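/- **Setting.** Let $d_x\ge 0$, $d_y\ge 1$ and $f,g:\mathbb R^{d_x}\times\mathbb R^{d_y}\to\mathbb R$. Assume, with Lipschitz continuity understood jointly in $(x,y)$ for the Euclidean (spectral, operator) norm: $g$ is three times differentiable and $g(x,\cdot)$ is $\mu$-strongly convex for every $x$ ($\mu>0$); $f$ is twice differentiable and $C$-Lipschitz; $\nabla f,\nabla g$ are $\ell$-Lipschitz; $\nabla^2 f,\nabla^2 g$ are $\rho$-Lipschitz; $\nabla^3 g$ is $\nu$-Lipschitz. Put $y^*(x)=\arg\min_y g(x,y)$ and $\varphi(x)=f(x,y^*(x))$, and assume $\varphi^*:=\inf\varphi>-\infty$. Let $\bar\ell=\max\{C,\ell,\nu,\rho\}$, $\kappa=\bar\ell/\mu$, $\mathcal L_\lambda(x,y)=f(x,y)+\lambda\,(g(x,y)-g(x,y^*(x)))$ and $y^*_\lambda(x)=\arg\min_y\mathcal L_\lambda(x,y)$. **AGD.** $\mathrm{AGD}(h,z_0,K,\eta,\theta)$ sets $\tilde z_0=z_0$, iterates $z_{k+1}=\tilde z_k-\eta\nabla h(\tilde z_k)$, $\tilde z_{k+1}=z_{k+1}+\theta(z_{k+1}-z_k)$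 for $k=0,\dots,K-1$, and returns $z_K$. **FSBA.** Given $x_0$, $\epsilon>0$, $M>0$, $T\in\mathbb N$, start from $y_{-1}=w_{-1}=0$ and for $t=0,\dots,T-1$ do: - $w_t=\mathrm{AGD}\big(g(x_t,\cdot),w_{t-1},K_t,\tfrac1{\ell},\tfrac{\sqrt{\kappa}-1}{\sqrt{\kappa}+1}\big)$ and $y_t=\mathrm{AGD}\big(\mathcal L_\lambda(x_t,\cdot),y_{t-1},K_t,\tfrac1{(1+\lambda)\ell},\tfrac{\sqrt{3\kappa}-1}{\sqrt{3\kappa}+1}\big)$; - $\mathbf g_t=\nabla_xf(x_t,y_t)+\lambda(\nabla_xg(x_t,y_t)-\nabla_xg(x_t,w_t))$ and $$\begin{aligned}\mathbf H_t={}&\nabla^2_{xx}f(x_t,y_t)+\lambda\big(\nabla^2_{xx}g(x_t,y_t)-\nabla^2_{xx}g(x_t,w_t)\big)\\&-\nabla^2_{xy}\mathcal L_\lambda(x_t,y_t)[\nabla^2_{yy}\mathcal L_\lambda(x_t,y_t)]^{-1}\nabla^2_{yx}\mathcal L_\lambda(x_t,y_t)\\&+\lambda\nabla^2_{xy}g(x_t,w_t)[\nabla^2_{yy}g(x_t,w_t)]^{-1}\nabla^2_{yx}g(x_t,w_t);\end{aligned}$$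 - $s_t$ is any minimizer of $s\mapsto \mathbf g_t^\top s+\tfrac12 s^\top\mathbf H_t s+\tfrac M6\|s\|^3$, and $x_{t+1}=x_t+s_t$; stop after this iteration if $\|s_t\|\le\tfrac12\sqrt{\epsilon/M}$. The output is $\hat x=x_{t+1}$ for the last executed iteration $t$. **Parameters.** Let $\Delta=\varphi(x_0)-\varphi^*>0$, $\lambda=\max\{\bar\ell\kappa^2/\Delta,\ \bar\ell\kappa^3/\epsilon,\ \bar\ell\kappa^5/\sqrt{M\epsilon}\}$, and suppose that $\lambda\ge 2\ell/\mu$. Let $R=\max\{\|y^*(x_0)\|,\|y^*_\lambda(x_0)\|\}$ and $\tilde\epsilon=\min\big\{\tfrac{\epsilon/192}{4\lambda\bar\ell},\tfrac{\sqrt{M\epsilon}/48}{2C_2}\big\}$, where $C_2>0$ satisfies $$\rho+\lambda\rho+(\ell+\lambda\ell)\Big(\tfrac{4(\rho+\lambda\rho)}{\lambda\mu}+\tfrac{4(\rho+\lambda\rho)(\ell+\lambda\ell)}{\lambda^2\mu^2}\Big)\le C_2\le a\,\lambda\bar\ell\kappa^2 .$$ Let $K_0=\big\lceil2\sqrt{3\kappa}\,\log\big(\tfrac{\sqrt{3\kappa+1}}{\tilde\epsilon}R\big)\big\rceil$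 and $K_t=\big\lceil2\sqrt{3\kappa}\,\log\big(\tfrac{\sqrt{3\kappa+1}}{\tilde\epsilon}(\tilde\epsilon+4\kappa\|s_{t-1}\|)\big)\big\rceil$ for $t\ge1$ (no step if the value is negative or $R=0$). **Theorem 3.4.** There are absolute constants $c_M,c_T>0$ such that for every $a>0$ there is a constant $A>0$, depending only on $a$, with the following property. In the setting above, if $$c_M\,\bar\ell\kappa^5\le M\le a\,\bar\ell\kappa^5,\qquad c_T\,\Delta\sqrt M\,\epsilon^{-3/2}\le T\le a\,\Delta\sqrt M\,\epsilon^{-3/2},$$ then for every run of FSBA: 1. $\varphi$ is twice continuously differentiable near $\hat x$, $\|\nabla\varphi(\hat x)\|\le A\epsilon$ and $\lambda_{\min}(\nabla^2\varphi(\hat x))\ge-A\,\kappa^{2.5}\bar\ell^{0.5}\epsilon^{0.5}$; 2. the number of evaluations of first-order information of $f$ or $g$ (one for each gradient of $g$ in AGD on $g(x_t,\cdot)$, two for each gradient of $\mathcal L_\lambda$, three for $\mathbf g_t$) is at most $$A\,\Delta\,\kappa^{3}\bar\ell^{0.5}\epsilon^{-1.5}\,\log\big(2+\kappa+\bar\ell+\tfrac1\epsilon+\Delta+\tfrac1\Delta+R\big);$$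 3. the number of evaluations of second-order information of $f$ or $g$ (three per iteration) is at most $A\,\Delta\,\kappa^{2.5}\bar\ell^{0.5}\epsilon^{-1.5}$. -/

import Mathlib

noncomputable section

namespace FSBA

/-! ### Calculus for functions of two blocks of variables -/

section Calculus

variable {E F : Type*} [NormedAddCommGroup E] [InnerProductSpace ℝ E] [CompleteSpace E]
  [NormedAddCommGroup F] [InnerProductSpace ℝ F] [CompleteSpace F]

/-- `h (x, y)` as a function on the Euclidean product space, whose norm is
`‖(x, y)‖ = √(‖x‖² + ‖y‖²)`. -/
def joint (h : E → F → ℝ) : WithLp 2 (E × F) → ℝ := fun z => h z.fst z.snd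

/-- The partial gradient `∇ₓ h (x, y)`. -/
def gradX (h : E → F → ℝ) (x : E) (y : F) : E := gradient (fun x' => h x' y) x

/-- The partial gradient `∇_y h (x, y)`. -/
def gradY (h : E → F → ℝ) (x : E) (y : F) : F := gradient (fun y' => h x y') y

/-- The Hessian block `∇²ₓₓ h (x, y)`. -/
def hessXX (h : E → F → ℝ) (x : E) (y : F) : E →L[ℝ] E := fderiv ℝ (fun x' => gradX h x' y) x

/-- The Hessian block `∇²ₓ_y h (x, y)`, which maps `y`-directions to `x`-directions. -/
def hessXY (h : E → F → ℝ) (x : E) (y : F) : F →L[ℝ] E := fderiv ℝ (fun y' => gradX h x y') y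

/-- The Hessian block `∇²_yₓ h (x, y)`, which maps `x`-directions to `y`-directions. -/
def hessYX (h : E → F → ℝ) (x : E) (y : F) : E →L[ℝ] F := fderiv ℝ (fun x' => gradY h x' y) x

/-- The Hessian block `∇²_yy h (x, y)`. -/
def hessYY (h : E → F → ℝ) (x : E) (y : F) : F →L[ℝ] F := fderiv ℝ (fun y' => gradY h x y') y

/-- A minimizer of `h` over the whole space (arbitrary if there is none). It is only used for
strongly convex functions, where the minimizer exists and is unique. -/
def argmin (h : F → ℝ) : F := Classical.epsilon fun v => ∀ v', h v ≤ h v'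

end Calculus

/-! ### The bilevel problem and its penalty proxy -/

section Bilevel

variable {E F : Type*} [NormedAddCommGroup E] [InnerProductSpace ℝ E] [CompleteSpace E]
  [NormedAddCommGroup F] [InnerProductSpace ℝ F] [CompleteSpace F]

/-- The lower-level solution `y*(x) = argmin_y g (x, y)`. -/
def yStar (g : E → F → ℝ) (x : E) : F := argmin (g x)

/-- The hyper-objective `φ(x) = f (x, y*(x))`. -/
def hyperObj (f g : E → F → ℝ) (x : E) : ℝ := f x (yStar g x)

/-- The Lagrangian `𝓛_λ (x, y) = f (x, y) + λ (g (x, y) - g (x, y*(x)))`. -/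
def lagrangian (f g : E → F → ℝ) (lam : ℝ) (x : E) (y : F) : ℝ :=
  f x y + lam * (g x y - g x (yStar g x))

/-- The penalized lower-level solution `y*_λ(x) = argmin_y 𝓛_λ (x, y)`. -/
def yStarLam (f g : E → F → ℝ) (lam : ℝ) (x : E) : F := argmin (lagrangian f g lam x)

/-- The smoothness and strong convexity assumptions on the pair `(f, g)`. The third (second)
derivative of `g` (of `f`) is assumed Lipschitz, so that "three times (twice) differentiable" is
the same as `C³` (`C²`) here. Norms of Hessians are spectral norms. -/
structure Assumptions (f g : E → F → ℝ) (μ C ℓ ρ ν : ℝ) : Prop where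
  mu_pos : 0 < μ
  g_smooth : ContDiff ℝ 3 (joint g)
  g_strong : ∀ x, StrongConvexOn Set.univ μ (g x)
  f_smooth : ContDiff ℝ 2 (joint f)
  f_lip : ∀ z z', |joint f z - joint f z'| ≤ C * ‖z - z'‖
  f_grad : ∀ z z', ‖gradient (joint f) z - gradient (joint f) z'‖ ≤ ℓ * ‖z - z'‖
  g_grad : ∀ z z', ‖gradient (joint g) z - gradient (joint g) z'‖ ≤ ℓ * ‖z - z'‖
  f_hess : ∀ z z', ‖fderiv ℝ (gradient (joint f)) z - fderiv ℝ (gradient (joint f)) z'‖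
    ≤ ρ * ‖z - z'‖
  g_hess : ∀ z z', ‖fderiv ℝ (gradient (joint g)) z - fderiv ℝ (gradient (joint g)) z'‖
    ≤ ρ * ‖z - z'‖
  g_third : ∀ z z', ‖iteratedFDeriv ℝ 3 (joint g) z - iteratedFDeriv ℝ 3 (joint g) z'‖
    ≤ ν * ‖z - z'‖
  phi_bdd : BddBelow (Set.range (hyperObj f g))

/-- `ℓ̄ = max {C, ℓ, ν, ρ}`. -/
def ellBar (C ℓ ρ ν : ℝ) : ℝ := max (max C ℓ) (max ν ρ)

/-- The condition number `κ = ℓ̄ / μ`. -/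
def kappa (μ C ℓ ρ ν : ℝ) : ℝ := ellBar C ℓ ρ ν / μ

/-- `Δ = φ(x₀) - φ*` with `φ* = inf φ`. -/
def gap (f g : E → F → ℝ) (x₀ : E) : ℝ := hyperObj f g x₀ - ⨅ x, hyperObj f g x

/-- `x` is an `(ε, τ)`-second-order stationary point of `φ`: `φ` is `C²` near `x`,
`‖∇φ(x)‖ ≤ ε`, and the smallest eigenvalue of the (symmetric) Hessian `∇²φ(x)` is at
least `-τ`. -/
def IsSOSP (φ : E → ℝ) (ε τ : ℝ) (x : E) : Prop :=
  ContDiffAt ℝ 2 φ x ∧ ‖gradient φ x‖ ≤ ε ∧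
    ∀ m : ℝ, Module.End.HasEigenvalue (fderiv ℝ (gradient φ) x : E →ₗ[ℝ] E) m → -τ ≤ m

end Bilevel

/-! ### The algorithms -/

section Algorithms

variable {E F : Type*} [NormedAddCommGroup E] [InnerProductSpace ℝ E] [CompleteSpace E]
  [NormedAddCommGroup F] [InnerProductSpace ℝ F] [CompleteSpace F]

/-- One step of accelerated gradient descent, acting on the pair `(z, z̃)`. It evaluates `∇h`
exactly once. -/
def agdStep (h : F → ℝ) (η θ : ℝ) (p : F × F) : F × F :=
  let z := p.2 - η • gradient h p.2
  (z, z + θ • (z - p.1))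

/-- `AGD (h, z₀, K, η, θ)`: the iterate `z_K`. -/
def agd (h : F → ℝ) (z₀ : F) (K : ℕ) (η θ : ℝ) : F := ((agdStep h η θ)^[K] (z₀, z₀)).1

/-- The momentum parameter `(√κ - 1) / (√κ + 1)`. -/
def momentum (κ : ℝ) : ℝ := (Real.sqrt κ - 1) / (Real.sqrt κ + 1)

/-- The gradient estimator
`∇ₓf (x, y) + λ (∇ₓg (x, y) - ∇ₓg (x, w))`. -/
def gradEst (f g : E → F → ℝ) (lam : ℝ) (x : E) (y w : F) : E :=
  gradX f x y + lam • (gradX g x y - gradX g x w)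

/-- The Hessian estimator
`∇²ₓₓf (x, y) + λ (∇²ₓₓg (x, y) - ∇²ₓₓg (x, w))
  - ∇²ₓ_y𝓛_λ (x, y) [∇²_yy𝓛_λ (x, y)]⁻¹ ∇²_yₓ𝓛_λ (x, y)
  + λ ∇²ₓ_yg (x, w) [∇²_yyg (x, w)]⁻¹ ∇²_yₓg (x, w)`. -/
def hessEst (f g : E → F → ℝ) (lam : ℝ) (x : E) (y w : F) : E →L[ℝ] E :=
  hessXX f x y + lam • (hessXX g x y - hessXX g x w)
    - hessXY (lagrangian f g lam) x y ∘L Ring.inverse (hessYY (lagrangian f g lam) x y)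
        ∘L hessYX (lagrangian f g lam) x y
    + lam • (hessXY g x w ∘L Ring.inverse (hessYY g x w) ∘L hessYX g x w)

/-- The cubic model `⟨u, s⟩ + ½ ⟨s, H s⟩ + (M / 6) ‖s‖³`. -/
def cubicModel (u : E) (H : E →L[ℝ] E) (M : ℝ) (s : E) : ℝ :=
  inner ℝ u s + 1 / 2 * inner ℝ s (H s) + M / 6 * ‖s‖ ^ 3

/-- A complete execution of FSBA. The number of executed iterations is `N`; they are
`t = 0, …, N - 1`. The sequences `w`, `y` are shifted by one: `w t` is the iterate `w_{t-1}` and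
`w (t + 1)` the iterate `w_t` (likewise for `y`), so that `w 0 = w_{-1} = 0`.
The cubic model may have several minimizers; `s t` is any one of them. The run ends after the
first iteration with `‖s_t‖ ≤ ½ √(ε / M)`, and after `T` iterations at the latest; the point
`x_{t+1} = x_t + s_t` of the last iteration is the output. -/
structure Run (f g : E → F → ℝ) (lam : ℝ) (x₀ : E) (T : ℕ) (ℓ₁ ℓ₂ κ₁ κ₂ ε M : ℝ)
    (K₁ K₂ : ℕ → ℕ) where
  N : ℕ
  x : ℕ → E
  w : ℕ → F
  y : ℕ → F
  s : ℕ → E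
  x_zero : x 0 = x₀
  w_zero : w 0 = 0
  y_zero : y 0 = 0
  w_step : ∀ t < N, w (t + 1) = agd (g (x t)) (w t) (K₁ t) (1 / ℓ₁) (momentum κ₁)
  y_step : ∀ t < N,
    y (t + 1) = agd (lagrangian f g lam (x t)) (y t) (K₂ t) (1 / ℓ₂) (momentum κ₂)
  s_min : ∀ t < N, ∀ s' : E,
    cubicModel (gradEst f g lam (x t) (y (t + 1)) (w (t + 1)))
        (hessEst f g lam (x t) (y (t + 1)) (w (t + 1))) M (s t)
      ≤ cubicModel (gradEst f g lam (x t) (y (t + 1)) (w (t + 1)))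
        (hessEst f g lam (x t) (y (t + 1)) (w (t + 1))) M s'
  x_step : ∀ t < N, x (t + 1) = x t + s t
  N_le : N ≤ T
  no_break : ∀ t, t + 1 < N → 1 / 2 * Real.sqrt (ε / M) < ‖s t‖
  ends : N = T ∨ ∃ t, N = t + 1 ∧ ‖s t‖ ≤ 1 / 2 * Real.sqrt (ε / M)

variable {f g : E → F → ℝ} {lam : ℝ} {x₀ : E} {T : ℕ} {ℓ₁ ℓ₂ κ₁ κ₂ ε M : ℝ} {K₁ K₂ : ℕ → ℕ}

/-- The output `x̂` of a run. -/
def Run.output (r : Run f g lam x₀ T ℓ₁ ℓ₂ κ₁ κ₂ ε M K₁ K₂) : E := r.x r.N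

/-- The number of calls to the first-order oracles of `f` and `g`: each of the `K₁ t` steps of
AGD on `g (x_t, ·)` evaluates one gradient of `g`, each of the `K₂ t` steps of AGD on
`𝓛_λ (x_t, ·)` evaluates one gradient of `f` and one of `g`, and the gradient estimator
evaluates `∇ₓf (x_t, y_t)`, `∇ₓg (x_t, y_t)` and `∇ₓg (x_t, w_t)`. -/
def Run.firstOrderCalls (r : Run f g lam x₀ T ℓ₁ ℓ₂ κ₁ κ₂ ε M K₁ K₂) : ℕ :=
  ∑ t ∈ Finset.range r.N, (K₁ t + 2 * K₂ t + 3)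

/-- The number of calls to the second-order oracles of `f` and `g`: the Hessian estimator
evaluates `∇²f (x_t, y_t)`, `∇²g (x_t, y_t)` and `∇²g (x_t, w_t)` in each iteration. -/
def Run.secondOrderCalls (r : Run f g lam x₀ T ℓ₁ ℓ₂ κ₁ κ₂ ε M K₁ K₂) : ℕ :=
  ∑ _t ∈ Finset.range r.N, 3

end Algorithms

/-! ### The parameters -/

/-- `λ = max {ℓ̄ κ² / Δ, ℓ̄ κ³ / ε, ℓ̄ κ⁵ / √(M ε)}`. -/
def penalty (ℓb κ Δ ε M : ℝ) : ℝ :=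
  max (ℓb * κ ^ 2 / Δ) (max (ℓb * κ ^ 3 / ε) (ℓb * κ ^ 5 / Real.sqrt (M * ε)))

/-- `ρ + λρ + (ℓ + λℓ) (4 (ρ + λρ) / (λμ) + 4 (ρ + λρ) (ℓ + λℓ) / (λ² μ²))`, a bound for the
sensitivity of the Hessian estimator in `y`. -/
def hessSens (μ ℓ ρ lam : ℝ) : ℝ :=
  ρ + lam * ρ + (ℓ + lam * ℓ) * (4 * (ρ + lam * ρ) / (lam * μ)
    + 4 * (ρ + lam * ρ) * (ℓ + lam * ℓ) / (lam ^ 2 * μ ^ 2))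

/-- The inner accuracy `ε̃ = min {C_g ε / (4 λ ℓ̄), C_H √(M ε) / (2 C₂)}` with `C_g = 1/192` and
`C_H = 1/48`. -/
def innerAcc (ℓb lam ε M C₂ : ℝ) : ℝ :=
  min (1 / 192 * ε / (4 * lam * ℓb)) (1 / 48 * Real.sqrt (M * ε) / (2 * C₂))

/-- The number of AGD steps in iteration `t`:
`⌈2 √κ₂ log ((√(κ₂ + 1) / ε̃) R)⌉` for `t = 0` and
`⌈2 √κ₂ log ((√(κ₂ + 1) / ε̃) (ε̃ + 4 κ ‖s_{t-1}‖))⌉` for `t ≥ 1`, where negative values (and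
the value `-∞` for `R = 0`) mean no step. -/
def innerSteps {E : Type*} [NormedAddCommGroup E] (κ κ₂ acc R : ℝ) (s : ℕ → E) : ℕ → ℕ
  | 0 => ⌈2 * Real.sqrt κ₂ * Real.log (Real.sqrt (κ₂ + 1) / acc * R)⌉₊
  | t + 1 => ⌈2 * Real.sqrt κ₂ *
      Real.log (Real.sqrt (κ₂ + 1) / acc * (acc + 4 * κ * ‖s t‖))⌉₊

end FSBA

end

/-! The method is an inexact cubic-regularized Newton method, not for φ itself but for `proxy`, Φ(x)
= min_y (f + λg) − λ min_y g. Everything rests on bounds for Φ that do not deteriorate as λ grows.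
Write Λ for the common Lipschitz bound and κ = Λ/μ.

At y*_λ the optimality condition is ∇_y f = −λ∇_y g, so y*_λ and y* differ by at most κ/λ
(`Reg.norm_minY_sub_le`). The Hessian of Φ is a difference of two Schur complements, each of order
λ. The polarization identity `IsSens.schur_sub` rewrites it as one form, `gapForm`, evaluated on the
lifts of the two sensitivity maps. This form is ∇²f plus λ times a difference of ∇²g over a distance
of order 1/λ, so it is bounded and Lipschitz uniformly in λ. Hence ∇²Φ is Lipschitz with constant
352Λκ⁵ (`Reg.proxyH_lip`). Expansion around y* gives |φ − Φ| ≤ Λκ/λ, gradients within 4Λκ³/λ, and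
Hessian quadratic forms within 48Λκ⁵/λ times ‖v‖². The three terms of the maximum defining λ make
these errors comparable with Δ, ε and √(Mε).

The estimators agree with the derivatives of Φ when the inner iterates are exact minimizers. A
Lyapunov argument shows that the prescribed number of AGD steps gives accuracy ε̃, since the
previous iterate is a warm start and the minimizers move by at most 3κ‖s‖
(`Assumptions.run_errors`). Put q = √(ε/M). A step longer than q/2 lowers Φ by at least Mq³/192
(`CubicStep.descent`), while Φ can fall by at most 2Δ, so T ≥ 400Δ/(Mq³) forces a short step. After
a short step, the first- and second-order conditions of the cubic model give stationarity
(`CubicStep.norm_deriv_le`, `CubicStep.hess_ge`), which transfers to φ.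

For the oracle counts, all arguments of the logarithms are bounded by a constant times a power of
the sum P of the problem parameters. The bound M‖s_t‖³ ≤ 48Δ, again from the total decrease,
controls the warm-start distances. -/

noncomputable section
set_option linter.unusedSectionVars false
namespace FSBA

/-! ### Linear convergence of accelerated gradient descent. -/

section Agd

variable {F : Type*} [NormedAddCommGroup F] [InnerProductSpace ℝ F] [CompleteSpace F]

/-- The Lyapunov function of accelerated gradient descent. -/
def agdEnergy (h : F → ℝ) (zs : F) (m r : ℝ) (p : F × F) : ℝ :=
  h p.1 - h zs + m / 2 * ‖p.2 + r • (p.2 - p.1) - zs‖ ^ 2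

/-- With G = ∇h(z̃), smoothness at z̃ yields the decrease ‖G‖²/(2L). The strong convexity bounds
from z̃ towards z and towards `zs` enter with weights 1 − 1/r and 1/r, and then all inner products
with G cancel because m·r/L = 1/r. -/
theorem agdEnergy_step_le {h : F → ℝ} {zs : F} {m L r : ℝ} (hr : 1 ≤ r) (hm : 0 < m)
    (hL : L = m * r ^ 2)
    (hlow : ∀ y y', h y + inner ℝ (gradient h y) (y' - y) + m / 2 * ‖y' - y‖ ^ 2 ≤ h y')
    (hup : ∀ y y', h y' ≤ h y + inner ℝ (gradient h y) (y' - y) + L / 2 * ‖y' - y‖ ^ 2)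
    (p : F × F) :
    agdEnergy h zs m r (agdStep h (1 / L) ((r - 1) / (r + 1)) p)
      ≤ (1 - 1 / r) * agdEnergy h zs m r p := by
  obtain ⟨z, zt⟩ := p
  have hr0 : 0 < r := by linarith
  have hLpos : 0 < L := by rw [hL]; positivity
  set G := gradient h zt with hG
  set a := zt - zs with ha
  set b := zt - z with hb
  have h1 := hup zt (zt - (1 / L) • G)
  have h2 := hlow zt z
  have h3 := hlow zt zs
  have e1 : zt - (1 / L) • G - zt = -((1 / L) • G) := by abel
  have e2 : z - zt = -b := by rw [hb]; abel
  have e3 : zs - zt = -a := by rw [ha]; abel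
  rw [← hG, e1, inner_neg_right, norm_neg, inner_smul_right, norm_smul, real_inner_self_eq_norm_sq,
    Real.norm_of_nonneg (by positivity)] at h1
  rw [← hG, e2, inner_neg_right, norm_neg] at h2
  rw [← hG, e3, inner_neg_right, norm_neg] at h3
  have e4 : (zt - (1 / L) • G) + ((r - 1) / (r + 1)) • ((zt - (1 / L) • G) - z)
      + r • ((zt - (1 / L) • G) + ((r - 1) / (r + 1)) • ((zt - (1 / L) • G) - z)
        - (zt - (1 / L) • G)) - zs = a + (r - 1) • b - (r / L) • G := by
    -- The momentum θ satisfies θ(1 + r) = r − 1; this collapses the updated auxiliary point to a +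
    -- (r − 1)b − (r/L)G.
    have : ((r - 1) / (r + 1)) * (1 + r) = r - 1 := by field_simp; ring
    have h' : (zt - (1 / L) • G) + ((r - 1) / (r + 1)) • ((zt - (1 / L) • G) - z)
      + r • ((zt - (1 / L) • G) + ((r - 1) / (r + 1)) • ((zt - (1 / L) • G) - z)
        - (zt - (1 / L) • G)) - zs
        = a - (1 / L) • G + (((r - 1) / (r + 1)) * (1 + r)) • (b - (1 / L) • G) := by
      rw [ha, hb]; module
    rw [h', this]; module
  have e5 : zt + r • (zt - z) - zs = a + r • b := by rw [ha, hb]; module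
  simp only [agdEnergy, agdStep]
  rw [← hG, e4, e5]
  have n1 : ‖a + (r - 1) • b - (r / L) • G‖ ^ 2 = ‖a‖ ^ 2 + (r - 1) ^ 2 * ‖b‖ ^ 2
      + (r / L) ^ 2 * ‖G‖ ^ 2 + 2 * (r - 1) * inner ℝ a b - 2 * (r / L) * inner ℝ G a
      - 2 * (r - 1) * (r / L) * inner ℝ G b := by
    rw [norm_sub_sq_real, norm_add_sq_real, norm_smul, norm_smul, inner_smul_right,
      inner_add_left, inner_smul_right, inner_smul_right, real_inner_smul_left, mul_pow, mul_pow,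
      Real.norm_eq_abs, Real.norm_eq_abs, sq_abs, sq_abs, real_inner_comm G a,
      real_inner_comm G b]
    ring
  have n2 : ‖a + r • b‖ ^ 2 = ‖a‖ ^ 2 + r ^ 2 * ‖b‖ ^ 2 + 2 * r * inner ℝ a b := by
    rw [norm_add_sq_real, norm_smul, inner_smul_right, mul_pow, Real.norm_eq_abs, sq_abs]
    ring
  rw [n1, n2]
  set A := ‖a‖ ^ 2
  set Bb := ‖b‖ ^ 2
  set N := ‖G‖ ^ 2
  set ab : ℝ := inner ℝ a b
  set ga : ℝ := inner ℝ G a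
  set gb : ℝ := inner ℝ G b
  have hBb : 0 ≤ Bb := by positivity
  have k1 : 1 / L * N - L / 2 * (1 / L * ‖G‖) ^ 2 = m / 2 * (r / L) ^ 2 * N := by
    rw [mul_pow, hL]; field_simp; ring
  have k2 : m * (r / L) = 1 / r := by rw [hL]; field_simp
  have hi : 0 < 1 / r := by positivity
  have hi1 : 1 / r ≤ 1 := by rw [div_le_one hr0]; exact hr
  have q2 := mul_le_mul_of_nonneg_left h2 (sub_nonneg.2 hi1)
  have q3 := mul_le_mul_of_nonneg_left h3 hi.le
  -- On the right, r² comes from the old energy and 1 from strong convexity towards z.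
  have hb2 : m / 2 * (r - 1) ^ 2 * Bb ≤ m / 2 * ((1 - 1 / r) * (1 + r ^ 2)) * Bb := by
    have : (r - 1) ^ 2 ≤ (1 - 1 / r) * (1 + r ^ 2) := by
      have : (1 - 1 / r) * (1 + r ^ 2) - (r - 1) ^ 2 = (1 - 1 / r) * (1 + r) := by
        field_simp; ring
      have h0 : 0 ≤ (1 - 1 / r) * (1 + r) := mul_nonneg (by linarith) (by linarith)
      linarith
    gcongr
  have kk1 : m / 2 * (-2 * (r / L) * ga) = - (1 / r * ga) := by rw [← k2]; ring
  have kk2 : m / 2 * (2 * (r - 1) * (r / L) * gb) = (1 - 1 / r) * gb := by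
    rw [show m / 2 * (2 * (r - 1) * (r / L) * gb) = (r - 1) * (m * (r / L)) * gb by ring, k2]
    field_simp
  have kk3 : (1 - 1 / r) * (m / 2 * (2 * r * ab)) = m / 2 * (2 * (r - 1) * ab) := by
    field_simp
  nlinarith [h1, q2, q3, hb2, k1, kk1, kk2, kk3]

/-- The energy dominates (m/2)‖z_K − zs‖² because `zs` is stationary, and initially it is at most (L
+ m)/2 · ‖z₀ − zs‖²; hence the factor r² + 1. -/
theorem agd_norm_sub_sq_le {h : F → ℝ} {zs : F} {m L r : ℝ} (hr : 1 ≤ r) (hm : 0 < m)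
    (hL : L = m * r ^ 2)
    (hlow : ∀ y y', h y + inner ℝ (gradient h y) (y' - y) + m / 2 * ‖y' - y‖ ^ 2 ≤ h y')
    (hup : ∀ y y', h y' ≤ h y + inner ℝ (gradient h y) (y' - y) + L / 2 * ‖y' - y‖ ^ 2)
    (hzs : gradient h zs = 0) (z₀ : F) (K : ℕ) :
    ‖agd h z₀ K (1 / L) ((r - 1) / (r + 1)) - zs‖ ^ 2
      ≤ (r ^ 2 + 1) * (1 - 1 / r) ^ K * ‖z₀ - zs‖ ^ 2 := by
  have hr0 : 0 < r := by linarith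
  have hi1 : 1 / r ≤ 1 := by rw [div_le_one hr0]; exact hr
  have hK : agdEnergy h zs m r ((agdStep h (1 / L) ((r - 1) / (r + 1)))^[K] (z₀, z₀))
      ≤ (1 - 1 / r) ^ K * agdEnergy h zs m r (z₀, z₀) := by
    induction K with
    | zero => simp
    | succ k ih =>
      rw [Function.iterate_succ_apply', pow_succ', mul_assoc]
      exact (agdEnergy_step_le hr hm hL hlow hup _).trans
        (mul_le_mul_of_nonneg_left ih (by linarith))
  have h1 := hlow zs (agd h z₀ K (1 / L) ((r - 1) / (r + 1)))
  have h2 := hup zs z₀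
  rw [hzs, inner_zero_left] at h1 h2
  have h0 : agdEnergy h zs m r (z₀, z₀) ≤ m / 2 * ((r ^ 2 + 1) * ‖z₀ - zs‖ ^ 2) := by
    simp only [agdEnergy, sub_self, smul_zero, add_zero]
    rw [hL] at h2
    linarith
  have h3 : m / 2 * ‖agd h z₀ K (1 / L) ((r - 1) / (r + 1)) - zs‖ ^ 2 ≤
      agdEnergy h zs m r ((agdStep h (1 / L) ((r - 1) / (r + 1)))^[K] (z₀, z₀)) := by
    simp only [agdEnergy]
    have : 0 ≤ m / 2 * ‖((agdStep h (1 / L) ((r - 1) / (r + 1)))^[K] (z₀, z₀)).2 +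
        r • (((agdStep h (1 / L) ((r - 1) / (r + 1)))^[K] (z₀, z₀)).2 -
          ((agdStep h (1 / L) ((r - 1) / (r + 1)))^[K] (z₀, z₀)).1) - zs‖ ^ 2 := by positivity
    simp only [agd] at h1 ⊢
    linarith
  have h4 := mul_le_mul_of_nonneg_left h0 (pow_nonneg (sub_nonneg.2 hi1) K)
  have h5 : m / 2 * ‖agd h z₀ K (1 / L) ((r - 1) / (r + 1)) - zs‖ ^ 2 ≤
      m / 2 * ((r ^ 2 + 1) * (1 - 1 / r) ^ K * ‖z₀ - zs‖ ^ 2) := by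
    calc _ ≤ _ := h3.trans (hK.trans h4)
      _ = _ := by ring
  exact le_of_mul_le_mul_left h5 (by positivity)

/-- With the prescribed number of steps AGD reaches the accuracy `acc`. -/
theorem agd_norm_sub_le {h : F → ℝ} {zs : F} {m L κ κ₂ acc D : ℝ} (hκ : 1 ≤ κ) (hκ₂ : κ ≤ κ₂)
    (hm : 0 < m) (hL : L = m * κ)
    (hlow : ∀ y y', h y + inner ℝ (gradient h y) (y' - y) + m / 2 * ‖y' - y‖ ^ 2 ≤ h y')
    (hup : ∀ y y', h y' ≤ h y + inner ℝ (gradient h y) (y' - y) + L / 2 * ‖y' - y‖ ^ 2)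
    (hzs : gradient h zs = 0) {z₀ : F} {K : ℕ} (hacc : 0 < acc) (hD : ‖z₀ - zs‖ ≤ D)
    (hK : 2 * Real.sqrt κ₂ * Real.log (Real.sqrt (κ₂ + 1) / acc * D) ≤ K) :
    ‖agd h z₀ K (1 / L) (momentum κ) - zs‖ ≤ acc := by
  have hs : 1 ≤ Real.sqrt κ := Real.one_le_sqrt.2 hκ
  have hsq : Real.sqrt κ ^ 2 = κ := Real.sq_sqrt (by linarith)
  have h1 := agd_norm_sub_sq_le hs hm (by rw [hsq]; exact hL) hlow hup hzs z₀ K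
  rw [hsq] at h1
  have hD0 : 0 ≤ D := (norm_nonneg _).trans hD
  refine le_of_sq_le_sq ?_ hacc.le
  refine h1.trans ?_
  rcases hD0.eq_or_lt with h0 | hDpos
  · have : ‖z₀ - zs‖ = 0 := le_antisymm (hD.trans h0.ge) (norm_nonneg _)
    rw [this]; simp; positivity
  have hs2 : Real.sqrt κ ≤ Real.sqrt κ₂ := Real.sqrt_le_sqrt hκ₂
  have hi : 1 / Real.sqrt κ ≤ 1 := by rw [div_le_one (by linarith)]; exact hs
  set X := Real.sqrt (κ₂ + 1) / acc * D with hX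
  have hXpos : 0 < X := by
    have : 0 < Real.sqrt (κ₂ + 1) := Real.sqrt_pos.2 (by linarith)
    positivity
  -- X² = (κ₂ + 1)D²/acc² is the contraction required. A negative log X does no harm here.
  have h2 : (1 - 1 / Real.sqrt κ) ^ K ≤ (X ^ 2)⁻¹ := by
    have e1 : (1 - 1 / Real.sqrt κ) ≤ Real.exp (- (1 / Real.sqrt κ)) := by
      have := Real.add_one_le_exp (- (1 / Real.sqrt κ)); linarith
    have e2 : Real.exp (- (1 / Real.sqrt κ)) ≤ Real.exp (- (1 / Real.sqrt κ₂)) := by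
      apply Real.exp_le_exp.2
      have : 1 / Real.sqrt κ₂ ≤ 1 / Real.sqrt κ := by gcongr
      linarith
    calc (1 - 1 / Real.sqrt κ) ^ K ≤ (Real.exp (- (1 / Real.sqrt κ₂))) ^ K :=
          pow_le_pow_left₀ (by linarith) (e1.trans e2) K
      _ = Real.exp (- (K / Real.sqrt κ₂)) := by
          rw [← Real.exp_nat_mul]; congr 1; ring
      _ ≤ Real.exp (- (2 * Real.log X)) := by
          apply Real.exp_le_exp.2
          rw [neg_le_neg_iff, le_div_iff₀ (by linarith)]
          linarith
      _ = (X ^ 2)⁻¹ := by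
          rw [Real.exp_neg, two_mul, Real.exp_add, Real.exp_log hXpos, sq]
  calc (κ + 1) * (1 - 1 / Real.sqrt κ) ^ K * ‖z₀ - zs‖ ^ 2
      ≤ (κ₂ + 1) * (X ^ 2)⁻¹ * D ^ 2 := by
        have : 0 ≤ (1 - 1 / Real.sqrt κ) ^ K := pow_nonneg (by linarith) _
        have : 0 ≤ κ₂ + 1 := by linarith
        gcongr
    _ = acc ^ 2 := by
        rw [hX, mul_pow, div_pow, Real.sq_sqrt (by linarith)]
        have : κ₂ + 1 ≠ 0 := by linarith
        field_simp

end Agd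

/-! ### Optimality conditions at a global minimizer of the cubic model. -/

section Cubic

variable {E : Type*} [NormedAddCommGroup E] [InnerProductSpace ℝ E]

theorem hasFDerivAt_cubicModel {u : E} {H : E →L[ℝ] E} {M : ℝ}
    (hH : ∀ v w, inner ℝ (H v) w = inner ℝ v (H w)) (s : E) :
    HasFDerivAt (cubicModel u H M) (innerSL ℝ (u + H s + (M / 2 * ‖s‖) • s)) s := by
  have h1 : HasFDerivAt (fun s : E => ‖s‖ ^ 3) ((3 * ‖s‖) • innerSL ℝ s) s := by
    have := hasFDerivAt_norm_rpow s (p := 3) (by norm_num)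
    convert this using 1
    · ext x; norm_cast
    · norm_num
  have h2 : HasFDerivAt (fun s : E => (inner ℝ s (H s) : ℝ))
      ((fderivInnerCLM ℝ (s, H s)).comp ((ContinuousLinearMap.id ℝ E).prod H)) s :=
    (hasFDerivAt_id s).inner ℝ H.hasFDerivAt
  have h3 : HasFDerivAt (fun s : E => (inner ℝ u s : ℝ)) (innerSL ℝ u) s :=
    (innerSL ℝ u).hasFDerivAt
  have := (h3.add (h2.const_mul (1 / 2))).add (h1.const_mul (M / 6))
  refine this.congr_fderiv ?_
  ext d
  simp [← hH]
  rw [hH d s, real_inner_comm (H s) d]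
  ring

theorem cubicModel_stationary [CompleteSpace E] {u s : E} {H : E →L[ℝ] E} {M : ℝ}
    (hH : ∀ v w, inner ℝ (H v) w = inner ℝ v (H w))
    (hs : ∀ s', cubicModel u H M s ≤ cubicModel u H M s') :
    u + H s + (M / 2 * ‖s‖) • s = 0 := by
  have h1 : IsLocalMin (cubicModel u H M) s := Filter.Eventually.of_forall hs
  have h2 := h1.hasFDerivAt_eq_zero (hasFDerivAt_cubicModel hH s)
  have h3 := congrArg (fun T : E →L[ℝ] ℝ => T (u + H s + (M / 2 * ‖s‖) • s)) h2
  rwa [innerSL_apply_apply, zero_apply, inner_self_eq_zero] at h3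

theorem nonneg_of_quadratic_nonneg {c₀ c₁ c₂ : ℝ}
    (h : ∀ t : ℝ, 0 < t → 0 ≤ c₀ + t * c₁ + t ^ 2 * c₂) : 0 ≤ c₀ := by
  have hc : Filter.Tendsto (fun t : ℝ => c₀ + t * c₁ + t ^ 2 * c₂) (nhdsWithin 0 (Set.Ioi 0))
      (nhds c₀) := by
    have : Continuous (fun t : ℝ => c₀ + t * c₁ + t ^ 2 * c₂) := by fun_prop
    simpa using (this.tendsto 0).mono_left nhdsWithin_le_nhds
  exact ge_of_tendsto hc (Filter.eventually_of_mem self_mem_nhdsWithin fun t ht => h t ht)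

/-- The second-order condition at a global minimizer of the cubic model. -/
theorem cubicModel_hess_nonneg [CompleteSpace E] {u s : E} {H : E →L[ℝ] E} {M : ℝ}
    (hH : ∀ v w, inner ℝ (H v) w = inner ℝ v (H w))
    (hs : ∀ s', cubicModel u H M s ≤ cubicModel u H M s') (d : E) :
    0 ≤ inner ℝ d (H d) + M / 2 * ‖s‖ * ‖d‖ ^ 2 := by
  have hst := cubicModel_stationary hH hs
  by_cases hs0 : s = 0
  · subst hs0
    have hu : u = 0 := by simpa using hst
    have : 0 ≤ (inner ℝ d (H d) : ℝ) := by
      apply nonneg_of_quadratic_nonneg (c₁ := M / 3 * ‖d‖ ^ 3) (c₂ := 0)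
      intro t ht
      have := hs (t • d)
      simp only [cubicModel, hu, inner_zero_left, norm_zero, map_smul, norm_smul,
        real_inner_smul_left, real_inner_smul_right, Real.norm_of_nonneg ht.le] at this
      simp only [ne_eq, OfNat.ofNat_ne_zero, not_false_eq_true, zero_pow, mul_zero, add_zero,
        zero_add] at this
      have h' : 0 ≤ t ^ 2 * (inner ℝ d (H d) + t * (M / 3 * ‖d‖ ^ 3)) := by nlinarith
      have := nonneg_of_mul_nonneg_right h' (by positivity)
      linarith
    simpa using this
  -- For e not orthogonal to s, the reflected point s + c e lies on the sphere through s. The cubic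
  -- term is unchanged there, so comparing model values leaves c²/2 times the desired quadratic
  -- form.
  have key : ∀ e : E, (inner ℝ s e : ℝ) ≠ 0 → 0 ≤ inner ℝ e (H e) + M / 2 * ‖s‖ * ‖e‖ ^ 2 := by
    intro e he
    have he0 : e ≠ 0 := by rintro rfl; simp at he
    have hen : 0 < ‖e‖ ^ 2 := by positivity
    obtain ⟨c, hc⟩ : ∃ c : ℝ, c = - (2 * inner ℝ s e / ‖e‖ ^ 2) := ⟨_, rfl⟩
    have hc0 : c ≠ 0 := by
      rw [hc]; exact neg_ne_zero.2 (div_ne_zero (mul_ne_zero two_ne_zero he) hen.ne')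
    have hce : c * ‖e‖ ^ 2 = -2 * inner ℝ s e := by rw [hc]; field_simp
    have hn : ‖s + c • e‖ ^ 2 = ‖s‖ ^ 2 := by
      rw [norm_add_sq_real, norm_smul, inner_smul_right, mul_pow, Real.norm_eq_abs, sq_abs]
      linear_combination c * hce
    have hn' : ‖s + c • e‖ = ‖s‖ := by
      exact (sq_eq_sq₀ (norm_nonneg _) (norm_nonneg _)).1 hn
    have h1 := hs (s + c • e)
    have h2 := congrArg (fun v : E => (inner ℝ v e : ℝ)) hst
    simp only [inner_add_left, real_inner_smul_left, inner_zero_left] at h2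
    simp only [cubicModel, hn', map_add, map_smul, inner_add_left, inner_add_right,
      real_inner_smul_left, real_inner_smul_right] at h1
    rw [← hH s e, real_inner_comm (H s) e] at h1
    have h3 : 0 ≤ c ^ 2 * (inner ℝ e (H e) + M / 2 * ‖s‖ * ‖e‖ ^ 2) := by
      linear_combination 2 * h1 + 2 * c * h2 - c * M / 2 * ‖s‖ * hce
    exact nonneg_of_mul_nonneg_right h3 (by positivity)
  -- A direction d orthogonal to s is the limit of d + t s, to which `key` applies.
  by_cases hd : (inner ℝ s d : ℝ) = 0
  · apply nonneg_of_quadratic_nonneg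
      (c₁ := 2 * inner ℝ d (H s)) (c₂ := inner ℝ s (H s) + M / 2 * ‖s‖ * ‖s‖ ^ 2)
    intro t ht
    have := key (d + t • s) (by
      rw [inner_add_right, hd, inner_smul_right, zero_add, real_inner_self_eq_norm_sq]
      have : 0 < ‖s‖ := norm_pos_iff.2 hs0
      positivity)
    rw [norm_add_sq_real, norm_smul, inner_smul_right, real_inner_comm s d, hd, mul_pow,
      Real.norm_eq_abs, sq_abs, map_add, map_smul] at this
    simp only [inner_add_left, inner_add_right, real_inner_smul_left,
      real_inner_smul_right] at this
    rw [← hH s d, real_inner_comm d (H s)] at this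
    linear_combination this
  · exact key d hd

/-- Stationarity tested with s reduces the model to −½⟨s, Hs⟩ − (M/3)‖s‖³, and the second-order
condition in direction s bounds the first term by (M/4)‖s‖³. -/
theorem cubicModel_le [CompleteSpace E] {u s : E} {H : E →L[ℝ] E} {M : ℝ}
    (hH : ∀ v w, inner ℝ (H v) w = inner ℝ v (H w))
    (hs : ∀ s', cubicModel u H M s ≤ cubicModel u H M s') :
    cubicModel u H M s ≤ - (M / 12) * ‖s‖ ^ 3 := by
  have h1 := cubicModel_hess_nonneg hH hs s
  have h2 := congrArg (fun v : E => (inner ℝ v s : ℝ)) (cubicModel_stationary hH hs)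
  simp only [inner_add_left, real_inner_smul_left, inner_zero_left,
    real_inner_self_eq_norm_sq] at h2
  rw [real_inner_comm s (H s)] at h2
  simp only [cubicModel]
  nlinarith

end Cubic

end FSBA
end

noncomputable section
set_option linter.unusedSectionVars false
set_option maxSynthPendingDepth 3
namespace FSBA

/-! ### Bilinear forms on the Euclidean product and their sensitivity maps. -/

section Blocks

variable {E F : Type*} [NormedAddCommGroup E] [InnerProductSpace ℝ E]
  [NormedAddCommGroup F] [InnerProductSpace ℝ F]

/-- The Euclidean product space. It is `WithLp 2 (E × F)`, with the topology that comes from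
the norm. -/
def Prd (E F : Type*) : Type _ := WithLp 2 (E × F)

instance : NormedAddCommGroup (Prd E F) := inferInstanceAs (NormedAddCommGroup (WithLp 2 (E × F)))

instance : InnerProductSpace ℝ (Prd E F) :=
  inferInstanceAs (InnerProductSpace ℝ (WithLp 2 (E × F)))

instance [CompleteSpace E] [CompleteSpace F] : CompleteSpace (Prd E F) :=
  inferInstanceAs (CompleteSpace (WithLp 2 (E × F)))

/-- The point `(x, y)` of the Euclidean product space. -/
def pt {E F : Type*} (x : E) (y : F) : Prd E F := WithLp.toLp 2 (x, y)

/-- The embedding `u ↦ (u, 0)`. -/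
def inX (E F : Type*) [NormedAddCommGroup E] [InnerProductSpace ℝ E]
    [NormedAddCommGroup F] [InnerProductSpace ℝ F] : E →L[ℝ] Prd E F :=
  LinearMap.mkContinuous
    { toFun := fun u => pt u 0
      map_add' := fun u v => by
        have : WithLp.toLp 2 (u + v, (0 : F)) = WithLp.toLp 2 (u, 0) + WithLp.toLp 2 (v, 0) := by
          simp [← WithLp.toLp_add]
        exact this
      map_smul' := fun c u => by
        have : WithLp.toLp 2 (c • u, (0 : F)) = c • WithLp.toLp 2 (u, 0) := by
          simp [← WithLp.toLp_smul]
        exact this } 1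
    fun u => by rw [one_mul]; exact (WithLp.norm_toLp_fst 2 E F u).le

/-- The embedding `w ↦ (0, w)`. -/
def inY (E F : Type*) [NormedAddCommGroup E] [InnerProductSpace ℝ E]
    [NormedAddCommGroup F] [InnerProductSpace ℝ F] : F →L[ℝ] Prd E F :=
  LinearMap.mkContinuous
    { toFun := fun w => pt 0 w
      map_add' := fun u v => by
        have : WithLp.toLp 2 ((0 : E), u + v) = WithLp.toLp 2 (0, u) + WithLp.toLp 2 (0, v) := by
          simp [← WithLp.toLp_add]
        exact this
      map_smul' := fun c u => by
        have : WithLp.toLp 2 ((0 : E), c • u) = c • WithLp.toLp 2 (0, u) := by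
          simp [← WithLp.toLp_smul]
        exact this } 1
    fun u => by rw [one_mul]; exact (WithLp.norm_toLp_snd 2 E F u).le

theorem pt_eq (x : E) (y : F) : pt x y = inX E F x + inY E F y := by
  have : WithLp.toLp 2 (x, y) = WithLp.toLp 2 (x, 0) + WithLp.toLp 2 (0, y) := by
    simp [← WithLp.toLp_add]
  exact this

@[simp] theorem norm_inX (u : E) : ‖inX E F u‖ = ‖u‖ := WithLp.norm_toLp_fst 2 E F u

@[simp] theorem norm_inY (w : F) : ‖inY E F w‖ = ‖w‖ := WithLp.norm_toLp_snd 2 E F w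

theorem norm_inX_add_inY_sq (u : E) (w : F) :
    ‖inX E F u + inY E F w‖ ^ 2 = ‖u‖ ^ 2 + ‖w‖ ^ 2 := by
  rw [← pt_eq, pt]
  exact WithLp.prod_norm_sq_eq_of_L2 _

theorem norm_inX_le : ‖inX E F‖ ≤ 1 :=
  ContinuousLinearMap.opNorm_le_bound _ zero_le_one fun u => by simp

theorem norm_inY_le : ‖inY E F‖ ≤ 1 :=
  ContinuousLinearMap.opNorm_le_bound _ zero_le_one fun u => by simp

theorem pt_sub_pt (x x' : E) (y y' : F) :
    pt x y - pt x' y' = inX E F (x - x') + inY E F (y - y') := by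
  rw [pt_eq, pt_eq, map_sub, map_sub]; abel

theorem norm_pt_sub_pt_le (x x' : E) (y y' : F) :
    ‖pt x y - pt x' y'‖ ≤ ‖x - x'‖ + ‖y - y'‖ := by
  rw [pt_sub_pt]
  exact (norm_add_le _ _).trans (by rw [norm_inX, norm_inY])

theorem norm_pt_sub_left (x : E) (y y' : F) : ‖pt x y - pt x y'‖ = ‖y - y'‖ := by
  rw [pt_sub_pt, sub_self, map_zero, zero_add, norm_inY]

theorem hasFDerivAt_pt_left (x : E) (y : F) : HasFDerivAt (fun x' => pt x' y) (inX E F) x := by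
  simp only [pt_eq]
  exact (inX E F).hasFDerivAt.add_const _

theorem hasFDerivAt_pt_right (x : E) (y : F) : HasFDerivAt (fun y' => pt x y') (inY E F) y := by
  simp only [pt_eq]
  exact (inY E F).hasFDerivAt.const_add _

/-- Bilinear forms on the product space. -/
abbrev Form (E F : Type*) [NormedAddCommGroup E] [InnerProductSpace ℝ E]
    [NormedAddCommGroup F] [InnerProductSpace ℝ F] :=
  Prd E F →L[ℝ] Prd E F →L[ℝ] ℝ

theorem form_apply_le (B : Form E F) (a b : Prd E F) :
    |B a b| ≤ ‖B‖ * ‖a‖ * ‖b‖ := B.le_opNorm₂ a b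

/-- The graph map `u ↦ (u, Y u)`. -/
def lift (Y : E →L[ℝ] F) : E →L[ℝ] Prd E F := inX E F + (inY E F).comp Y

@[simp] theorem lift_apply (Y : E →L[ℝ] F) (u : E) :
    lift Y u = inX E F u + inY E F (Y u) := rfl

theorem norm_lift_sub_le (Y Y' : E →L[ℝ] F) : ‖lift Y - lift Y'‖ ≤ ‖Y - Y'‖ := by
  have : lift Y - lift Y' = (inY E F).comp (Y - Y') := by
    ext u; simp
  rw [this]
  exact ((inY E F).opNorm_comp_le _).trans
    (mul_le_of_le_one_left (norm_nonneg _) norm_inY_le)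

theorem norm_lift_le (Y : E →L[ℝ] F) : ‖lift Y‖ ≤ 1 + ‖Y‖ := by
  refine (norm_add_le _ _).trans (add_le_add norm_inX_le ?_)
  exact ((inY E F).opNorm_comp_le _).trans
    (mul_le_of_le_one_left (norm_nonneg _) norm_inY_le)

theorem norm_lift_sq_le (Y : E →L[ℝ] F) : ‖lift Y‖ ^ 2 ≤ 1 + ‖Y‖ ^ 2 := by
  have : ‖lift Y‖ ≤ Real.sqrt (1 + ‖Y‖ ^ 2) := by
    refine ContinuousLinearMap.opNorm_le_bound _ (Real.sqrt_nonneg _) fun u => ?_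
    refine le_of_sq_le_sq ?_ (by positivity)
    rw [lift_apply, norm_inX_add_inY_sq, mul_pow, Real.sq_sqrt (by positivity)]
    have := Y.le_opNorm u
    have h2 : ‖Y u‖ ^ 2 ≤ (‖Y‖ * ‖u‖) ^ 2 := by gcongr
    linarith [mul_pow ‖Y‖ ‖u‖ 2]
  calc ‖lift Y‖ ^ 2 ≤ Real.sqrt (1 + ‖Y‖ ^ 2) ^ 2 := by gcongr
    _ = _ := Real.sq_sqrt (by positivity)

/-- The form is coercive with constant `m` in the second block. -/
def CoerY (m : ℝ) (B : Form E F) : Prop :=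
  ∀ w : F, m * ‖w‖ ^ 2 ≤ B (inY E F w) (inY E F w)

/-- `(u, Y u)` is orthogonal to the second block for all `u`. -/
def IsSens (B : Form E F) (Y : E →L[ℝ] F) : Prop :=
  ∀ (u : E) (w : F), B (lift Y u) (inY E F w) = 0

theorem IsSens.smul {B : Form E F} {Y : E →L[ℝ] F} (h : IsSens B Y) (c : ℝ) :
    IsSens (c • B) Y := fun u w => by
    rw [smul_apply, smul_apply, h u w, smul_zero]

/-- For w = (Y − Y')u the vector (0, w) is the difference of the two lifts of u, so orthogonality
gives B(w, w) = −(B − B')(lift Y' u, w). Coercivity of B alone then suffices. -/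
theorem IsSens.norm_sub_le {B B' : Form E F} {Y Y' : E →L[ℝ] F} {m : ℝ} (hm : 0 < m)
    (hB : CoerY m B) (h : IsSens B Y) (h' : IsSens B' Y') :
    ‖Y - Y'‖ ≤ ‖B - B'‖ * ‖lift Y'‖ / m := by
  refine ContinuousLinearMap.opNorm_le_bound _ (by positivity) fun u => ?_
  set w := (Y - Y') u with hw
  have e : inY E F w = lift Y u - lift Y' u := by simp [hw]
  have h1 : B (inY E F w) (inY E F w) = -((B - B') (lift Y' u) (inY E F w)) := by
    conv_lhs => rw [show B (inY E F w) = B (lift Y u - lift Y' u) by rw [← e]]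
    simp only [map_sub, sub_apply, h u w, h' u w]
    ring
  have h2 := hB w
  have h3 := form_apply_le (B - B') (lift Y' u) (inY E F w)
  rw [norm_inY] at h3
  have h4 : ‖B - B'‖ * ‖lift Y' u‖ * ‖w‖ ≤ ‖B - B'‖ * (‖lift Y'‖ * ‖u‖) * ‖w‖ := by
    gcongr; exact (lift Y').le_opNorm u
  have h5 : m * ‖w‖ ^ 2 ≤ ‖B - B'‖ * (‖lift Y'‖ * ‖u‖) * ‖w‖ := by
    rw [h1] at h2
    exact h2.trans ((neg_le_abs _).trans (h3.trans h4))
  rcases (norm_nonneg w).eq_or_lt with h0 | h0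
  · rw [← h0]; positivity
  · have : m * ‖w‖ ≤ ‖B - B'‖ * (‖lift Y'‖ * ‖u‖) := by
      apply le_of_mul_le_mul_right _ h0
      calc m * ‖w‖ * ‖w‖ = m * ‖w‖ ^ 2 := by ring
        _ ≤ _ := h5
    rw [div_mul_eq_mul_div, le_div_iff₀ hm]
    linarith

/-- Comparison with the zero form, for which the zero map is a sensitivity. -/
theorem IsSens.norm_le {B : Form E F} {Y : E →L[ℝ] F} {m L : ℝ} (hm : 0 < m)
    (hB : CoerY m B) (h : IsSens B Y) (hL : ‖B‖ ≤ L) : ‖Y‖ ≤ L / m := by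
  have h0 : IsSens (0 : Form E F) (0 : E →L[ℝ] F) := fun u w => by simp
  have h1 := h.norm_sub_le hm hB h0
  have e : B - 0 = B := sub_zero B
  rw [sub_zero, e] at h1
  have h2 : ‖lift (0 : E →L[ℝ] F)‖ ≤ 1 := by simpa using norm_lift_le (0 : E →L[ℝ] F)
  refine h1.trans ?_
  gcongr
  exact (mul_le_of_le_one_right (norm_nonneg B) h2).trans hL

/-- Polarization of the difference of two Schur complements. -/
theorem IsSens.schur_sub {B B' : Form E F} {Y Y' : E →L[ℝ] F}
    (hs : ∀ a b, B' a b = B' b a) (h : IsSens B Y) (h' : IsSens B' Y') (u v : E) :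
    B (lift Y u) (lift Y v) - B' (lift Y' u) (lift Y' v) = (B - B') (lift Y u) (lift Y' v) := by
  -- `lift Y u` is B-orthogonal to the second block, so the other argument may be moved to `lift Y'
  -- v`; likewise for B'. The difference Y − Y' never has to be estimated.
  have e1 : B (lift Y u) (lift Y v) = B (lift Y u) (lift Y' v) := by
    rw [lift_apply Y v, lift_apply Y' v, map_add, map_add, h u, h u]
  have e2 : B' (lift Y' u) (lift Y' v) = B' (lift Y u) (lift Y' v) := by
    rw [hs _ (lift Y' v), hs _ (lift Y' v), lift_apply Y' u, lift_apply Y u, map_add, map_add,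
      h' v, h' v]
  rw [e1, e2]; rfl

end Blocks

/-! ### Riesz representation of functionals composed with a linear map. -/

section Riesz

variable {V W Z : Type*} [NormedAddCommGroup V] [NormedSpace ℝ V]
  [NormedAddCommGroup W] [InnerProductSpace ℝ W] [CompleteSpace W]
  [NormedAddCommGroup Z] [NormedSpace ℝ Z]

/-- The vector representing the functional `T ∘ Q`, as a linear function of `T`. -/
def riesz (Q : W →L[ℝ] Z) : (Z →L[ℝ] ℝ) →L[ℝ] W :=
  LinearMap.mkContinuous
    { toFun := fun T => (InnerProductSpace.toDual ℝ W).symm (T.comp Q)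
      map_add' := fun T T' => by rw [ContinuousLinearMap.add_comp, map_add]
      map_smul' := fun c T => by
        rw [ContinuousLinearMap.smul_comp, LinearIsometryEquiv.map_smulₛₗ]; rfl }
    ‖Q‖ fun T => by
      simpa [mul_comm] using T.opNorm_comp_le Q

theorem riesz_apply (Q : W →L[ℝ] Z) (T : Z →L[ℝ] ℝ) :
    riesz Q T = (InnerProductSpace.toDual ℝ W).symm (T.comp Q) := rfl

@[simp] theorem inner_riesz (Q : W →L[ℝ] Z) (T : Z →L[ℝ] ℝ) (w : W) :
    inner ℝ (riesz Q T) w = T (Q w) := by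
  rw [riesz_apply, InnerProductSpace.toDual_symm_apply]; rfl

theorem gradient_comp_eq {p : Z → ℝ} {q : W → Z} {Q : W →L[ℝ] Z} {w : W}
    (hp : DifferentiableAt ℝ p (q w)) (hq : HasFDerivAt q Q w) :
    gradient (fun w => p (q w)) w = riesz Q (fderiv ℝ p (q w)) := by
  have h : HasFDerivAt (fun w => p (q w)) _ w := hp.hasFDerivAt.comp w hq
  rw [gradient, riesz_apply, h.fderiv]

end Riesz

/-! ### Schur complements and their dependence on the form. -/

section Schur

variable {E F : Type*} [NormedAddCommGroup E] [InnerProductSpace ℝ E]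
  [NormedAddCommGroup F] [InnerProductSpace ℝ F] [CompleteSpace F]

/-- The `F × F` block of a form, as an operator. -/
def blockYY (B : Form E F) : F →L[ℝ] F := (riesz (inY E F)).comp (B.comp (inY E F))

/-- The derivative of the minimizer in the second block. -/
def sens (B : Form E F) : E →L[ℝ] F :=
  -((Ring.inverse (blockYY B)).comp ((riesz (inY E F)).comp (B.comp (inX E F))))

/-- Lax–Milgram: the coercive form on F induces a continuous linear equivalence, and this
equivalence is the block. -/
theorem CoerY.isUnit_blockYY {B : Form E F} {m : ℝ} (hm : 0 < m) (hB : CoerY m B) :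
    IsUnit (blockYY B) := by
  set b : F →L[ℝ] F →L[ℝ] ℝ :=
    ((ContinuousLinearMap.compL ℝ F (Prd E F) ℝ).flip (inY E F)).comp
      (B.comp (inY E F)) with hb
  have hco : IsCoercive b := ⟨m, hm, fun w => by
    have := hB w
    rw [pow_two, ← mul_assoc] at this
    exact this⟩
  have he : ((hco.continuousLinearEquivOfBilin : F ≃L[ℝ] F) : F →L[ℝ] F) = blockYY B := by
    ext1 v
    apply ext_inner_right ℝ
    intro w
    simp only [ContinuousLinearEquiv.coe_coe]
    rw [IsCoercive.continuousLinearEquivOfBilin_apply]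
    simp [blockYY, hb]
  rw [← he]
  exact (ContinuousLinearEquiv.unitsEquiv ℝ F).symm hco.continuousLinearEquivOfBilin |>.isUnit

theorem isSens_sens {B : Form E F} {m : ℝ} (hm : 0 < m) (hB : CoerY m B) :
    IsSens B (sens B) := by
  intro u w
  have h1 : blockYY B (sens B u) = - riesz (inY E F) (B (inX E F u)) := by
    have := Ring.mul_inverse_cancel _ (hB.isUnit_blockYY hm)
    have h2 := congrArg (fun T : F →L[ℝ] F => T (riesz (inY E F) (B (inX E F u)))) this
    simp only [mul_apply_eq_comp, one_apply_eq_self] at h2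
    simp [sens, h2]
  have h2 := congrArg (fun v : F => (inner ℝ v w : ℝ)) h1
  simp only [blockYY, ContinuousLinearMap.comp_apply, inner_neg_left, inner_riesz] at h2
  rw [lift_apply, map_add, add_apply, h2]
  ring

variable [CompleteSpace E]

/-- The Schur complement of a form. -/
def schur (B : Form E F) : E →L[ℝ] E :=
  (riesz (inX E F)).comp (B.comp (inX E F))
    - ((riesz (inX E F)).comp (B.comp (inY E F))) ∘L Ring.inverse (blockYY B)
      ∘L ((riesz (inY E F)).comp (B.comp (inX E F)))

theorem inner_schur {B : Form E F} {m : ℝ} (hm : 0 < m) (hB : CoerY m B) (u v : E) :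
    inner ℝ (schur B u) v = B (lift (sens B) u) (lift (sens B) v) := by
  rw [lift_apply _ v, map_add, isSens_sens hm hB u, add_zero]
  simp only [schur, sens, sub_apply, inner_sub_left, ContinuousLinearMap.comp_apply, inner_riesz,
    lift_apply, neg_apply, map_neg, map_add, add_apply]
  ring

/-- Tested with v = (S − S')u, the polarization identity expresses ‖v‖² through B − B' and the two
lifts, so the inverse blocks are never compared with each other. -/
theorem schur_sub_le {B B' : Form E F} {m L : ℝ} (hm : 0 < m) (hB : CoerY m B)
    (hB' : CoerY m B') (hs : ∀ a b, B' a b = B' b a) (hL : ‖B‖ ≤ L) (hL' : ‖B'‖ ≤ L) :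
    ‖schur B - schur B'‖ ≤ ‖B - B'‖ * (1 + (L / m) ^ 2) := by
  have hbd : ∀ {B : Form E F}, CoerY m B → ‖B‖ ≤ L →
      ‖lift (sens B)‖ ^ 2 ≤ 1 + (L / m) ^ 2 := by
    intro B hB hL
    refine (norm_lift_sq_le _).trans ?_
    have := (isSens_sens hm hB).norm_le hm hB hL
    gcongr
  have h1 := hbd hB hL
  have h2 := hbd hB' hL'
  refine ContinuousLinearMap.opNorm_le_bound _ (by positivity) fun u => ?_
  set v := (schur B - schur B') u with hv
  have e : ‖v‖ ^ 2 = (B - B') (lift (sens B) u) (lift (sens B') v) := by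
    rw [← (isSens_sens hm hB).schur_sub hs (isSens_sens hm hB'), ← inner_schur hm hB,
      ← inner_schur hm hB', ← inner_sub_left, ← real_inner_self_eq_norm_sq, hv]
    rfl
  have h3 : ‖v‖ ^ 2 ≤ ‖B - B'‖ * (1 + (L / m) ^ 2) * ‖u‖ * ‖v‖ := by
    calc ‖v‖ ^ 2 ≤ ‖B - B'‖ * ‖lift (sens B) u‖ * ‖lift (sens B') v‖ := by
          rw [e]; exact (le_abs_self _).trans (form_apply_le _ _ _)
      _ ≤ ‖B - B'‖ * (‖lift (sens B)‖ * ‖u‖) * (‖lift (sens B')‖ * ‖v‖) := by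
          gcongr
          · exact ContinuousLinearMap.le_opNorm _ _
          · exact ContinuousLinearMap.le_opNorm _ _
      _ = ‖B - B'‖ * (‖lift (sens B)‖ * ‖lift (sens B')‖) * ‖u‖ * ‖v‖ := by ring
      _ ≤ _ := by
          gcongr
          nlinarith [sq_nonneg (‖lift (sens B)‖ - ‖lift (sens B')‖)]
  rcases (norm_nonneg v).eq_or_lt with h0 | h0
  · rw [← h0]; positivity
  · exact le_of_mul_le_mul_right (by rw [← pow_two]; exact h3) h0

end Schur

end FSBA
end

noncomputable section
set_option linter.unusedSectionVars false
set_option maxSynthPendingDepth 3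
namespace FSBA

/-! ### Taylor bounds and strong convexity along lines. -/

section Line

/-- A second-order Taylor lower bound on `[0, 1]`. -/
theorem taylor_lower {φ φ' φ'' : ℝ → ℝ} {c : ℝ} (h0 : ∀ t, HasDerivAt φ (φ' t) t)
    (h1 : ∀ t, HasDerivAt φ' (φ'' t) t) (hc : ∀ t, c ≤ φ'' t) :
    φ 0 + φ' 0 + c / 2 ≤ φ 1 := by
  have m1 : Monotone fun t => φ' t - c * t := by
    have hd : ∀ t, HasDerivAt (fun t => φ' t - c * t) (φ'' t - c) t := fun t => by
      refine ((h1 t).sub ((hasDerivAt_id t).const_mul c)).congr_deriv ?_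
      rw [mul_one]
    refine monotone_of_deriv_nonneg (fun t => (hd t).differentiableAt) fun t => ?_
    rw [(hd t).deriv]; linarith [hc t]
  have hd : ∀ t, HasDerivAt (fun t => φ t - φ' 0 * t - c / 2 * t ^ 2) (φ' t - φ' 0 - c * t) t :=
    fun t => by
      have := ((h0 t).sub ((hasDerivAt_id t).const_mul (φ' 0))).sub
        (((hasDerivAt_id t).pow 2).const_mul (c / 2))
      refine this.congr_deriv ?_
      simp; ring
  have m2 : MonotoneOn (fun t => φ t - φ' 0 * t - c / 2 * t ^ 2) (Set.Icc 0 1) := by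
    refine monotoneOn_of_deriv_nonneg (convex_Icc 0 1)
      (fun t _ => (hd t).continuousAt.continuousWithinAt)
      (fun t _ => (hd t).differentiableAt.differentiableWithinAt) fun t ht => ?_
    rw [(hd t).deriv]
    rw [interior_Icc] at ht
    have := m1 ht.1.le
    simp only [mul_zero, sub_zero] at this
    linarith
  have := m2 (Set.left_mem_Icc.2 zero_le_one) (Set.right_mem_Icc.2 zero_le_one) zero_le_one
  simp only at this
  linarith

/-- Subtracting ct²/2 leaves a convex function, so φ' − ct is monotone and its derivative d − c at 0
is nonnegative. -/
theorem le_of_strongConvexOn {φ φ' : ℝ → ℝ} {c d : ℝ} (hs : StrongConvexOn Set.univ c φ)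
    (h0 : ∀ t, HasDerivAt φ (φ' t) t) (h1 : HasDerivAt φ' d 0) : c ≤ d := by
  have hcx := strongConvexOn_iff_convex.1 hs
  have hd : ∀ t, HasDerivAt (fun t => φ t - c / 2 * ‖t‖ ^ 2) (φ' t - c * t) t := fun t => by
    simp only [Real.norm_eq_abs, sq_abs]
    refine ((h0 t).sub (((hasDerivAt_id t).pow 2).const_mul (c / 2))).congr_deriv ?_
    simp; ring
  have hmono : Monotone fun t => φ' t - c * t := by
    have := hcx.monotoneOn_deriv fun t _ => (hd t).differentiableAt
    rw [monotoneOn_univ] at this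
    rwa [funext fun t => (hd t).deriv] at this
  have h2 : HasDerivAt (fun t => φ' t - c * t) (d - c) 0 := by
    refine (h1.sub ((hasDerivAt_id (0 : ℝ)).const_mul c)).congr_deriv ?_
    rw [mul_one]
  have := hmono.deriv_nonneg (x := 0)
  rw [h2.deriv] at this
  linarith

variable {V W : Type*} [NormedAddCommGroup V] [NormedSpace ℝ V] [NormedAddCommGroup W]
  [NormedSpace ℝ W]

theorem hasDerivAt_along {G : V → W} {G' : V → V →L[ℝ] W} (hG : ∀ z, HasFDerivAt G (G' z) z)
    (z a : V) (t : ℝ) : HasDerivAt (fun t : ℝ => G (z + t • a)) (G' (z + t • a) a) t := by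
  have hl : HasDerivAt (fun t : ℝ => z + t • a) a t := by
    simpa using ((hasDerivAt_id t).smul_const a).const_add z
  exact (hG (z + t • a)).comp_hasDerivAt t hl

theorem hasFDerivAt_apply_const {G : V → V →L[ℝ] W} {G' : V → V →L[ℝ] V →L[ℝ] W}
    (hG : ∀ z, HasFDerivAt G (G' z) z) (a z : V) :
    HasFDerivAt (fun z => G z a) ((G' z).flip a) z :=
  (ContinuousLinearMap.apply ℝ W a).hasFDerivAt.comp z (hG z)

variable {p : V → ℝ} {p' : V → V →L[ℝ] ℝ} {p'' : V → V →L[ℝ] V →L[ℝ] ℝ}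

theorem taylor_lower_along (h0 : ∀ z, HasFDerivAt p (p' z) z)
    (h1 : ∀ z, HasFDerivAt p' (p'' z) z) {c : ℝ} (z a : V) (hc : ∀ z, c ≤ p'' z a a) :
    p z + p' z a + c / 2 ≤ p (z + a) := by
  simpa using taylor_lower (hasDerivAt_along h0 z a)
    (hasDerivAt_along (hasFDerivAt_apply_const h1 a) z a) fun t => hc _

theorem taylor_upper_along (h0 : ∀ z, HasFDerivAt p (p' z) z)
    (h1 : ∀ z, HasFDerivAt p' (p'' z) z) {c : ℝ} (z a : V) (hc : ∀ z, p'' z a a ≤ c) :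
    p (z + a) ≤ p z + p' z a + c / 2 := by
  have := taylor_lower_along (p := fun z => -p z) (p' := fun z => -p' z) (p'' := fun z => -p'' z)
    (c := -c) (fun z => (h0 z).neg) (fun z => (h1 z).neg) z a fun z => neg_le_neg (hc z)
  simp only [neg_apply] at this
  linarith

theorem le_of_strongConvexOn_along (h0 : ∀ z, HasFDerivAt p (p' z) z)
    (h1 : ∀ z, HasFDerivAt p' (p'' z) z) {c : ℝ} (z a : V)
    (hs : StrongConvexOn Set.univ c fun t : ℝ => p (z + t • a)) : c ≤ p'' z a a := by
  refine le_of_strongConvexOn hs (hasDerivAt_along h0 z a) ?_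
  simpa using hasDerivAt_along (hasFDerivAt_apply_const h1 a) z a 0

end Line

/-! ### Derivatives of a function of two blocks on the product space. -/

section Joint

/-- `h` as a function on the Euclidean product space. -/
def jnt {E F : Type*} (h : E → F → ℝ) : Prd E F → ℝ := joint h

theorem jnt_pt {E F : Type*} (h : E → F → ℝ) (x : E) (y : F) : jnt h (pt x y) = h x y := rfl

variable {E F : Type*} [NormedAddCommGroup E] [InnerProductSpace ℝ E]
  [NormedAddCommGroup F] [InnerProductSpace ℝ F]

/-- The first derivative. -/
def D1 (h : E → F → ℝ) : Prd E F → Prd E F →L[ℝ] ℝ := fderiv ℝ (jnt h)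

/-- The second derivative. -/
def D2 (h : E → F → ℝ) : Prd E F → Form E F := fderiv ℝ (D1 h)

/-- The third derivative. -/
def D3 (h : E → F → ℝ) : Prd E F → Prd E F →L[ℝ] Form E F := fderiv ℝ (D2 h)

variable {h : E → F → ℝ}

theorem hasFDerivAt_jnt (hh : ContDiff ℝ 2 (jnt h)) (z : Prd E F) :
    HasFDerivAt (jnt h) (D1 h z) z :=
  (hh.differentiable (by norm_num) z).hasFDerivAt

theorem contDiff_D1 {n : WithTop ℕ∞} (hh : ContDiff ℝ (n + 1) (jnt h)) :
    ContDiff ℝ n (D1 h) := hh.fderiv_right le_rfl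

theorem contDiff_D2 {n : WithTop ℕ∞} (hh : ContDiff ℝ (n + 1 + 1) (jnt h)) :
    ContDiff ℝ n (D2 h) := (contDiff_D1 hh).fderiv_right le_rfl

theorem contDiff_two_D1 (hh : ContDiff ℝ 2 (jnt h)) : ContDiff ℝ 1 (D1 h) :=
  contDiff_D1 (by rwa [one_add_one_eq_two])

theorem hasFDerivAt_D1 (hh : ContDiff ℝ 2 (jnt h)) (z : Prd E F) :
    HasFDerivAt (D1 h) (D2 h z) z :=
  ((contDiff_two_D1 hh).differentiable (by norm_num) z).hasFDerivAt

theorem hasFDerivAt_D2 (hh : ContDiff ℝ 3 (jnt h)) (z : Prd E F) :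
    HasFDerivAt (D2 h) (D3 h z) z :=
  ((contDiff_D2 (n := 1) (by convert hh using 1; norm_num)).differentiable (by norm_num)
    z).hasFDerivAt

theorem D2_symm (hh : ContDiff ℝ 2 (jnt h)) (z a b : Prd E F) : D2 h z a b = D2 h z b a :=
  (hh.contDiffAt.isSymmSndFDerivAt (x := z) (by simp)) a b

theorem hasFDerivAt_left (hh : ContDiff ℝ 2 (jnt h)) (x : E) (y : F) :
    HasFDerivAt (fun x' => h x' y) ((D1 h (pt x y)).comp (inX E F)) x :=
  HasFDerivAt.comp (g := jnt h) x (hasFDerivAt_jnt hh (pt x y)) (hasFDerivAt_pt_left x y)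

theorem hasFDerivAt_right (hh : ContDiff ℝ 2 (jnt h)) (x : E) (y : F) :
    HasFDerivAt (fun y' => h x y') ((D1 h (pt x y)).comp (inY E F)) y :=
  HasFDerivAt.comp (g := jnt h) y (hasFDerivAt_jnt hh (pt x y)) (hasFDerivAt_pt_right x y)

theorem continuous_right (hh : ContDiff ℝ 2 (jnt h)) (x : E) : Continuous (h x) :=
  continuous_iff_continuousAt.2 fun y => (hasFDerivAt_right hh x y).continuousAt

/-- Taylor bounds along segments. -/
theorem jnt_taylor_lower (hh : ContDiff ℝ 2 (jnt h)) {c : ℝ} (z a : Prd E F)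
    (hc : ∀ z, c ≤ D2 h z a a) : jnt h z + D1 h z a + c / 2 ≤ jnt h (z + a) :=
  taylor_lower_along (hasFDerivAt_jnt hh) (hasFDerivAt_D1 hh) z a hc

theorem jnt_taylor_upper (hh : ContDiff ℝ 2 (jnt h)) {c : ℝ} (z a : Prd E F)
    (hc : ∀ z, D2 h z a a ≤ c) : jnt h (z + a) ≤ jnt h z + D1 h z a + c / 2 :=
  taylor_upper_along (hasFDerivAt_jnt hh) (hasFDerivAt_D1 hh) z a hc

theorem pt_add_smul_inY (x : E) (y w : F) (t : ℝ) :
    pt x y + t • inY E F w = pt x (y + t • w) := by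
  rw [pt_eq, pt_eq, map_add, map_smul, add_assoc]

/-- Strong convexity in the second variable bounds the corresponding block of the Hessian. -/
theorem coerY_of_strongConvexOn (hh : ContDiff ℝ 2 (jnt h)) {m : ℝ} {x : E}
    (hs : StrongConvexOn Set.univ m (h x)) (y : F) : CoerY m (D2 h (pt x y)) := by
  intro w
  refine le_of_strongConvexOn_along (hasFDerivAt_jnt hh) (hasFDerivAt_D1 hh) (pt x y)
    (inY E F w) ⟨convex_univ, fun s _ t _ a b ha hb hab => ?_⟩
  have := hs.2 (Set.mem_univ (y + s • w)) (Set.mem_univ (y + t • w)) ha hb hab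
  simp only [pt_add_smul_inY, jnt_pt]
  have e1 : a • (y + s • w) + b • (y + t • w) = y + (a • s + b • t) • w := by
    have : y = (a + b) • y := by rw [hab, one_smul]
    conv_rhs => rw [this]
    simp only [smul_eq_mul]
    module
  have e2 : ‖y + s • w - (y + t • w)‖ = ‖s - t‖ * ‖w‖ := by
    rw [← norm_smul]; congr 1; module
  rw [e1, e2] at this
  refine this.trans (le_of_eq ?_)
  ring

end Joint

/-! ### Partial gradients and Hessian blocks in terms of joint derivatives. -/

section Gradients

variable {E F : Type*} [NormedAddCommGroup E] [InnerProductSpace ℝ E]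
  [NormedAddCommGroup F] [InnerProductSpace ℝ F] {h : E → F → ℝ}

theorem gradX_eq [CompleteSpace E] (hh : ContDiff ℝ 2 (jnt h)) (x : E) (y : F) :
    gradX h x y = riesz (inX E F) (D1 h (pt x y)) :=
  gradient_comp_eq (hasFDerivAt_jnt hh _).differentiableAt (hasFDerivAt_pt_left x y)

theorem gradY_eq [CompleteSpace F] (hh : ContDiff ℝ 2 (jnt h)) (x : E) (y : F) :
    gradY h x y = riesz (inY E F) (D1 h (pt x y)) :=
  gradient_comp_eq (hasFDerivAt_jnt hh _).differentiableAt (hasFDerivAt_pt_right x y)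

theorem hasFDerivAt_riesz_D1_left {W : Type*} [NormedAddCommGroup W] [InnerProductSpace ℝ W]
    [CompleteSpace W] (Q : W →L[ℝ] Prd E F) (hh : ContDiff ℝ 2 (jnt h)) (x : E) (y : F) :
    HasFDerivAt (fun x' => riesz Q (D1 h (pt x' y)))
      ((riesz Q).comp ((D2 h (pt x y)).comp (inX E F))) x :=
  (riesz Q).hasFDerivAt.comp x ((hasFDerivAt_D1 hh _).comp x (hasFDerivAt_pt_left x y))

theorem hasFDerivAt_riesz_D1_right {W : Type*} [NormedAddCommGroup W] [InnerProductSpace ℝ W]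
    [CompleteSpace W] (Q : W →L[ℝ] Prd E F) (hh : ContDiff ℝ 2 (jnt h)) (x : E) (y : F) :
    HasFDerivAt (fun y' => riesz Q (D1 h (pt x y')))
      ((riesz Q).comp ((D2 h (pt x y)).comp (inY E F))) y :=
  (riesz Q).hasFDerivAt.comp y ((hasFDerivAt_D1 hh _).comp y (hasFDerivAt_pt_right x y))

theorem hessXX_eq [CompleteSpace E] (hh : ContDiff ℝ 2 (jnt h)) (x : E) (y : F) :
    hessXX h x y = (riesz (inX E F)).comp ((D2 h (pt x y)).comp (inX E F)) := by
  simp only [hessXX, gradX_eq hh]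
  exact (hasFDerivAt_riesz_D1_left _ hh x y).fderiv

theorem hessXY_eq [CompleteSpace E] (hh : ContDiff ℝ 2 (jnt h)) (x : E) (y : F) :
    hessXY h x y = (riesz (inX E F)).comp ((D2 h (pt x y)).comp (inY E F)) := by
  simp only [hessXY, gradX_eq hh]
  exact (hasFDerivAt_riesz_D1_right _ hh x y).fderiv

theorem hessYX_eq [CompleteSpace F] (hh : ContDiff ℝ 2 (jnt h)) (x : E) (y : F) :
    hessYX h x y = (riesz (inY E F)).comp ((D2 h (pt x y)).comp (inX E F)) := by
  simp only [hessYX, gradY_eq hh]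
  exact (hasFDerivAt_riesz_D1_left _ hh x y).fderiv

theorem hessYY_eq [CompleteSpace F] (hh : ContDiff ℝ 2 (jnt h)) (x : E) (y : F) :
    hessYY h x y = blockYY (D2 h (pt x y)) := by
  simp only [hessYY, gradY_eq hh]
  exact (hasFDerivAt_riesz_D1_right _ hh x y).fderiv

end Gradients

end FSBA
end

noncomputable section
set_option linter.unusedSectionVars false
set_option maxSynthPendingDepth 3
namespace FSBA

/-! ### The lower-level minimizer and its value function. -/

section Lower

variable {E F : Type*} [NormedAddCommGroup E] [InnerProductSpace ℝ E]
  [NormedAddCommGroup F] [InnerProductSpace ℝ F]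

/-- Regularity of a lower-level objective: `m`-strong convexity in the second variable and
bounded, Lipschitz second derivatives. -/
structure Regular (h : E → F → ℝ) (m L R : ℝ) : Prop where
  pos : 0 < m
  smooth : ContDiff ℝ 2 (jnt h)
  coer : ∀ z, CoerY m (D2 h z)
  hess_le : ∀ z, ‖D2 h z‖ ≤ L
  hess_lip : ∀ z z', ‖D2 h z - D2 h z'‖ ≤ R * ‖z - z'‖

/-- The minimizer in the second variable. -/
def minY (h : E → F → ℝ) (x : E) : F := argmin (h x)

variable {h : E → F → ℝ} {m L R : ℝ}

theorem norm_sub_le_of_hasFDerivAt {V W : Type*} [NormedAddCommGroup V] [NormedSpace ℝ V]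
    [NormedAddCommGroup W] [NormedSpace ℝ W] {G : V → W} {G' : V → V →L[ℝ] W} {c : ℝ}
    (hG : ∀ z, HasFDerivAt G (G' z) z) (hc : ∀ z, ‖G' z‖ ≤ c) (z z' : V) :
    ‖G z - G z'‖ ≤ c * ‖z - z'‖ :=
  convex_univ.norm_image_sub_le_of_norm_hasFDerivWithin_le
    (fun x _ => (hG x).hasFDerivWithinAt) (fun x _ => hc x) (Set.mem_univ z') (Set.mem_univ z)

namespace Regular

theorem L_nonneg (H : Regular h m L R) : 0 ≤ L := (norm_nonneg (D2 h 0)).trans (H.hess_le 0)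

theorem D1_lip (H : Regular h m L R) (z z' : Prd E F) :
    ‖D1 h z - D1 h z'‖ ≤ L * ‖z - z'‖ :=
  norm_sub_le_of_hasFDerivAt (hasFDerivAt_D1 H.smooth) H.hess_le z z'

theorem pt_add_inY (x : E) (y y' : F) : pt x y + inY E F (y' - y) = pt x y' := by
  simpa using pt_add_smul_inY x y (y' - y) 1

theorem lower (H : Regular h m L R) (x : E) (y y' : F) :
    h x y + D1 h (pt x y) (inY E F (y' - y)) + m / 2 * ‖y' - y‖ ^ 2 ≤ h x y' := by
  have := jnt_taylor_lower H.smooth (pt x y) (inY E F (y' - y)) fun z => H.coer z (y' - y)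
  rw [pt_add_inY, jnt_pt, jnt_pt] at this
  linarith

theorem upper (H : Regular h m L R) (x : E) (y y' : F) :
    h x y' ≤ h x y + D1 h (pt x y) (inY E F (y' - y)) + L / 2 * ‖y' - y‖ ^ 2 := by
  have := jnt_taylor_upper H.smooth (c := L * ‖y' - y‖ ^ 2) (pt x y) (inY E F (y' - y))
    fun z => by
      refine (le_abs_self _).trans ((form_apply_le _ _ _).trans ?_)
      rw [norm_inY, mul_assoc, ← pow_two]
      gcongr
      exact H.hess_le z
  rw [pt_add_inY, jnt_pt, jnt_pt] at this
  linarith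

theorem strong_mono (H : Regular h m L R) (x : E) (y y' : F) :
    m * ‖y - y'‖ ^ 2 ≤ (D1 h (pt x y) - D1 h (pt x y')) (inY E F (y - y')) := by
  have h1 := H.lower x y y'
  have h2 := H.lower x y' y
  rw [← neg_sub y y', map_neg, map_neg, norm_neg] at h1
  rw [sub_apply]
  linarith

/-- The quadratic lower bound at y = 0 forces h(x, ·) to infinity, and a continuous coercive
function on a finite-dimensional space attains its minimum. -/
theorem exists_min [FiniteDimensional ℝ F] (H : Regular h m L R) (x : E) :
    ∃ v, ∀ v', h x v ≤ h x v' := by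
  have hm := H.pos
  refine (continuous_right H.smooth x).exists_forall_le ?_
  set c := ‖D1 h (pt x 0)‖
  have hb : ∀ y, h x 0 + (m / 2 * ‖y‖ - c) * ‖y‖ ≤ h x y := fun y => by
    have h1 := H.lower x 0 y
    rw [sub_zero] at h1
    have h2 := (D1 h (pt x 0)).le_opNorm (inY E F y)
    rw [norm_inY, Real.norm_eq_abs] at h2
    have h3 := neg_abs_le (D1 h (pt x 0) (inY E F y))
    nlinarith
  refine Filter.tendsto_atTop_mono hb ?_
  have hn : Filter.Tendsto (fun y : F => ‖y‖) (Filter.cocompact F) Filter.atTop :=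
    tendsto_norm_cocompact_atTop
  refine Filter.tendsto_atTop_add_const_left _ _ (Filter.Tendsto.atTop_mul_atTop₀ ?_ hn)
  exact Filter.tendsto_atTop_add_const_right _ _ (hn.const_mul_atTop (by positivity))

theorem D1_eq_zero_of_min (H : Regular h m L R) {x : E} {y : F} (hy : ∀ v', h x y ≤ h x v')
    (w : F) : D1 h (pt x y) (inY E F w) = 0 := by
  have h1 : IsLocalMin (h x) y := Filter.Eventually.of_forall hy
  have := h1.hasFDerivAt_eq_zero (hasFDerivAt_right H.smooth x y)
  exact congrArg (fun T : F →L[ℝ] ℝ => T w) this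

/-- The derivative of the minimizer. -/
def sensAt [CompleteSpace F] (h : E → F → ℝ) (x : E) : E →L[ℝ] F := sens (D2 h (pt x (minY h x)))

theorem isSens_sensAt [CompleteSpace F] (H : Regular h m L R) (x : E) :
    IsSens (D2 h (pt x (minY h x))) (sensAt h x) := isSens_sens H.pos (H.coer _)

theorem norm_sensAt_le [CompleteSpace F] (H : Regular h m L R) (x : E) : ‖sensAt h x‖ ≤ L / m :=
  (H.isSens_sensAt x).norm_le H.pos (H.coer _) (H.hess_le _)

/-- Restriction of functionals to the first block. -/
def restrX (E F : Type*) [NormedAddCommGroup E] [InnerProductSpace ℝ E]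
    [NormedAddCommGroup F] [InnerProductSpace ℝ F] :
    (Prd E F →L[ℝ] ℝ) →L[ℝ] E →L[ℝ] ℝ :=
  (ContinuousLinearMap.compL ℝ E (Prd E F) ℝ).flip (inX E F)

theorem hess_env_apply [CompleteSpace F] (H : Regular h m L R) (x u v : E) :
    (restrX E F).comp ((D2 h (pt x (minY h x))).comp (lift (sensAt h x))) u v
      = D2 h (pt x (minY h x)) (lift (sensAt h x) u) (lift (sensAt h x) v) := by
  rw [lift_apply _ v, map_add, H.isSens_sensAt x, add_zero]
  rfl

variable [FiniteDimensional ℝ F]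

theorem minY_le (H : Regular h m L R) (x : E) (v : F) : h x (minY h x) ≤ h x v :=
  Classical.epsilon_spec (p := fun v => ∀ v', h x v ≤ h x v') (H.exists_min x) v

theorem D1_minY (H : Regular h m L R) (x : E) (w : F) :
    D1 h (pt x (minY h x)) (inY E F w) = 0 :=
  H.D1_eq_zero_of_min (H.minY_le x) w

/-- The distance to a minimizer is bounded by the gradient. -/
theorem norm_sub_minY_le (H : Regular h m L R) {x : E} {y : F} {c : ℝ} (hc : 0 ≤ c)
    (hy : ∀ w, |D1 h (pt x y) (inY E F w)| ≤ c * ‖w‖) : ‖y - minY h x‖ ≤ c / m := by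
  have h1 := H.strong_mono x y (minY h x)
  rw [sub_apply, H.D1_minY, sub_zero] at h1
  have h2 := (le_abs_self _).trans (hy (y - minY h x))
  rw [le_div_iff₀ H.pos]
  rcases (norm_nonneg (y - minY h x)).eq_or_lt with h0 | h0
  · rw [← h0]; simpa using hc
  · refine le_of_mul_le_mul_right ?_ h0
    calc ‖y - minY h x‖ * m * ‖y - minY h x‖ = m * ‖y - minY h x‖ ^ 2 := by ring
      _ ≤ _ := h1.trans h2

theorem minY_lip (H : Regular h m L R) (x x' : E) :
    ‖minY h x - minY h x'‖ ≤ L / m * ‖x - x'‖ := by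
  rw [div_mul_eq_mul_div]
  refine H.norm_sub_minY_le (by have := H.L_nonneg; positivity) fun w => ?_
  -- The y-gradient vanishes at (x, y*(x)), so at (x', y*(x)) it is only the change caused by moving
  -- x to x'.
  have h1 : D1 h (pt x' (minY h x)) (inY E F w)
      = (D1 h (pt x' (minY h x)) - D1 h (pt x (minY h x))) (inY E F w) := by
    rw [sub_apply, H.D1_minY, sub_zero]
  rw [h1, ← Real.norm_eq_abs]
  refine (ContinuousLinearMap.le_opNorm _ _).trans ?_
  rw [norm_inY]
  gcongr
  refine (H.D1_lip _ _).trans (le_of_eq ?_)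
  rw [pt_sub_pt, sub_self, map_zero, add_zero, norm_inX, norm_sub_rev]

theorem norm_pt_minY_sub_le (H : Regular h m L R) (x x' : E) :
    ‖pt x (minY h x) - pt x' (minY h x')‖ ≤ (1 + L / m) * ‖x - x'‖ := by
  refine (norm_pt_sub_pt_le _ _ _ _).trans ?_
  linarith [H.minY_lip x x']

variable [CompleteSpace F]

/-- The Lipschitz bound on `minY` makes the expansion of D1 along x' ↦ (x', y*(x')) valid up to
o(‖x' − x‖). Both D1 terms vanish on the second block, so testing with the remainder r and using
coercivity bounds m‖r‖ by that expansion error. This replaces the implicit function theorem. -/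
theorem hasFDerivAt_minY (H : Regular h m L R) (x : E) :
    HasFDerivAt (minY h) (sensAt h x) x := by
  set z : E → Prd E F := fun x => pt x (minY h x) with hz
  have hzO : (fun x' => z x' - z x) =O[nhds x] fun x' => x' - x :=
    Asymptotics.IsBigO.of_bound (1 + L / m)
      (Filter.Eventually.of_forall fun x' => H.norm_pt_minY_sub_le x' x)
  have hzc : Filter.Tendsto z (nhds x) (nhds (z x)) := by
    rw [tendsto_iff_norm_sub_tendsto_zero]
    have h1 : Filter.Tendsto (fun x' => (1 + L / m) * ‖x' - x‖) (nhds x) (nhds 0) := by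
      have : Continuous fun x' => (1 + L / m) * ‖x' - x‖ := by fun_prop
      simpa using this.tendsto x
    exact squeeze_zero (fun _ => norm_nonneg _) (fun x' => H.norm_pt_minY_sub_le x' x) h1
  have ho : (fun x' => D1 h (z x') - D1 h (z x) - D2 h (z x) (z x' - z x))
      =o[nhds x] fun x' => x' - x :=
    ((hasFDerivAt_D1 H.smooth (z x)).isLittleO.comp_tendsto hzc).trans_isBigO hzO
  refine HasFDerivAt.of_isLittleO (Asymptotics.IsBigO.trans_isLittleO
    (Asymptotics.IsBigO.of_bound (1 / m) (Filter.Eventually.of_forall fun x' => ?_)) ho)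
  set r := minY h x' - minY h x - sensAt h x (x' - x) with hr
  set q := D1 h (z x') - D1 h (z x) - D2 h (z x) (z x' - z x) with hq
  have e1 : inY E F r = (z x' - z x) - lift (sensAt h x) (x' - x) := by
    rw [hz, pt_sub_pt, lift_apply, hr, map_sub]; abel
  have e2 : D2 h (z x) (inY E F r) (inY E F r) = - q (inY E F r) := by
    conv_lhs => rw [show D2 h (z x) (inY E F r)
      = D2 h (z x) ((z x' - z x) - lift (sensAt h x) (x' - x)) by rw [← e1]]
    rw [map_sub, sub_apply, H.isSens_sensAt x, hq, sub_apply, sub_apply, H.D1_minY, H.D1_minY]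
    ring
  have e3 := H.coer (z x) r
  rw [e2] at e3
  have e4 := q.le_opNorm (inY E F r)
  rw [norm_inY, Real.norm_eq_abs] at e4
  have e5 := neg_le_abs (q (inY E F r))
  have hm := H.pos
  rw [div_mul_eq_mul_div, one_mul, le_div_iff₀ hm]
  rcases (norm_nonneg r).eq_or_lt with h0 | h0
  · rw [← h0, zero_mul]; exact norm_nonneg _
  · refine le_of_mul_le_mul_right ?_ h0
    calc ‖r‖ * m * ‖r‖ = m * ‖r‖ ^ 2 := by ring
      _ ≤ _ := e3.trans (e5.trans e4)

theorem hasFDerivAt_pt_minY (H : Regular h m L R) (x : E) :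
    HasFDerivAt (fun x => pt x (minY h x)) (lift (sensAt h x)) x := by
  simp only [pt_eq]
  exact (inX E F).hasFDerivAt.add ((inY E F).hasFDerivAt.comp x (H.hasFDerivAt_minY x))

theorem continuous_minY (H : Regular h m L R) : Continuous (minY h) :=
  continuous_iff_continuousAt.2 fun x => (H.hasFDerivAt_minY x).continuousAt

/-- Bootstrapping: the derivative of `minY` is `sens` of the Hessian at the minimizer, and operator
inversion is smooth at units. Each order of smoothness of `minY` yields the next as long as D2 h has
it. -/
theorem contDiff_minY_succ (H : Regular h m L R) {n : ℕ} (h2 : ContDiff ℝ n (D2 h))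
    (hn : ContDiff ℝ n (minY h)) : ContDiff ℝ (n + 1) (minY h) := by
  rw [contDiff_succ_iff_fderiv]
  refine ⟨fun x => (H.hasFDerivAt_minY x).differentiableAt, fun hω => by simp at hω, ?_⟩
  have e : fderiv ℝ (minY h) = fun x => sens (D2 h (pt x (minY h x))) :=
    funext fun x => (H.hasFDerivAt_minY x).fderiv
  rw [e]
  have hp : ContDiff ℝ n fun x => D2 h (pt x (minY h x)) := by
    refine h2.comp ?_
    simp only [pt_eq]
    exact (inX E F).contDiff.add ((inY E F).contDiff.comp hn)
  have hYY : ContDiff ℝ n fun x => blockYY (D2 h (pt x (minY h x))) :=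
    contDiff_const.clm_comp (hp.clm_comp contDiff_const)
  have hinv : ContDiff ℝ n fun x => Ring.inverse (blockYY (D2 h (pt x (minY h x)))) := by
    rw [contDiff_iff_contDiffAt]
    intro x
    obtain ⟨U, hU⟩ := (H.coer (pt x (minY h x))).isUnit_blockYY H.pos
    have := contDiffAt_ringInverse ℝ (n := n) U
    rw [hU] at this
    exact this.comp x hYY.contDiffAt
  exact (hinv.clm_comp (contDiff_const.clm_comp (hp.clm_comp contDiff_const))).neg

theorem contDiff_two_minY (H : Regular h m L R) (h3 : ContDiff ℝ 3 (jnt h)) :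
    ContDiff ℝ 2 (minY h) := by
  have h2 : ContDiff ℝ 1 (D2 h) := contDiff_D2 (by convert h3 using 1; norm_num)
  have c0 : ContDiff ℝ (0 : ℕ) (minY h) := contDiff_zero.2 H.continuous_minY
  have c1 := H.contDiff_minY_succ (n := 0) (h2.of_le (by norm_num)) c0
  have c2 := H.contDiff_minY_succ (n := 1) (by simpa using h2) (by simpa using c1)
  simpa [one_add_one_eq_two] using c2

/-- The value function. -/
def env (h : E → F → ℝ) (x : E) : ℝ := h x (minY h x)

/-- Envelope theorem: first-order optimality removes the contribution of the moving minimizer. -/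
theorem hasFDerivAt_env (H : Regular h m L R) (x : E) :
    HasFDerivAt (env h) ((D1 h (pt x (minY h x))).comp (inX E F)) x := by
  have h1 : HasFDerivAt (fun x => jnt h (pt x (minY h x))) _ x :=
    (hasFDerivAt_jnt H.smooth _).comp x (H.hasFDerivAt_pt_minY x)
  refine h1.congr_fderiv ?_
  ext u
  rw [ContinuousLinearMap.comp_apply, lift_apply, map_add, H.D1_minY, add_zero]
  rfl

/-- The derivative of the value function is differentiable; its derivative is given by the Schur
complement. -/
theorem hasFDerivAt_fderiv_env (H : Regular h m L R) (x : E) :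
    HasFDerivAt (fun x => (D1 h (pt x (minY h x))).comp (inX E F))
      ((restrX E F).comp ((D2 h (pt x (minY h x))).comp (lift (sensAt h x)))) x :=
  (restrX E F).hasFDerivAt.comp x
    ((hasFDerivAt_D1 H.smooth _).comp x (H.hasFDerivAt_pt_minY x))

end Regular

end Lower

end FSBA
end

noncomputable section
set_option linter.unusedSectionVars false
set_option maxSynthPendingDepth 3
namespace FSBA

/-- Mean value inequality for G − G'(z) on the ball of radius ‖z' − z‖; this gives c instead of the
sharp c/2. -/
theorem norm_remainder_le {V W : Type*} [NormedAddCommGroup V] [NormedSpace ℝ V]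
    [NormedAddCommGroup W] [NormedSpace ℝ W] {G : V → W} {G' : V → V →L[ℝ] W} {c : ℝ}
    (hc : 0 ≤ c) (hG : ∀ z, HasFDerivAt G (G' z) z)
    (hL : ∀ z z', ‖G' z - G' z'‖ ≤ c * ‖z - z'‖) (z z' : V) :
    ‖G z' - G z - G' z (z' - z)‖ ≤ c * ‖z' - z‖ ^ 2 := by
  have := (convex_closedBall z ‖z' - z‖).norm_image_sub_le_of_norm_hasFDerivWithin_le'
    (f := G) (f' := G') (φ := G' z) (C := c * ‖z' - z‖) (x := z) (y := z')
    (fun x _ => (hG x).hasFDerivWithinAt) (fun x hx => (hL x z).trans (by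
      rw [mem_closedBall_iff_norm] at hx
      gcongr)) (Metric.mem_closedBall_self (norm_nonneg _)) (mem_closedBall_iff_norm.2 le_rfl)
  rw [pow_two, ← mul_assoc]
  exact this

/-! ### The penalized objective and the common regularity constants. -/

section Penalized

variable {E F : Type*} [NormedAddCommGroup E] [InnerProductSpace ℝ E]
  [NormedAddCommGroup F] [InnerProductSpace ℝ F]

/-- The penalized objective `f + λ g`. -/
def pen {E F : Type*} (f g : E → F → ℝ) (lam : ℝ) (x : E) (y : F) : ℝ := f x y + lam * g x y

variable {f g : E → F → ℝ} {lam : ℝ}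

theorem contDiff_pen (hf : ContDiff ℝ 2 (jnt f)) (hg : ContDiff ℝ 2 (jnt g)) :
    ContDiff ℝ 2 (jnt (pen f g lam)) := hf.add (contDiff_const.mul hg)

theorem D1_pen (hf : ContDiff ℝ 2 (jnt f)) (hg : ContDiff ℝ 2 (jnt g)) (z : Prd E F) :
    D1 (pen f g lam) z = D1 f z + lam • D1 g z :=
  ((hasFDerivAt_jnt hf z).add ((hasFDerivAt_jnt hg z).const_mul lam)).fderiv

theorem D2_pen (hf : ContDiff ℝ 2 (jnt f)) (hg : ContDiff ℝ 2 (jnt g)) (z : Prd E F) :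
    D2 (pen f g lam) z = D2 f z + lam • D2 g z := by
  have e : D1 (pen f g lam) = fun z => D1 f z + lam • D1 g z := funext (D1_pen hf hg)
  rw [D2, e]
  exact ((hasFDerivAt_D1 hf z).add ((hasFDerivAt_D1 hg z).const_smul lam)).fderiv

theorem smooth_two (hg : ContDiff ℝ 3 (jnt g)) : ContDiff ℝ 2 (jnt g) :=
  hg.of_le (by norm_num)

/-- Regularity of the pair `(f, g)` with a common bound `Λ` for all Lipschitz constants, and
strong convexity of the penalized objective. -/
structure Reg (f g : E → F → ℝ) (μ Λ lam : ℝ) : Prop where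
  two_le_lam : 2 ≤ lam
  mu_le : μ ≤ Λ
  f_smooth : ContDiff ℝ 2 (jnt f)
  g_smooth : ContDiff ℝ 3 (jnt g)
  f_D1 : ∀ z, ‖D1 f z‖ ≤ Λ
  f_D2 : ∀ z, ‖D2 f z‖ ≤ Λ
  f_D2_lip : ∀ z z', ‖D2 f z - D2 f z'‖ ≤ Λ * ‖z - z'‖
  g_D3 : ∀ z, ‖D3 g z‖ ≤ Λ
  g_D3_lip : ∀ z z', ‖D3 g z - D3 g z'‖ ≤ Λ * ‖z - z'‖
  g_reg : Regular g μ Λ Λ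
  h_reg : Regular (pen f g lam) (lam * μ / 2) ((1 + lam) * Λ) ((1 + lam) * Λ)

namespace Reg

variable {μ Λ : ℝ}

theorem mu_pos (H : Reg f g μ Λ lam) : 0 < μ := H.g_reg.pos

theorem lam_pos (H : Reg f g μ Λ lam) : 0 < lam := by linarith [H.two_le_lam]

theorem Λ_pos (H : Reg f g μ Λ lam) : 0 < Λ := H.mu_pos.trans_le H.mu_le

theorem one_le_kappa (H : Reg f g μ Λ lam) : 1 ≤ Λ / μ := by
  rw [le_div_iff₀ H.mu_pos, one_mul]; exact H.mu_le

theorem f_D1_lip (H : Reg f g μ Λ lam) (z z' : Prd E F) :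
    ‖D1 f z - D1 f z'‖ ≤ Λ * ‖z - z'‖ :=
  norm_sub_le_of_hasFDerivAt (hasFDerivAt_D1 H.f_smooth) H.f_D2 z z'

theorem D3_symm_right (H : Reg f g μ Λ lam) (z a b c : Prd E F) :
    D3 g z a b c = D3 g z a c b := by
  have h1 := (hasFDerivAt_D2 H.g_smooth z).clm_apply (hasFDerivAt_const b z)
  have h2 := (h1.clm_apply (hasFDerivAt_const c z))
  have h3 := (hasFDerivAt_D2 H.g_smooth z).clm_apply (hasFDerivAt_const c z)
  have h4 := (h3.clm_apply (hasFDerivAt_const b z))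
  have e : (fun z => D2 g z b c) = fun z => D2 g z c b :=
    funext fun z => D2_symm (smooth_two H.g_smooth) z b c
  rw [e] at h2
  simpa using congrArg (fun T : Prd E F →L[ℝ] ℝ => T a) (h2.unique h4)

theorem D3_symm_left (H : Reg f g μ Λ lam) (z a b c : Prd E F) :
    D3 g z a b c = D3 g z b a c := by
  have h : ContDiff ℝ 2 (D1 g) := contDiff_D1 (by convert H.g_smooth using 1; norm_num)
  have := (h.contDiffAt.isSymmSndFDerivAt (x := z) (by simp)) a b
  exact congrArg (fun T : Prd E F →L[ℝ] ℝ => T c) this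

end Reg

end Penalized

/-! ### The proxy: derivatives and Lipschitz constant of the Hessian, uniform in λ. -/

section Proxy

set_option linter.unusedSectionVars false

variable {E F : Type*} [NormedAddCommGroup E] [InnerProductSpace ℝ E]
  [NormedAddCommGroup F] [InnerProductSpace ℝ F] [FiniteDimensional ℝ F] [CompleteSpace F]
  {f g : E → F → ℝ} {μ Λ lam : ℝ}

/-- The point `(x, y*(x))`. -/
def ptMin (h : E → F → ℝ) (x : E) : Prd E F := pt x (minY h x)

/-- The proxy `min_y (f + λ g) - λ min_y g` of the hyper-objective. -/
def proxy (f g : E → F → ℝ) (lam : ℝ) (x : E) : ℝ :=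
  Regular.env (pen f g lam) x - lam * Regular.env g x

/-- The derivative of the proxy. -/
def proxyD (f g : E → F → ℝ) (lam : ℝ) (x : E) : E →L[ℝ] ℝ :=
  (D1 (pen f g lam) (ptMin (pen f g lam) x)).comp (inX E F)
    - lam • (D1 g (ptMin g x)).comp (inX E F)

/-- The second derivative of the proxy. -/
def proxyH (f g : E → F → ℝ) (lam : ℝ) (x : E) : E →L[ℝ] E →L[ℝ] ℝ :=
  (Regular.restrX E F).comp ((D2 (pen f g lam) (ptMin (pen f g lam) x)).comp
      (lift (Regular.sensAt (pen f g lam) x)))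
    - lam • (Regular.restrX E F).comp ((D2 g (ptMin g x)).comp (lift (Regular.sensAt g x)))

/-- The form whose mixed restriction is the Hessian of the proxy. -/
def gapForm (f g : E → F → ℝ) (lam : ℝ) (x : E) : Form E F :=
  D2 (pen f g lam) (ptMin (pen f g lam) x) - lam • D2 g (ptMin g x)

namespace Reg

open Regular

theorem hasFDerivAt_proxy (H : Reg f g μ Λ lam) (x : E) :
    HasFDerivAt (proxy f g lam) (proxyD f g lam x) x :=
  (H.h_reg.hasFDerivAt_env x).sub ((H.g_reg.hasFDerivAt_env x).const_mul lam)

theorem hasFDerivAt_proxyD (H : Reg f g μ Λ lam) (x : E) :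
    HasFDerivAt (proxyD f g lam) (proxyH f g lam x) x :=
  (H.h_reg.hasFDerivAt_fderiv_env x).sub ((H.g_reg.hasFDerivAt_fderiv_env x).const_smul lam)

theorem proxyH_apply (H : Reg f g μ Λ lam) (x u v : E) :
    proxyH f g lam x u v
      = D2 (pen f g lam) (ptMin (pen f g lam) x) (lift (sensAt (pen f g lam) x) u)
          (lift (sensAt (pen f g lam) x) v)
        - lam * D2 g (ptMin g x) (lift (sensAt g x) u) (lift (sensAt g x) v) := by
  rw [proxyH, sub_apply, sub_apply, smul_apply, smul_apply]
  congr 1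
  · exact H.h_reg.hess_env_apply x u v
  · rw [smul_eq_mul]; congr 1
    exact H.g_reg.hess_env_apply x u v

/-- Here the two contributions of order λ are merged. Scaling by λ does not change the sensitivity
map of g, so polarization applies to the Hessians of f + λg and λg. -/
theorem proxyH_apply_gapForm (H : Reg f g μ Λ lam) (x u v : E) :
    proxyH f g lam x u v
      = gapForm f g lam x (lift (sensAt (pen f g lam) x) u) (lift (sensAt g x) v) := by
  rw [H.proxyH_apply, gapForm]
  have := (H.h_reg.isSens_sensAt x).schur_sub (B' := lam • D2 g (ptMin g x))
    (fun a b => by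
      rw [smul_apply, smul_apply, smul_apply, smul_apply,
        D2_symm (smooth_two H.g_smooth)])
    ((H.g_reg.isSens_sensAt x).smul lam) u v
  exact this

theorem D1_pen_ptMin (H : Reg f g μ Λ lam) (x : E) (w : F) :
    D1 f (ptMin (pen f g lam) x) (inY E F w)
      = -(lam * D1 g (ptMin (pen f g lam) x) (inY E F w)) := by
  have := H.h_reg.D1_minY x w
  rw [D1_pen H.f_smooth (smooth_two H.g_smooth), add_apply, smul_apply, smul_eq_mul] at this
  exact eq_neg_of_add_eq_zero_left this

/-- At y*_λ the y-gradient of g equals −∇_y f/λ and is at most Λ/λ; strong convexity turns this into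
a distance. -/
theorem norm_minY_sub_le (H : Reg f g μ Λ lam) (x : E) :
    ‖minY (pen f g lam) x - minY g x‖ ≤ Λ / μ / lam := by
  have hl := H.lam_pos
  have := H.Λ_pos
  rw [div_right_comm]
  refine H.g_reg.norm_sub_minY_le (by positivity) fun w => ?_
  have h1 := H.D1_pen_ptMin x w
  have h2 := (D1 f (ptMin (pen f g lam) x)).le_opNorm (inY E F w)
  rw [h1, norm_neg, Real.norm_eq_abs, abs_mul, abs_of_pos hl, norm_inY] at h2
  rw [div_mul_eq_mul_div, le_div_iff₀ hl, mul_comm _ lam]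
  exact h2.trans (by gcongr; exact H.f_D1 _)

theorem norm_ptMin_sub_le (H : Reg f g μ Λ lam) (x : E) :
    ‖ptMin (pen f g lam) x - ptMin g x‖ ≤ Λ / μ / lam := by
  rw [ptMin, ptMin, norm_pt_sub_left]; exact H.norm_minY_sub_le x

theorem gapForm_eq (H : Reg f g μ Λ lam) (x : E) :
    gapForm f g lam x = D2 f (ptMin (pen f g lam) x)
      + lam • (D2 g (ptMin (pen f g lam) x) - D2 g (ptMin g x)) := by
  rw [gapForm, D2_pen H.f_smooth (smooth_two H.g_smooth), smul_sub]
  abel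

/-- The two evaluations of ∇²g are κ/λ apart, which absorbs the factor λ. -/
theorem norm_gapForm_le (H : Reg f g μ Λ lam) (x : E) :
    ‖gapForm f g lam x‖ ≤ 2 * Λ * (Λ / μ) := by
  have hl := H.lam_pos
  have hΛ := H.Λ_pos
  rw [H.gapForm_eq]
  have h1 := H.f_D2 (ptMin (pen f g lam) x)
  have h2 := (H.g_reg.hess_lip (ptMin (pen f g lam) x) (ptMin g x)).trans
    (mul_le_mul_of_nonneg_left (H.norm_ptMin_sub_le x) hΛ.le)
  have h3 : ‖lam • (D2 g (ptMin (pen f g lam) x) - D2 g (ptMin g x))‖ ≤ Λ * (Λ / μ) := by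
    rw [norm_smul, Real.norm_of_nonneg hl.le]
    calc _ ≤ lam * (Λ * (Λ / μ / lam)) := by gcongr
      _ = _ := by field_simp
  have h4 := H.one_le_kappa
  refine (norm_add_le _ _).trans ((add_le_add h1 h3).trans ?_)
  nlinarith

theorem norm_lift_g_le (H : Reg f g μ Λ lam) (x : E) :
    ‖lift (sensAt g x)‖ ≤ 2 * (Λ / μ) := by
  have := H.g_reg.norm_sensAt_le x
  linarith [norm_lift_le (sensAt g x), H.one_le_kappa]

/-- Since λ ≥ 2, 1 + λ ≤ 3λ/2: penalization worsens the conditioning by a factor of at most 3. -/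
theorem ratio_le (H : Reg f g μ Λ lam) :
    (1 + lam) * Λ / (lam * μ / 2) ≤ 3 * (Λ / μ) := by
  have hl := H.lam_pos
  have hΛ := H.Λ_pos
  have hμ := H.mu_pos
  rw [div_le_iff₀ (by positivity)]
  have : 3 * (Λ / μ) * (lam * μ / 2) = 3 / 2 * lam * Λ := by field_simp
  rw [this]
  nlinarith [H.two_le_lam]

theorem norm_lift_h_le (H : Reg f g μ Λ lam) (x : E) :
    ‖lift (sensAt (pen f g lam) x)‖ ≤ 4 * (Λ / μ) := by
  have := (H.h_reg.norm_sensAt_le x).trans H.ratio_le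
  linarith [norm_lift_le (sensAt (pen f g lam) x), H.one_le_kappa]

/-- `sensAt g` is also the sensitivity of λ·D2 g, so the difference of forms is `gapForm`, bounded
independently of λ, while the coercivity constant λμ/2 supplies the 1/λ. -/
theorem norm_sensAt_sub_le (H : Reg f g μ Λ lam) (x : E) :
    ‖sensAt (pen f g lam) x - sensAt g x‖ ≤ 8 * (Λ / μ) ^ 3 / lam := by
  have hl := H.lam_pos
  have hμ := H.mu_pos
  have hΛ := H.Λ_pos
  have := (H.h_reg.isSens_sensAt x).norm_sub_le H.h_reg.pos (H.h_reg.coer _)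
    ((H.g_reg.isSens_sensAt x).smul lam)
  refine this.trans ?_
  calc _ ≤ (2 * Λ * (Λ / μ)) * (2 * (Λ / μ)) / (lam * μ / 2) := by
        gcongr
        · exact H.norm_gapForm_le x
        · exact H.norm_lift_g_le x
    _ = _ := by field_simp; ring

theorem norm_lift_sub_le' (H : Reg f g μ Λ lam) (x : E) :
    ‖lift (sensAt (pen f g lam) x) - lift (sensAt g x)‖ ≤ 8 * (Λ / μ) ^ 3 / lam :=
  (norm_lift_sub_le _ _).trans (H.norm_sensAt_sub_le x)

theorem ptMin_g_lip (H : Reg f g μ Λ lam) (x x' : E) :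
    ‖ptMin g x - ptMin g x'‖ ≤ 2 * (Λ / μ) * ‖x - x'‖ := by
  refine (H.g_reg.norm_pt_minY_sub_le x x').trans ?_
  gcongr
  linarith [H.one_le_kappa]

theorem ptMin_h_lip (H : Reg f g μ Λ lam) (x x' : E) :
    ‖ptMin (pen f g lam) x - ptMin (pen f g lam) x'‖ ≤ 4 * (Λ / μ) * ‖x - x'‖ := by
  refine (H.h_reg.norm_pt_minY_sub_le x x').trans ?_
  gcongr
  linarith [H.one_le_kappa, H.ratio_le]

theorem sensAt_g_lip (H : Reg f g μ Λ lam) (x x' : E) :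
    ‖sensAt g x - sensAt g x'‖ ≤ 4 * (Λ / μ) ^ 3 * ‖x - x'‖ := by
  have hμ := H.mu_pos
  have hΛ := H.Λ_pos
  refine ((H.g_reg.isSens_sensAt x).norm_sub_le hμ (H.g_reg.coer _)
    (H.g_reg.isSens_sensAt x')).trans ?_
  calc _ ≤ (Λ * (2 * (Λ / μ) * ‖x - x'‖)) * (2 * (Λ / μ)) / μ := by
        gcongr
        · refine (H.g_reg.hess_lip _ _).trans ?_
          gcongr
          exact H.ptMin_g_lip x x'
        · exact H.norm_lift_g_le x'
    _ = _ := by field_simp; ring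

theorem sensAt_h_lip (H : Reg f g μ Λ lam) (x x' : E) :
    ‖sensAt (pen f g lam) x - sensAt (pen f g lam) x'‖ ≤ 48 * (Λ / μ) ^ 3 * ‖x - x'‖ := by
  have hμ := H.mu_pos
  have hΛ := H.Λ_pos
  have hl := H.lam_pos
  have hm := H.h_reg.pos
  refine ((H.h_reg.isSens_sensAt x).norm_sub_le hm (H.h_reg.coer _)
    (H.h_reg.isSens_sensAt x')).trans ?_
  calc _ ≤ ((1 + lam) * Λ * (4 * (Λ / μ) * ‖x - x'‖)) * (4 * (Λ / μ)) / (lam * μ / 2) := by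
        gcongr
        · refine (H.h_reg.hess_lip _ _).trans ?_
          gcongr
          exact H.ptMin_h_lip x x'
        · exact H.norm_lift_h_le x'
    _ = ((1 + lam) * Λ / (lam * μ / 2)) * (16 * (Λ / μ) ^ 2 * ‖x - x'‖) := by ring
    _ ≤ 3 * (Λ / μ) * (16 * (Λ / μ) ^ 2 * ‖x - x'‖) := by
        have := H.ratio_le
        gcongr
    _ = _ := by ring

/-- The difference D2 g(x, y*_λ(x)) − D2 g(x, y*(x)) is differentiated in x before norms are taken:
points and lifts are O(1/λ) apart, so Lipschitz continuity of D3 g makes the derivative O(1/λ).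
Bounding the two terms separately would leave a factor λ. -/
theorem gapForm_lip (H : Reg f g μ Λ lam) (x x' : E) :
    ‖gapForm f g lam x - gapForm f g lam x'‖ ≤ 16 * Λ * (Λ / μ) ^ 3 * ‖x - x'‖ := by
  have hμ := H.mu_pos
  have hΛ := H.Λ_pos
  have hl := H.lam_pos
  have hκ := H.one_le_kappa
  set κ := Λ / μ with hκd
  have h1 : ‖D2 f (ptMin (pen f g lam) x) - D2 f (ptMin (pen f g lam) x')‖
      ≤ Λ * (4 * κ * ‖x - x'‖) :=
    (H.f_D2_lip _ _).trans (mul_le_mul_of_nonneg_left (H.ptMin_h_lip x x') hΛ.le)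
  have hd : ∀ x, HasFDerivAt (fun x => D2 g (ptMin (pen f g lam) x) - D2 g (ptMin g x))
      ((D3 g (ptMin (pen f g lam) x)).comp (lift (sensAt (pen f g lam) x))
        - (D3 g (ptMin g x)).comp (lift (sensAt g x))) x := fun x =>
    ((hasFDerivAt_D2 H.g_smooth _).comp x (H.h_reg.hasFDerivAt_pt_minY x)).sub
      ((hasFDerivAt_D2 H.g_smooth _).comp x (H.g_reg.hasFDerivAt_pt_minY x))
  have h2 := norm_sub_le_of_hasFDerivAt (c := 12 * Λ * κ ^ 3 / lam) hd (fun x => by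
    have e : (D3 g (ptMin (pen f g lam) x)).comp (lift (sensAt (pen f g lam) x))
        - (D3 g (ptMin g x)).comp (lift (sensAt g x))
        = (D3 g (ptMin (pen f g lam) x) - D3 g (ptMin g x)).comp
            (lift (sensAt (pen f g lam) x))
          + (D3 g (ptMin g x)).comp (lift (sensAt (pen f g lam) x) - lift (sensAt g x)) := by
      ext; simp
    rw [e]
    refine (norm_add_le _ _).trans ?_
    have a1 : ‖(D3 g (ptMin (pen f g lam) x) - D3 g (ptMin g x)).comp
        (lift (sensAt (pen f g lam) x))‖ ≤ (Λ * (κ / lam)) * (4 * κ) := by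
      refine (ContinuousLinearMap.opNorm_comp_le _ _).trans ?_
      gcongr
      · exact (H.g_D3_lip _ _).trans (mul_le_mul_of_nonneg_left (H.norm_ptMin_sub_le x) hΛ.le)
      · exact H.norm_lift_h_le x
    have a2 : ‖(D3 g (ptMin g x)).comp (lift (sensAt (pen f g lam) x) - lift (sensAt g x))‖
        ≤ Λ * (8 * κ ^ 3 / lam) := by
      refine (ContinuousLinearMap.opNorm_comp_le _ _).trans ?_
      gcongr
      · exact H.g_D3 _
      · exact H.norm_lift_sub_le' x
    have a3 : Λ * (κ / lam) * (4 * κ) ≤ 4 * Λ * κ ^ 3 / lam := by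
      have : Λ * (κ / lam) * (4 * κ) = 4 * Λ * κ ^ 2 / lam := by ring
      rw [this]
      gcongr
      · norm_num
    calc _ ≤ 4 * Λ * κ ^ 3 / lam + Λ * (8 * κ ^ 3 / lam) := by linarith
      _ = _ := by ring) x x'
  have e : gapForm f g lam x - gapForm f g lam x'
      = (D2 f (ptMin (pen f g lam) x) - D2 f (ptMin (pen f g lam) x'))
        + lam • ((D2 g (ptMin (pen f g lam) x) - D2 g (ptMin g x))
          - (D2 g (ptMin (pen f g lam) x') - D2 g (ptMin g x'))) := by
    rw [H.gapForm_eq, H.gapForm_eq]; module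
  rw [e]
  refine (norm_add_le _ _).trans ?_
  rw [norm_smul, Real.norm_of_nonneg hl.le]
  have h3 : lam * ‖D2 g (ptMin (pen f g lam) x) - D2 g (ptMin g x)
          - (D2 g (ptMin (pen f g lam) x') - D2 g (ptMin g x'))‖
      ≤ 12 * Λ * κ ^ 3 * ‖x - x'‖ := by
    calc _ ≤ lam * (12 * Λ * κ ^ 3 / lam * ‖x - x'‖) := by gcongr
      _ = _ := by field_simp
  have h4 : Λ * (4 * κ * ‖x - x'‖) ≤ 4 * Λ * κ ^ 3 * ‖x - x'‖ := by
    have : Λ * (4 * κ * ‖x - x'‖) = 4 * Λ * κ * ‖x - x'‖ := by ring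
    rw [this]
    gcongr
    exact le_self_pow₀ hκ (by norm_num)
  linarith

/-- Product rule for Q(a u)(b v): the variations of the form and of the two lifts contribute 128,
192 and 32 times Λκ⁵. -/
theorem proxyH_lip (H : Reg f g μ Λ lam) (x x' : E) :
    ‖proxyH f g lam x - proxyH f g lam x'‖ ≤ 352 * Λ * (Λ / μ) ^ 5 * ‖x - x'‖ := by
  have hμ := H.mu_pos
  have hΛ := H.Λ_pos
  have hκ := H.one_le_kappa
  set κ := Λ / μ with hκd
  refine ContinuousLinearMap.opNorm_le_bound₂ _ (by positivity) fun u v => ?_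
  set Q := gapForm f g lam x
  set Q' := gapForm f g lam x'
  set a := lift (sensAt (pen f g lam) x) with ha
  set a' := lift (sensAt (pen f g lam) x')
  set b := lift (sensAt g x)
  set b' := lift (sensAt g x')
  have e : (proxyH f g lam x - proxyH f g lam x') u v
      = (Q - Q') (a u) (b v) + Q' ((a - a') u) (b v) + Q' (a' u) ((b - b') v) := by
    rw [sub_apply, sub_apply, H.proxyH_apply_gapForm, H.proxyH_apply_gapForm]
    simp only [sub_apply, map_sub]
    ring
  have na : ‖a u‖ ≤ 4 * κ * ‖u‖ := a.le_of_opNorm_le (H.norm_lift_h_le x) u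
  have na' : ‖a' u‖ ≤ 4 * κ * ‖u‖ := a'.le_of_opNorm_le (H.norm_lift_h_le x') u
  have nb : ‖b v‖ ≤ 2 * κ * ‖v‖ := b.le_of_opNorm_le (H.norm_lift_g_le x) v
  have nda : ‖(a - a') u‖ ≤ 48 * κ ^ 3 * ‖x - x'‖ * ‖u‖ :=
    (a - a').le_of_opNorm_le ((norm_lift_sub_le _ _).trans (H.sensAt_h_lip x x')) u
  have ndb : ‖(b - b') v‖ ≤ 4 * κ ^ 3 * ‖x - x'‖ * ‖v‖ :=
    (b - b').le_of_opNorm_le ((norm_lift_sub_le _ _).trans (H.sensAt_g_lip x x')) v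
  have nQ : ‖Q'‖ ≤ 2 * Λ * κ := H.norm_gapForm_le x'
  have ndQ : ‖Q - Q'‖ ≤ 16 * Λ * κ ^ 3 * ‖x - x'‖ := H.gapForm_lip x x'
  have t1 : |(Q - Q') (a u) (b v)|
      ≤ (16 * Λ * κ ^ 3 * ‖x - x'‖) * (4 * κ * ‖u‖) * (2 * κ * ‖v‖) :=
    (form_apply_le _ _ _).trans (by gcongr)
  have t2 : |Q' ((a - a') u) (b v)|
      ≤ (2 * Λ * κ) * (48 * κ ^ 3 * ‖x - x'‖ * ‖u‖) * (2 * κ * ‖v‖) :=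
    (form_apply_le _ _ _).trans (by gcongr)
  have t3 : |Q' (a' u) ((b - b') v)|
      ≤ (2 * Λ * κ) * (4 * κ * ‖u‖) * (4 * κ ^ 3 * ‖x - x'‖ * ‖v‖) :=
    (form_apply_le _ _ _).trans (by gcongr)
  rw [e, Real.norm_eq_abs]
  refine (abs_add_three _ _ _).trans ((add_le_add_three t1 t2 t3).trans (le_of_eq ?_))
  ring

end Reg

end Proxy

end FSBA
end

noncomputable section
set_option linter.unusedSectionVars false
set_option maxSynthPendingDepth 3
namespace FSBA

/-! ### Closeness of the proxy and the hyper-objective up to second order. -/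

section HyperObjective

variable {E F : Type*} [NormedAddCommGroup E] [InnerProductSpace ℝ E] [CompleteSpace E]
  [NormedAddCommGroup F] [InnerProductSpace ℝ F] [FiniteDimensional ℝ F] [CompleteSpace F]
  {f g : E → F → ℝ} {μ Λ lam : ℝ}

namespace Reg

open Regular

set_option linter.unusedSectionVars false

/-- y*(x) is a competitor in the minimization of f + λg. -/
theorem proxy_le_hyperObj (H : Reg f g μ Λ lam) (x : E) :
    proxy f g lam x ≤ hyperObj f g x := by
  have := H.h_reg.minY_le x (minY g x)
  simp only [pen] at this
  simp only [proxy, Regular.env, pen, hyperObj]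
  change _ ≤ f x (minY g x)
  linarith

/-- The penalty excess of y*_λ is nonnegative and can be dropped; what remains is the variation of f
between y*_λ and y*. -/
theorem hyperObj_le_proxy (H : Reg f g μ Λ lam) (x : E) :
    hyperObj f g x - Λ * (Λ / μ / lam) ≤ proxy f g lam x := by
  have h1 := H.g_reg.minY_le x (minY (pen f g lam) x)
  have h2 := norm_sub_le_of_hasFDerivAt (hasFDerivAt_jnt H.f_smooth) H.f_D1 (ptMin g x)
    (ptMin (pen f g lam) x)
  rw [norm_sub_rev (ptMin g x)] at h2
  have h3 := h2.trans (mul_le_mul_of_nonneg_left (H.norm_ptMin_sub_le x) H.Λ_pos.le)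
  rw [Real.norm_eq_abs, ptMin, ptMin, jnt_pt, jnt_pt] at h3
  have h4 := le_abs_self (f x (minY g x) - f x (minY (pen f g lam) x))
  have h5 := mul_le_mul_of_nonneg_left h1 H.lam_pos.le
  simp only [proxy, Regular.env, pen, hyperObj]
  change f x (minY g x) - _ ≤ _
  linarith

/-- The derivative of the hyper-objective. -/
def _root_.FSBA.hyperD (f g : E → F → ℝ) (x : E) : E →L[ℝ] ℝ :=
  (D1 f (ptMin g x)).comp (lift (sensAt g x))

theorem hasFDerivAt_hyperObj (H : Reg f g μ Λ lam) (x : E) :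
    HasFDerivAt (hyperObj f g) (hyperD f g x) x :=
  HasFDerivAt.comp (g := jnt f) x (hasFDerivAt_jnt H.f_smooth _) (H.g_reg.hasFDerivAt_pt_minY x)

theorem contDiff_hyperObj (H : Reg f g μ Λ lam) : ContDiff ℝ 2 (hyperObj f g) := by
  have h1 : ContDiff ℝ 2 fun x : E => pt x (minY g x) := by
    simp only [pt_eq]
    exact (inX E F).contDiff.add ((inY E F).contDiff.comp (H.g_reg.contDiff_two_minY H.g_smooth))
  exact H.f_smooth.comp h1

theorem D1_g_remainder (H : Reg f g μ Λ lam) (x : E) :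
    ‖D1 g (ptMin (pen f g lam) x) - D1 g (ptMin g x)
      - D2 g (ptMin g x) (ptMin (pen f g lam) x - ptMin g x)‖ ≤ Λ * (Λ / μ / lam) ^ 2 := by
  refine (norm_remainder_le H.Λ_pos.le (hasFDerivAt_D1 H.g_reg.smooth) H.g_reg.hess_lip _
    _).trans ?_
  have := H.Λ_pos
  gcongr
  exact H.norm_ptMin_sub_le x

theorem D2_g_remainder (H : Reg f g μ Λ lam) (x : E) :
    ‖D2 g (ptMin (pen f g lam) x) - D2 g (ptMin g x)
      - D3 g (ptMin g x) (ptMin (pen f g lam) x - ptMin g x)‖ ≤ Λ * (Λ / μ / lam) ^ 2 := by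
  refine (norm_remainder_le H.Λ_pos.le (hasFDerivAt_D2 H.g_smooth) H.g_D3_lip _ _).trans ?_
  have := H.Λ_pos
  gcongr
  exact H.norm_ptMin_sub_le x

theorem ptMin_sub_eq (x : E) :
    ptMin (pen f g lam) x - ptMin g x = inY E F (minY (pen f g lam) x - minY g x) := by
  rw [ptMin, ptMin, pt_sub_pt, sub_self, map_zero, zero_add]

theorem D1_f_diff (H : Reg f g μ Λ lam) (x : E) :
    ‖D1 f (ptMin (pen f g lam) x) - D1 f (ptMin g x)‖ ≤ Λ * (Λ / μ / lam) :=
  (H.f_D1_lip _ _).trans (mul_le_mul_of_nonneg_left (H.norm_ptMin_sub_le x) H.Λ_pos.le)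

/-- The gradient of the proxy approximates the hyper-gradient. -/
theorem norm_hyperD_sub_proxyD_le (H : Reg f g μ Λ lam) (x : E) :
    ‖hyperD f g x - proxyD f g lam x‖ ≤ 4 * Λ * (Λ / μ) ^ 3 / lam := by
  have hμ := H.mu_pos
  have hΛ := H.Λ_pos
  have hl := H.lam_pos
  have hκ := H.one_le_kappa
  have r1 := H.D1_g_remainder x
  have r2 := H.D1_f_diff x
  have hY := H.norm_lift_g_le x
  set κ := Λ / μ with hκd
  clear_value κ
  refine ContinuousLinearMap.opNorm_le_bound _ (by positivity) fun u => ?_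
  set a := lift (sensAt g x) u with ha
  set z := ptMin g x
  set zl := ptMin (pen f g lam) x
  have e0 : a = inX E F u + inY E F (sensAt g x u) := rfl
  have na : ‖a‖ ≤ 2 * κ * ‖u‖ := (lift (sensAt g x)).le_of_opNorm_le hY u
  have e1 : D1 (pen f g lam) zl (inX E F u) = D1 f zl a + lam * D1 g zl a := by
    have h1 : D1 (pen f g lam) zl a = D1 (pen f g lam) zl (inX E F u) := by
      rw [e0, map_add]
      have : D1 (pen f g lam) zl (inY E F (sensAt g x u)) = 0 := H.h_reg.D1_minY x _
      rw [this, add_zero]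
    rw [← h1, D1_pen H.f_smooth H.g_reg.smooth]; rfl
  have e2 : D1 g z (inX E F u) = D1 g z a := by
    rw [e0, map_add]
    have : D1 g z (inY E F (sensAt g x u)) = 0 := H.g_reg.D1_minY x _
    rw [this, add_zero]
  -- The linear term of g vanishes, as zl − z lies in the second block, to which a is orthogonal.
  -- Only the Taylor remainder, of order λ⁻², is multiplied by λ.
  have e3 : D2 g z (zl - z) a = 0 := by
    rw [D2_symm H.g_reg.smooth, ptMin_sub_eq]
    exact H.g_reg.isSens_sensAt x u _
  have e4 : (hyperD f g x - proxyD f g lam x) u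
      = -((D1 f zl - D1 f z) a) - lam * (D1 g zl - D1 g z - D2 g z (zl - z)) a := by
    have h1 : hyperD f g x u = D1 f z a := rfl
    have h2 : proxyD f g lam x u
      = D1 (pen f g lam) zl (inX E F u) - lam * D1 g z (inX E F u) := rfl
    rw [sub_apply, h1, h2, e1, e2, sub_apply, sub_apply, sub_apply, e3]
    ring
  have t1 : |(D1 f zl - D1 f z) a| ≤ Λ * (κ / lam) * (2 * κ * ‖u‖) := by
    refine ((D1 f zl - D1 f z).le_opNorm a).trans ?_
    gcongr
  have t2 : |(D1 g zl - D1 g z - D2 g z (zl - z)) a| ≤ Λ * (κ / lam) ^ 2 * (2 * κ * ‖u‖) := by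
    refine ((D1 g zl - D1 g z - D2 g z (zl - z)).le_opNorm a).trans ?_
    gcongr
  have t3 : Λ * (κ / lam) * (2 * κ * ‖u‖) ≤ 2 * Λ * κ ^ 3 / lam * ‖u‖ := by
    calc _ = 2 * Λ * κ ^ 2 / lam * ‖u‖ := by ring
      _ ≤ _ := by gcongr; norm_num
  have t4 : lam * (Λ * (κ / lam) ^ 2 * (2 * κ * ‖u‖)) = 2 * Λ * κ ^ 3 / lam * ‖u‖ := by
    field_simp
  rw [e4, Real.norm_eq_abs]
  calc _ ≤ |(D1 f zl - D1 f z) a| + lam * |(D1 g zl - D1 g z - D2 g z (zl - z)) a| := by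
        refine (abs_sub _ _).trans ?_
        rw [abs_neg, abs_mul, abs_of_pos hl]
    _ ≤ Λ * (κ / lam) * (2 * κ * ‖u‖) + lam * (Λ * (κ / lam) ^ 2 * (2 * κ * ‖u‖)) := by gcongr
    _ ≤ 2 * Λ * κ ^ 3 / lam * ‖u‖ + 2 * Λ * κ ^ 3 / lam * ‖u‖ := add_le_add t3 t4.le
    _ = 4 * Λ * κ ^ 3 / lam * ‖u‖ := by ring

/-- The second derivative of the hyper-objective along a direction, through the second derivative
`q` of the lower-level solution. -/
theorem exists_hess_hyperObj (H : Reg f g μ Λ lam) (x v : E) :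
    ∃ q : F, (∀ w, D3 g (ptMin g x) (lift (sensAt g x) v) (lift (sensAt g x) v) (inY E F w)
        + D2 g (ptMin g x) (inY E F q) (inY E F w) = 0) ∧
      inner ℝ (fderiv ℝ (gradient (hyperObj f g)) x v) v
        = D2 f (ptMin g x) (lift (sensAt g x) v) (lift (sensAt g x) v)
          + D1 f (ptMin g x) (inY E F q) := by
  set a := lift (sensAt g x) v with ha
  have hfd : fderiv ℝ (minY g) = sensAt g := funext fun x => (H.g_reg.hasFDerivAt_minY x).fderiv
  have hs1 : ContDiff ℝ 1 (sensAt g) := by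
    rw [← hfd]
    exact (H.g_reg.contDiff_two_minY H.g_smooth).fderiv_right (by norm_num)
  have hs : HasFDerivAt (sensAt g) (fderiv ℝ (sensAt g) x) x :=
    (hs1.differentiable (by norm_num) x).hasFDerivAt
  set q := fderiv ℝ (sensAt g) x v v with hq
  have hp : HasFDerivAt (ptMin g) (lift (sensAt g x)) x := H.g_reg.hasFDerivAt_pt_minY x
  have ha' : HasFDerivAt (fun x' => lift (sensAt g x') v)
      ((inY E F).comp ((fderiv ℝ (sensAt g) x).flip v)) x := by
    have h1 := (hs.clm_apply (hasFDerivAt_const v x))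
    have h2 := ((inY E F).hasFDerivAt.comp x h1).const_add (inX E F v)
    refine h2.congr_fderiv ?_
    ext u; simp
  refine ⟨q, fun w => ?_, ?_⟩
  -- The equation for q is the derivative, in direction v, of the orthogonality relation that
  -- defines the sensitivity.
  · have h1 : HasFDerivAt (fun x' => D2 g (ptMin g x') (lift (sensAt g x') v) (inY E F w)) _ x :=
      (((hasFDerivAt_D2 H.g_smooth _).comp x hp).clm_apply ha').clm_apply
        (hasFDerivAt_const (inY E F w) x)
    have h2 : (fun x' => D2 g (ptMin g x') (lift (sensAt g x') v) (inY E F w)) = fun _ => 0 :=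
      funext fun x' => H.g_reg.isSens_sensAt x' v w
    rw [h2] at h1
    have h3 := congrArg (fun T : E →L[ℝ] ℝ => T v) (h1.unique (hasFDerivAt_const (0 : ℝ) x))
    have h4 : D2 g (ptMin g x) (inY E F q) (inY E F w)
        + D3 g (ptMin g x) a a (inY E F w) = 0 := by
      simpa [← ha, ← hq] using h3
    linarith
  · have hφ : fderiv ℝ (hyperObj f g) = hyperD f g :=
      funext fun x => (H.hasFDerivAt_hyperObj x).fderiv
    have hφ1 : ContDiff ℝ 1 (hyperD f g) := by
      rw [← hφ]; exact H.contDiff_hyperObj.fderiv_right (by norm_num)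
    have hφd : HasFDerivAt (hyperD f g) (fderiv ℝ (hyperD f g) x) x :=
      (hφ1.differentiable (by norm_num) x).hasFDerivAt
    have hg : gradient (hyperObj f g) = fun x => riesz (ContinuousLinearMap.id ℝ E)
        (hyperD f g x) := funext fun x => by
      rw [gradient, hφ, riesz_apply]; rfl
    have hgd : fderiv ℝ (gradient (hyperObj f g)) x
        = (riesz (ContinuousLinearMap.id ℝ E)).comp (fderiv ℝ (hyperD f g) x) := by
      rw [hg]
      exact ((riesz (ContinuousLinearMap.id ℝ E)).hasFDerivAt.comp x hφd).fderiv
    rw [hgd, ContinuousLinearMap.comp_apply, inner_riesz, ContinuousLinearMap.id_apply]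
    have h1 : HasFDerivAt (fun x' => D1 f (ptMin g x') (lift (sensAt g x') v)) _ x :=
      ((hasFDerivAt_D1 H.f_smooth _).comp x hp).clm_apply ha'
    have h2 : HasFDerivAt (fun x' => hyperD f g x' v) _ x :=
      hφd.clm_apply (hasFDerivAt_const v x)
    have h3 := congrArg (fun T : E →L[ℝ] ℝ => T v) (h2.unique h1)
    have h4 : fderiv ℝ (hyperD f g) x v v
        = D1 f (ptMin g x) (inY E F q) + D2 f (ptMin g x) a a := by
      simpa [← ha, ← hq] using h3
    linarith

/-- The Hessian of the proxy approximates the Hessian of the hyper-objective. -/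
theorem abs_hess_hyperObj_sub_le (H : Reg f g μ Λ lam) (x v : E) :
    |proxyH f g lam x v v - inner ℝ (fderiv ℝ (gradient (hyperObj f g)) x v) v|
      ≤ 48 * Λ * (Λ / μ) ^ 5 / lam * ‖v‖ ^ 2 := by
  have hμ := H.mu_pos
  have hΛ := H.Λ_pos
  have hl := H.lam_pos
  have hκ := H.one_le_kappa
  obtain ⟨q, hq, hφ⟩ := H.exists_hess_hyperObj x v
  have r1 := H.D1_g_remainder x
  have r2 := H.D1_f_diff x
  have r3 := H.D2_g_remainder x
  have r4 : ‖D2 f (ptMin (pen f g lam) x) - D2 f (ptMin g x)‖ ≤ Λ * (Λ / μ / lam) :=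
    (H.f_D2_lip _ _).trans (mul_le_mul_of_nonneg_left (H.norm_ptMin_sub_le x) hΛ.le)
  have hY := H.norm_lift_g_le x
  have hd := H.norm_lift_sub_le' x
  have hQ := H.norm_gapForm_le x
  have hP := H.D1_pen_ptMin x q
  rw [hφ, H.proxyH_apply_gapForm]
  have hk : Λ / μ * μ = Λ := by field_simp
  set κ := Λ / μ with hκd
  clear_value κ
  set a := lift (sensAt g x) v with ha
  set al := lift (sensAt (pen f g lam) x) v with hal
  set z := ptMin g x with hz
  set zl := ptMin (pen f g lam) x with hzl
  have ez : zl - z = inY E F (minY (pen f g lam) x - minY g x) := ptMin_sub_eq x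
  have na : ‖a‖ ≤ 2 * κ * ‖v‖ := (lift (sensAt g x)).le_of_opNorm_le hY v
  have nd : ‖al - a‖ ≤ 8 * κ ^ 3 / lam * ‖v‖ :=
    (lift (sensAt (pen f g lam) x) - lift (sensAt g x)).le_of_opNorm_le hd v
  -- Coercivity of D2 g in the equation for q, tested with w = q.
  have nq : ‖q‖ ≤ 4 * κ ^ 3 * ‖v‖ ^ 2 := by
    have h1 := H.g_reg.coer z q
    have h2 := hq q
    have h3 : |D3 g z a a (inY E F q)| ≤ Λ * (2 * κ * ‖v‖) * (2 * κ * ‖v‖) * ‖q‖ := by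
      have := form_apply_le (D3 g z a) a (inY E F q)
      rw [norm_inY] at this
      refine this.trans ?_
      gcongr
      exact (D3 g z).le_of_opNorm_le_of_le (H.g_D3 z) na
    have h4 : μ * ‖q‖ ^ 2 ≤ Λ * (2 * κ * ‖v‖) * (2 * κ * ‖v‖) * ‖q‖ := by
      have := neg_le_abs (D3 g z a a (inY E F q))
      linarith
    rcases (norm_nonneg q).eq_or_lt with h0 | h0
    · rw [← h0]; positivity
    · have h5 : μ * ‖q‖ ≤ Λ * (2 * κ * ‖v‖) * (2 * κ * ‖v‖) := by
        refine le_of_mul_le_mul_right ?_ h0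
        calc μ * ‖q‖ * ‖q‖ = μ * ‖q‖ ^ 2 := by ring
          _ ≤ _ := h4
      refine le_of_mul_le_mul_left (h5.trans (le_of_eq ?_)) hμ
      rw [← hk]; ring
  -- Testing the equation for q with y*_λ − y* trades the third derivative of g along zl − z for a
  -- second derivative in direction q.
  have eD3 : D3 g z (zl - z) a a = -(D2 g z (zl - z) (inY E F q)) := by
    have h1 := hq (minY (pen f g lam) x - minY g x)
    rw [← ez, H.D3_symm_right, H.D3_symm_left] at h1
    rw [D2_symm H.g_reg.smooth z (zl - z)]
    linarith
  have eg : D1 g z (inY E F q) = 0 := H.g_reg.D1_minY x q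
  -- The λ-weighted terms that are not small are matched by `eD3` and by the optimality of y*_λ in
  -- direction q. Only Taylor remainders of g, differences of derivatives of f and the change of
  -- lift survive; they contribute 32 + 4 + 4 + 4 + 4 = 48.
  have e : gapForm f g lam x al a - (D2 f z a a + D1 f z (inY E F q))
      = gapForm f g lam x (al - a) a + (D2 f zl - D2 f z) a a
        + lam * (D2 g zl - D2 g z - D3 g z (zl - z)) a a
        + (lam * (D1 g zl - D1 g z - D2 g z (zl - z)) (inY E F q)
          + (D1 f zl - D1 f z) (inY E F q)) := by
    have h1 : gapForm f g lam x a a = D2 f zl a a + lam * (D2 g zl a a - D2 g z a a) := by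
      rw [H.gapForm_eq]; rfl
    simp only [map_sub, sub_apply, h1, eg, hP]
    have h2 := eD3
    simp only [map_sub, sub_apply] at h2
    rw [h2]
    ring
  have t1 : |gapForm f g lam x (al - a) a|
      ≤ (2 * Λ * κ) * (8 * κ ^ 3 / lam * ‖v‖) * (2 * κ * ‖v‖) :=
    (form_apply_le _ _ _).trans (by gcongr)
  have t2 : |(D2 f zl - D2 f z) a a| ≤ (Λ * (κ / lam)) * (2 * κ * ‖v‖) * (2 * κ * ‖v‖) :=
    (form_apply_le _ _ _).trans (by gcongr)
  have t3 : |(D2 g zl - D2 g z - D3 g z (zl - z)) a a|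
      ≤ (Λ * (κ / lam) ^ 2) * (2 * κ * ‖v‖) * (2 * κ * ‖v‖) :=
    (form_apply_le _ _ _).trans (by gcongr)
  have t4 : |(D1 g zl - D1 g z - D2 g z (zl - z)) (inY E F q)|
      ≤ (Λ * (κ / lam) ^ 2) * (4 * κ ^ 3 * ‖v‖ ^ 2) := by
    refine ((D1 g zl - D1 g z - D2 g z (zl - z)).le_opNorm _).trans ?_
    rw [norm_inY]
    gcongr
  have t5 : |(D1 f zl - D1 f z) (inY E F q)| ≤ (Λ * (κ / lam)) * (4 * κ ^ 3 * ‖v‖ ^ 2) := by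
    refine ((D1 f zl - D1 f z).le_opNorm _).trans ?_
    rw [norm_inY]
    gcongr
  have hpow : ∀ n ≤ 5, κ ^ n ≤ κ ^ 5 := fun n hn => pow_le_pow_right₀ hκ hn
  have c0 : 0 ≤ Λ / lam * ‖v‖ ^ 2 := by positivity
  have s1 : (2 * Λ * κ) * (8 * κ ^ 3 / lam * ‖v‖) * (2 * κ * ‖v‖)
      = 32 * (κ ^ 5 * (Λ / lam * ‖v‖ ^ 2)) := by ring
  have s2 : (Λ * (κ / lam)) * (2 * κ * ‖v‖) * (2 * κ * ‖v‖)
      ≤ 4 * (κ ^ 5 * (Λ / lam * ‖v‖ ^ 2)) := by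
    calc _ = 4 * (κ ^ 3 * (Λ / lam * ‖v‖ ^ 2)) := by ring
      _ ≤ _ := by gcongr; norm_num
  have s3 : lam * ((Λ * (κ / lam) ^ 2) * (2 * κ * ‖v‖) * (2 * κ * ‖v‖))
      ≤ 4 * (κ ^ 5 * (Λ / lam * ‖v‖ ^ 2)) := by
    calc _ = 4 * (κ ^ 4 * (Λ / lam * ‖v‖ ^ 2)) := by field_simp; ring
      _ ≤ _ := by gcongr; norm_num
  have s4 : lam * ((Λ * (κ / lam) ^ 2) * (4 * κ ^ 3 * ‖v‖ ^ 2))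
      = 4 * (κ ^ 5 * (Λ / lam * ‖v‖ ^ 2)) := by field_simp
  have s5 : (Λ * (κ / lam)) * (4 * κ ^ 3 * ‖v‖ ^ 2) ≤ 4 * (κ ^ 5 * (Λ / lam * ‖v‖ ^ 2)) := by
    calc _ = 4 * (κ ^ 4 * (Λ / lam * ‖v‖ ^ 2)) := by ring
      _ ≤ _ := by gcongr; norm_num
  have t3' := mul_le_mul_of_nonneg_left t3 hl.le
  have t4' := mul_le_mul_of_nonneg_left t4 hl.le
  rw [e]
  refine (abs_add_le _ _).trans ((add_le_add (abs_add_three _ _ _) (abs_add_le _ _)).trans ?_)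
  rw [abs_mul, abs_mul, abs_of_pos hl]
  have : 48 * Λ * κ ^ 5 / lam * ‖v‖ ^ 2 = 48 * (κ ^ 5 * (Λ / lam * ‖v‖ ^ 2)) := by ring
  rw [this]
  linarith

end Reg

end HyperObjective

end FSBA
end

noncomputable section
set_option linter.unusedSectionVars false
set_option maxSynthPendingDepth 3
namespace FSBA

/-! ### Derivative bounds from Lipschitz bounds, and regularity from the assumptions. -/

section Generic

variable {V W : Type*} [NormedAddCommGroup V] [NormedSpace ℝ V] [NormedAddCommGroup W]
  [NormedSpace ℝ W]

/-- Two distinct points are needed to exclude a negative constant; in the product space they exist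
because F is nontrivial. -/
theorem nonneg_of_lipschitz_bound [Nontrivial V] {G : V → W} {c : ℝ}
    (hc : ∀ z z', ‖G z - G z'‖ ≤ c * ‖z - z'‖) : 0 ≤ c := by
  obtain ⟨z, hz⟩ := exists_ne (0 : V)
  have h := (norm_nonneg _).trans (hc z 0)
  rw [sub_zero] at h
  exact nonneg_of_mul_nonneg_left h (norm_pos_iff.2 hz)

theorem norm_le_of_lipschitz_bound [Nontrivial V] {G : V → W} {G' : V →L[ℝ] W} {z : V} {c : ℝ}
    (hG : HasFDerivAt G G' z) (hc : ∀ z z', ‖G z - G z'‖ ≤ c * ‖z - z'‖) : ‖G'‖ ≤ c :=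
  hG.le_of_lip' (nonneg_of_lipschitz_bound hc) (Filter.Eventually.of_forall fun z' => hc z' z)

theorem norm_iteratedFDeriv_succ_sub (n : ℕ) (G : V → W) (z z' : V) :
    ‖iteratedFDeriv ℝ (n + 1) G z - iteratedFDeriv ℝ (n + 1) G z'‖
      = ‖iteratedFDeriv ℝ n (fderiv ℝ G) z - iteratedFDeriv ℝ n (fderiv ℝ G) z'‖ := by
  rw [iteratedFDeriv_succ_eq_comp_right, iteratedFDeriv_succ_eq_comp_right, Function.comp_apply,
    Function.comp_apply, ← map_sub, LinearIsometryEquiv.norm_map]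

theorem norm_iteratedFDeriv_zero_sub (G : V → W) (z z' : V) :
    ‖iteratedFDeriv ℝ 0 G z - iteratedFDeriv ℝ 0 G z'‖ = ‖G z - G z'‖ := by
  rw [iteratedFDeriv_zero_eq_comp, Function.comp_apply,
    Function.comp_apply, ← map_sub, LinearIsometryEquiv.norm_map]

end Generic

section Bridge

variable {E F : Type*} [NormedAddCommGroup E] [InnerProductSpace ℝ E] [CompleteSpace E]
  [NormedAddCommGroup F] [InnerProductSpace ℝ F] [CompleteSpace F]
  {f g h : E → F → ℝ} {μ C ℓ ρ ν lam : ℝ}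

theorem norm_D1_sub_eq (z z' : Prd E F) :
    ‖D1 h z - D1 h z'‖ = ‖gradient (jnt h) z - gradient (jnt h) z'‖ := by
  rw [gradient, gradient, ← map_sub, LinearIsometryEquiv.norm_map]; rfl

theorem norm_D2_sub_le (hh : ContDiff ℝ 2 (jnt h)) (z z' : Prd E F) :
    ‖D2 h z - D2 h z'‖ ≤ ‖fderiv ℝ (gradient (jnt h)) z - fderiv ℝ (gradient (jnt h)) z'‖ := by
  have hg : gradient (jnt h) = fun z => riesz (ContinuousLinearMap.id ℝ (Prd E F)) (D1 h z) :=
    rfl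
  have hd : ∀ z, fderiv ℝ (gradient (jnt h)) z
      = (riesz (ContinuousLinearMap.id ℝ (Prd E F))).comp (D2 h z) := fun z => by
    rw [hg]
    exact ((riesz (ContinuousLinearMap.id ℝ (Prd E F))).hasFDerivAt.comp z
      (hasFDerivAt_D1 hh z)).fderiv
  refine ContinuousLinearMap.opNorm_le_bound₂ _ (norm_nonneg _) fun a b => ?_
  have e : (D2 h z - D2 h z') a b
      = inner ℝ ((fderiv ℝ (gradient (jnt h)) z - fderiv ℝ (gradient (jnt h)) z') a) b := by
    rw [hd, hd, sub_apply, sub_apply, sub_apply, inner_sub_left]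
    simp
  rw [e]
  refine (norm_inner_le_norm _ _).trans ?_
  gcongr
  exact ContinuousLinearMap.le_opNorm _ _

theorem norm_D3_sub_eq (z z' : Prd E F) :
    ‖D3 h z - D3 h z'‖ = ‖iteratedFDeriv ℝ 3 (jnt h) z - iteratedFDeriv ℝ 3 (jnt h) z'‖ := by
  rw [norm_iteratedFDeriv_succ_sub, norm_iteratedFDeriv_succ_sub, norm_iteratedFDeriv_succ_sub,
    norm_iteratedFDeriv_zero_sub]
  rfl

instance [Nontrivial F] : Nontrivial (Prd E F) := by
  obtain ⟨w, hw⟩ := exists_ne (0 : F)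
  refine ⟨inY E F w, 0, fun h => hw ?_⟩
  rw [← norm_eq_zero, ← norm_inY (E := E), h, norm_zero]

namespace Regular

variable {m L R L' R' : ℝ}

theorem mono (H : Regular h m L R) (hL : L ≤ L') (hR : R ≤ R') : Regular h m L' R' :=
  ⟨H.pos, H.smooth, H.coer, fun z => (H.hess_le z).trans hL,
    fun z z' => (H.hess_lip z z').trans (by gcongr)⟩

end Regular

namespace Assumptions

theorem f_smooth' (A : Assumptions f g μ C ℓ ρ ν) : ContDiff ℝ 2 (jnt f) := A.f_smooth

theorem g_smooth' (A : Assumptions f g μ C ℓ ρ ν) : ContDiff ℝ 3 (jnt g) := A.g_smooth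

variable [Nontrivial F]

theorem g_regular (A : Assumptions f g μ C ℓ ρ ν) : Regular g μ ℓ ρ where
  pos := A.mu_pos
  smooth := smooth_two A.g_smooth'
  coer := fun z => coerY_of_strongConvexOn (smooth_two A.g_smooth') (A.g_strong z.fst) z.snd
  hess_le := fun z => norm_le_of_lipschitz_bound (hasFDerivAt_D1 (smooth_two A.g_smooth') z)
    fun z z' => (norm_D1_sub_eq z z').le.trans (A.g_grad z z')
  hess_lip := fun z z' => (norm_D2_sub_le (smooth_two A.g_smooth') z z').trans (A.g_hess z z')

theorem f_D1_le (A : Assumptions f g μ C ℓ ρ ν) (z : Prd E F) : ‖D1 f z‖ ≤ C :=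
  norm_le_of_lipschitz_bound (hasFDerivAt_jnt A.f_smooth' z) fun z z' => A.f_lip z z'

theorem f_D2_le (A : Assumptions f g μ C ℓ ρ ν) (z : Prd E F) : ‖D2 f z‖ ≤ ℓ :=
  norm_le_of_lipschitz_bound (hasFDerivAt_D1 A.f_smooth' z)
    fun z z' => (norm_D1_sub_eq z z').le.trans (A.f_grad z z')

theorem f_D2_lip (A : Assumptions f g μ C ℓ ρ ν) (z z' : Prd E F) :
    ‖D2 f z - D2 f z'‖ ≤ ρ * ‖z - z'‖ :=
  (norm_D2_sub_le A.f_smooth' z z').trans (A.f_hess z z')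

theorem mu_le (A : Assumptions f g μ C ℓ ρ ν) : μ ≤ ℓ := by
  obtain ⟨w, hw⟩ := exists_ne (0 : F)
  have h1 := A.g_regular.coer 0 w
  have h2 := (le_abs_self _).trans (form_apply_le (D2 g 0) (inY E F w) (inY E F w))
  rw [norm_inY, mul_assoc, ← pow_two] at h2
  have h3 : 0 < ‖w‖ ^ 2 := by positivity
  refine le_of_mul_le_mul_right (h1.trans (h2.trans ?_)) h3
  gcongr
  exact A.g_regular.hess_le 0

/-- f lowers the curvature in y by at most ℓ, and λ ≥ 2ℓ/μ makes this at most half of λμ. -/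
theorem pen_regular (A : Assumptions f g μ C ℓ ρ ν) (hlam : 2 * ℓ / μ ≤ lam) :
    Regular (pen f g lam) (lam * μ / 2) ((1 + lam) * ℓ) ((1 + lam) * ρ) := by
  have hμ := A.mu_pos
  have h1 := A.mu_le
  rw [div_le_iff₀ hμ] at hlam
  have hl : 0 < lam := by
    by_contra hc
    nlinarith [not_lt.1 hc]
  refine ⟨by positivity, contDiff_pen A.f_smooth' (smooth_two A.g_smooth'), fun z w => ?_,
    fun z => ?_, fun z z' => ?_⟩
  · rw [D2_pen A.f_smooth' (smooth_two A.g_smooth')]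
    have h2 := A.g_regular.coer z w
    have h3 := (neg_abs_le _).trans' (neg_le_neg (form_apply_le (D2 f z) (inY E F w)
      (inY E F w)))
    rw [norm_inY, mul_assoc, ← pow_two] at h3
    have h4 : ‖D2 f z‖ * ‖w‖ ^ 2 ≤ ℓ * ‖w‖ ^ 2 := by
      gcongr; exact A.f_D2_le z
    have h5 : lam * (μ * ‖w‖ ^ 2) ≤ lam * D2 g z (inY E F w) (inY E F w) := by gcongr
    change _ ≤ D2 f z (inY E F w) (inY E F w) + lam * D2 g z (inY E F w) (inY E F w)
    nlinarith [sq_nonneg ‖w‖]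
  · rw [D2_pen A.f_smooth' (smooth_two A.g_smooth')]
    refine (norm_add_le _ _).trans ?_
    rw [norm_smul, Real.norm_of_nonneg hl.le, add_mul, one_mul]
    gcongr
    · exact A.f_D2_le z
    · exact A.g_regular.hess_le z
  · rw [D2_pen A.f_smooth' (smooth_two A.g_smooth'), D2_pen A.f_smooth' (smooth_two A.g_smooth')]
    have e : D2 f z + lam • D2 g z - (D2 f z' + lam • D2 g z')
        = (D2 f z - D2 f z') + lam • (D2 g z - D2 g z') := by module
    rw [e]
    refine (norm_add_le _ _).trans ?_
    rw [norm_smul, Real.norm_of_nonneg hl.le]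
    have h2 := A.f_D2_lip z z'
    have h3 := mul_le_mul_of_nonneg_left (A.g_regular.hess_lip z z') hl.le
    linarith

theorem two_le_lam (A : Assumptions f g μ C ℓ ρ ν) (hlam : 2 * ℓ / μ ≤ lam) : 2 ≤ lam := by
  refine le_trans ?_ hlam
  rw [le_div_iff₀ A.mu_pos]
  linarith [A.mu_le]

theorem le_ellBar (C ℓ ρ ν : ℝ) : C ≤ ellBar C ℓ ρ ν ∧ ℓ ≤ ellBar C ℓ ρ ν ∧
    ρ ≤ ellBar C ℓ ρ ν ∧ ν ≤ ellBar C ℓ ρ ν := by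
  simp [ellBar]

theorem reg (A : Assumptions f g μ C ℓ ρ ν) (hlam : 2 * ℓ / μ ≤ lam) :
    Reg f g μ (ellBar C ℓ ρ ν) lam := by
  obtain ⟨hC, hℓ, hρ, hν⟩ := le_ellBar C ℓ ρ ν
  have h2 := A.two_le_lam hlam
  exact {
    two_le_lam := h2
    mu_le := A.mu_le.trans hℓ
    f_smooth := A.f_smooth'
    g_smooth := A.g_smooth'
    f_D1 := fun z => (A.f_D1_le z).trans hC
    f_D2 := fun z => (A.f_D2_le z).trans hℓ
    f_D2_lip := fun z z' => (A.f_D2_lip z z').trans (mul_le_mul_of_nonneg_right hρ (norm_nonneg _))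
    g_D3 := fun z => (norm_le_of_lipschitz_bound (hasFDerivAt_D2 A.g_smooth' z)
      A.g_regular.hess_lip).trans hρ
    g_D3_lip := fun z z' => ((norm_D3_sub_eq z z').le.trans (A.g_third z z')).trans
      (mul_le_mul_of_nonneg_right hν (norm_nonneg _))
    g_reg := A.g_regular.mono hℓ hρ
    h_reg := (A.pen_regular hlam).mono (by gcongr) (by gcongr) }

end Assumptions

end Bridge

/-! ### Errors of the gradient and Hessian estimators. -/

section Estimators

variable {E F : Type*} [NormedAddCommGroup E] [InnerProductSpace ℝ E] [CompleteSpace E]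
  [NormedAddCommGroup F] [InnerProductSpace ℝ F] [CompleteSpace F]
  {f g : E → F → ℝ} {μ ℓ ρ lam : ℝ}

/-- The Lagrangian differs from f + λg by a function of x alone. Hence its y-gradient is the same,
and its x-gradient changes by a vector independent of y, which drops out of the mixed Hessian. -/
theorem lagrangian_eq (x : E) (y : F) :
    lagrangian f g lam x y = pen f g lam x y - lam * Regular.env g x := by
  simp only [lagrangian, pen, Regular.env]
  change f x y + lam * (g x y - g x (minY g x)) = _
  ring

theorem gradient_lagrangian (hh : ContDiff ℝ 2 (jnt (pen f g lam))) (x : E) (y : F) :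
    gradient (lagrangian f g lam x) y = gradY (pen f g lam) x y := by
  have e : lagrangian f g lam x = fun y => pen f g lam x y - lam * Regular.env g x :=
    funext (lagrangian_eq x)
  rw [gradY, gradient, gradient, e,
    ((hasFDerivAt_right hh x y).sub_const (lam * Regular.env g x)).fderiv,
    (hasFDerivAt_right hh x y).fderiv]

theorem hessYY_lagrangian (hh : ContDiff ℝ 2 (jnt (pen f g lam))) (x : E) (y : F) :
    hessYY (lagrangian f g lam) x y = hessYY (pen f g lam) x y := by
  simp only [hessYY]
  congr 1
  exact funext fun y' => gradient_lagrangian hh x y'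

theorem hessYX_lagrangian (hh : ContDiff ℝ 2 (jnt (pen f g lam))) (x : E) (y : F) :
    hessYX (lagrangian f g lam) x y = hessYX (pen f g lam) x y := by
  simp only [hessYX]
  congr 1
  exact funext fun x' => gradient_lagrangian hh x' y

theorem argmin_lagrangian (x : E) : argmin (lagrangian f g lam x) = minY (pen f g lam) x := by
  simp only [argmin, minY, lagrangian_eq, sub_le_sub_iff_right]

variable [FiniteDimensional ℝ F] {m L R m' L' R' : ℝ}

theorem hessXY_lagrangian (Hg : Regular g m L R) (hh : ContDiff ℝ 2 (jnt (pen f g lam)))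
    (x : E) (y : F) : hessXY (lagrangian f g lam) x y = hessXY (pen f g lam) x y := by
  have e : ∀ y', gradX (lagrangian f g lam) x y'
      = gradX (pen f g lam) x y' - lam • gradient (Regular.env g) x := fun y' => by
    have h1 : (fun x' => lagrangian f g lam x' y')
        = fun x' => pen f g lam x' y' - lam * Regular.env g x' :=
      funext fun x' => lagrangian_eq x' y'
    have h2 := (hasFDerivAt_left hh x y').sub ((Hg.hasFDerivAt_env x).const_mul lam)
    rw [gradX, gradX, gradient, gradient, gradient, h1, (hasFDerivAt_left hh x y').fderiv,
      (Hg.hasFDerivAt_env x).fderiv]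
    have h3 : fderiv ℝ (fun x' => pen f g lam x' y' - lam * Regular.env g x') x = _ := h2.fderiv
    rw [h3, map_sub, LinearIsometryEquiv.map_smulₛₗ]
    rfl
  simp only [hessXY, e]
  exact fderiv_sub_const _

/-- The Hessian estimator is a difference of Schur complements. -/
theorem hessEst_eq (hf : ContDiff ℝ 2 (jnt f)) (Hg : Regular g m L R) (x : E) (y w : F) :
    hessEst f g lam x y w
      = schur (D2 (pen f g lam) (pt x y)) - lam • schur (D2 g (pt x w)) := by
  have hh : ContDiff ℝ 2 (jnt (pen f g lam)) := contDiff_pen hf Hg.smooth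
  have hXX : hessXX (pen f g lam) x y = hessXX f x y + lam • hessXX g x y := by
    rw [hessXX_eq hh, hessXX_eq hf, hessXX_eq Hg.smooth, D2_pen hf Hg.smooth]
    ext u
    simp
  rw [hessEst, hessXY_lagrangian Hg hh, hessYX_lagrangian hh, hessYY_lagrangian hh, schur, schur,
    ← hessXX_eq hh, ← hessXX_eq Hg.smooth, ← hessXY_eq hh, ← hessXY_eq Hg.smooth,
    ← hessYX_eq hh, ← hessYX_eq Hg.smooth, ← hessYY_eq hh, ← hessYY_eq Hg.smooth, hXX]
  module

theorem hessEst_symm (Hg : Regular g m L R) (Hh : Regular (pen f g lam) m' L' R')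
    (hf : ContDiff ℝ 2 (jnt f)) (x : E) (y w : F) (u v : E) :
    inner ℝ (hessEst f g lam x y w u) v = inner ℝ u (hessEst f g lam x y w v) := by
  rw [hessEst_eq hf Hg, real_inner_comm]
  simp only [sub_apply, smul_apply, inner_sub_right, real_inner_smul_right]
  rw [real_inner_comm _ v, real_inner_comm _ v, real_inner_comm _ u, real_inner_comm _ u,
    inner_schur Hh.pos (Hh.coer _), inner_schur Hh.pos (Hh.coer _),
    inner_schur Hg.pos (Hg.coer _), inner_schur Hg.pos (Hg.coer _), D2_symm Hh.smooth,
    D2_symm Hg.smooth]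

/-- The terms at (x, y) form the x-gradient of f + λg, so the estimator has the shape of `proxyD`
with y and w in place of the two minimizers. -/
theorem abs_gradEst_sub_le (Hg : Regular g m L R) (Hh : Regular (pen f g lam) m' L' R')
    (hf : ContDiff ℝ 2 (jnt f)) (hlam : 0 ≤ lam) (x u : E) (y w : F) :
    |inner ℝ (gradEst f g lam x y w) u - proxyD f g lam x u|
      ≤ (L' * ‖y - minY (pen f g lam) x‖ + lam * (L * ‖w - minY g x‖)) * ‖u‖ := by
  have e : inner ℝ (gradEst f g lam x y w) u - proxyD f g lam x u
      = (D1 (pen f g lam) (pt x y) - D1 (pen f g lam) (ptMin (pen f g lam) x)) (inX E F u)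
        - lam * (D1 g (pt x w) - D1 g (ptMin g x)) (inX E F u) := by
    have h1 : proxyD f g lam x u = D1 (pen f g lam) (ptMin (pen f g lam) x) (inX E F u)
      - lam * D1 g (ptMin g x) (inX E F u) := rfl
    have h2 : D1 (pen f g lam) (pt x y) (inX E F u)
      = D1 f (pt x y) (inX E F u) + lam * D1 g (pt x y) (inX E F u) := by
      rw [D1_pen hf Hg.smooth]; rfl
    rw [h1, gradEst, gradX_eq hf, gradX_eq Hg.smooth, gradX_eq Hg.smooth, sub_apply, sub_apply,
      inner_add_left, real_inner_smul_left, inner_sub_left, inner_riesz, inner_riesz,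
      inner_riesz, h2]
    ring
  have t1 := (D1 (pen f g lam) (pt x y)
    - D1 (pen f g lam) (ptMin (pen f g lam) x)).le_of_opNorm_le (Hh.D1_lip _ _) (inX E F u)
  have t2 := (D1 g (pt x w) - D1 g (ptMin g x)).le_of_opNorm_le (Hg.D1_lip _ _) (inX E F u)
  rw [norm_inX, ptMin, norm_pt_sub_left, Real.norm_eq_abs] at t1 t2
  rw [e]
  refine (abs_sub _ _).trans ?_
  rw [abs_mul, abs_of_nonneg hlam]
  have := mul_le_mul_of_nonneg_left t2 hlam
  rw [ptMin, ptMin]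
  linarith

theorem norm_schur_sub_le {h : E → F → ℝ} (H : Regular h m L R) (z z' : Prd E F) :
    ‖schur (D2 h z) - schur (D2 h z')‖ ≤ R * ‖z - z'‖ * (1 + (L / m) ^ 2) := by
  refine (schur_sub_le H.pos (H.coer z) (H.coer z') (D2_symm H.smooth z') (H.hess_le z)
    (H.hess_le z')).trans ?_
  gcongr
  exact H.hess_lip z z'

/-- Estimator and exact Hessian are the same combination of two Schur complements, taken at the
iterates and at the minimizers respectively. -/
theorem abs_hessEst_sub_le {Λ : ℝ} (HR : Reg f g μ Λ lam) (Hg : Regular g m L R)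
    (Hh : Regular (pen f g lam) m' L' R') (x u v : E) (y w : F) :
    |inner ℝ (hessEst f g lam x y w u) v - proxyH f g lam x u v|
      ≤ (R' * ‖y - minY (pen f g lam) x‖ * (1 + (L' / m') ^ 2)
        + lam * (R * ‖w - minY g x‖ * (1 + (L / m) ^ 2))) * ‖u‖ * ‖v‖ := by
  have hlam := HR.lam_pos.le
  have e : inner ℝ (hessEst f g lam x y w u) v - proxyH f g lam x u v
      = inner ℝ ((schur (D2 (pen f g lam) (pt x y))
          - schur (D2 (pen f g lam) (ptMin (pen f g lam) x))) u) v
        - lam * inner ℝ ((schur (D2 g (pt x w)) - schur (D2 g (ptMin g x))) u) v := by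
    have h1 := inner_schur Hh.pos (Hh.coer (ptMin (pen f g lam) x)) u v
    have h2 := inner_schur Hg.pos (Hg.coer (ptMin g x)) u v
    rw [HR.proxyH_apply, hessEst_eq HR.f_smooth Hg]
    simp only [sub_apply, smul_apply, inner_sub_left, real_inner_smul_left]
    rw [h1, h2]
    simp only [Regular.sensAt, ptMin]
    ring
  have key : ∀ (T : E →L[ℝ] E) (c : ℝ), ‖T‖ ≤ c → |inner ℝ (T u) v| ≤ c * ‖u‖ * ‖v‖ := by
    intro T c hc
    refine (abs_real_inner_le_norm _ _).trans ?_
    gcongr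
    exact T.le_of_opNorm_le hc u
  have t1 := key _ _ (norm_schur_sub_le Hh (pt x y) (ptMin (pen f g lam) x))
  have t2 := key _ _ (norm_schur_sub_le Hg (pt x w) (ptMin g x))
  rw [ptMin, norm_pt_sub_left] at t1 t2
  rw [e]
  refine (abs_sub _ _).trans ?_
  rw [abs_mul, abs_of_nonneg hlam]
  have := mul_le_mul_of_nonneg_left t2 hlam
  rw [ptMin, ptMin]
  linarith

end Estimators

end FSBA
end

noncomputable section
set_option linter.unusedSectionVars false
set_option maxSynthPendingDepth 3
namespace FSBA

/-! ### Accelerated gradient descent on a lower-level objective. -/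

section InnerLoop

variable {E F : Type*} [NormedAddCommGroup E] [InnerProductSpace ℝ E]
  [NormedAddCommGroup F] [InnerProductSpace ℝ F] [FiniteDimensional ℝ F] [CompleteSpace F]
  {h : E → F → ℝ} {m L R : ℝ}

/-- The momentum is prescribed through κ, which may exceed L/m; weakening m to L/κ makes the
condition number exactly κ, as the Lyapunov argument requires. The shift c accommodates the
Lagrangian. -/
theorem Regular.norm_agd_sub_le (H : Regular h m L R) {x : E} {p : F → ℝ} {c : ℝ}
    (hp : ∀ y, p y = h x y - c) (hg : ∀ y, gradient p y = gradY h x y) {κ κ₂ acc D : ℝ}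
    (hκ : 1 ≤ κ) (hκ₂ : κ ≤ κ₂) (hL : 0 < L) (hm : L ≤ m * κ) {z₀ : F} {K : ℕ} (hacc : 0 < acc)
    (hD : ‖z₀ - minY h x‖ ≤ D)
    (hK : 2 * Real.sqrt κ₂ * Real.log (Real.sqrt (κ₂ + 1) / acc * D) ≤ K) :
    ‖agd p z₀ K (1 / L) (momentum κ) - minY h x‖ ≤ acc := by
  have hκ0 : 0 < κ := by linarith
  have hin : ∀ y v, inner ℝ (gradient p y) v = D1 h (pt x y) (inY E F v) := fun y v => by
    rw [hg, gradY_eq H.smooth, inner_riesz]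
  have hm' : L / κ ≤ m := (div_le_iff₀ hκ0).2 hm
  refine agd_norm_sub_le (m := L / κ) hκ hκ₂ (by positivity) (by field_simp)
    (fun y y' => ?_) (fun y y' => ?_) ?_ hacc hD hK
  · rw [hin, hp, hp]
    have h1 := H.lower x y y'
    have h2 := mul_le_mul_of_nonneg_right hm' (sq_nonneg ‖y' - y‖)
    linarith
  · rw [hin, hp, hp]
    linarith [H.upper x y y']
  · refine ext_inner_right ℝ fun v => ?_
    rw [hin, H.D1_minY, inner_zero_left]

end InnerLoop

/-! ### Inexact cubic Newton steps: descent, stationarity, termination. -/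

section CubicStep

variable {E : Type*} [NormedAddCommGroup E] [InnerProductSpace ℝ E]
  {Φ : E → ℝ} {G : E → E →L[ℝ] ℝ} {Q : E → E →L[ℝ] E →L[ℝ] ℝ} {c : ℝ}

theorem abs_taylor_two_le (hΦ : ∀ x, HasFDerivAt Φ (G x) x) (hG : ∀ x, HasFDerivAt G (Q x) x)
    (hQ : ∀ x x', ‖Q x - Q x'‖ ≤ c * ‖x - x'‖) (hc : 0 ≤ c) (x s : E) :
    |Φ (x + s) - Φ x - G x s - 1 / 2 * Q x s s| ≤ c * ‖s‖ ^ 3 := by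
  have hder : ∀ t : ℝ, HasDerivAt (fun t : ℝ => Φ (x + t • s) - t * G x s - t ^ 2 / 2 * Q x s s)
      (G (x + t • s) s - G x s - t * Q x s s) t := fun t => by
    have h1 : HasDerivAt (fun t : ℝ => x + t • s) s t := by
      simpa using ((hasDerivAt_id t).smul_const s).const_add x
    have h2 := (hΦ (x + t • s)).comp_hasDerivAt t h1
    have h3 := (hasDerivAt_id t).mul_const (G x s)
    have h4 := (((hasDerivAt_id t).pow 2).div_const 2).mul_const (Q x s s)
    refine ((h2.sub h3).sub h4).congr_deriv ?_
    simp
  have hb := norm_image_sub_le_of_norm_deriv_le_segment_01' (C := c * ‖s‖ ^ 3)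
    (fun t _ => (hder t).hasDerivWithinAt) fun t ht => by
      have h1 := norm_remainder_le hc hG hQ x (x + t • s)
      rw [add_sub_cancel_left] at h1
      have h2 := ContinuousLinearMap.le_of_opNorm_le
        (G (x + t • s) - G x - Q x (t • s)) h1 s
      have h3 : (G (x + t • s) - G x - Q x (t • s)) s
          = G (x + t • s) s - G x s - t * Q x s s := by
        simp
      rw [h3, norm_smul, Real.norm_of_nonneg ht.1] at h2
      refine h2.trans ?_
      have h4 : t ^ 2 ≤ 1 := pow_le_one₀ ht.1 ht.2.le
      have h5 : 0 ≤ c * ‖s‖ ^ 3 := by positivity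
      nlinarith [mul_le_mul_of_nonneg_right h4 h5]
  simp only [one_smul, zero_smul, add_zero, Real.norm_eq_abs] at hb
  refine le_trans (le_of_eq ?_) hb
  congr 1
  ring

/-- `s` is the step of an inexact cubic regularized Newton method at `x` for a function with
derivative `G` and second derivative `Q`. The errors in the derivatives are measured by the target
step length `q`. -/
structure CubicStep (G : E → E →L[ℝ] ℝ) (Q : E → E →L[ℝ] E →L[ℝ] ℝ) (M q : ℝ) (x s : E)
    (u : E) (H : E →L[ℝ] E) : Prop where
  symm : ∀ v w, inner ℝ (H v) w = inner ℝ v (H w)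
  min : ∀ s', cubicModel u H M s ≤ cubicModel u H M s'
  grad_err : ∀ v, |inner ℝ u v - G x v| ≤ M * q ^ 2 / 192 * ‖v‖
  hess_err : ∀ v w, |inner ℝ (H v) w - Q x v w| ≤ M * q / 48 * ‖v‖ * ‖w‖

namespace CubicStep

variable [CompleteSpace E] {M q : ℝ} {x s u : E} {H : E →L[ℝ] E}

/-- In units of M‖s‖³: the quadratic part of the model is at most −1/12 − 1/6, the Taylor error
costs at most 1/12, and q ≤ 2‖s‖ turns the gradient and Hessian errors into 1/48 each. This leaves
more than 1/24. -/
theorem descent (S : CubicStep G Q M q x s u H) (hΦ : ∀ x, HasFDerivAt Φ (G x) x)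
    (hG : ∀ x, HasFDerivAt G (Q x) x) (hQ : ∀ x x', ‖Q x - Q x'‖ ≤ c * ‖x - x'‖) (hc : 0 ≤ c)
    (hM : 12 * c ≤ M) (hq : 0 ≤ q) (hs : q / 2 ≤ ‖s‖) :
    Φ (x + s) ≤ Φ x - M / 24 * ‖s‖ ^ 3 := by
  have hM0 : 0 ≤ M := by linarith
  have h1 := (abs_le.1 (abs_taylor_two_le hΦ hG hQ hc x s)).2
  have h2 := (abs_le.1 (S.grad_err s)).1
  have h3 := (abs_le.1 (S.hess_err s s)).1
  have h4 := cubicModel_le S.symm S.min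
  rw [cubicModel, real_inner_comm] at h4
  set r := ‖s‖
  have hr : 0 ≤ r := by linarith
  have h5 : q * r ^ 2 ≤ 2 * r ^ 3 := by nlinarith [sq_nonneg r]
  have h6 : q ^ 2 * r ≤ 4 * r ^ 3 := by
    have : q ^ 2 ≤ (2 * r) ^ 2 := by gcongr; linarith
    nlinarith
  have h7 := mul_le_mul_of_nonneg_left h5 hM0
  have h8 := mul_le_mul_of_nonneg_left h6 hM0
  have h9 : 12 * c * r ^ 3 ≤ M * r ^ 3 := by gcongr
  have h10 : 0 ≤ M * r ^ 3 := by positivity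
  have h11 : inner ℝ s u = inner ℝ u s := real_inner_comm _ _
  have h12 : inner ℝ s (H s) = inner ℝ (H s) s := real_inner_comm _ _
  linarith

/-- Stationarity of the model replaces u + Hs by −(M/2)‖s‖s. For ‖s‖ ≤ q/2 this term, the Taylor
error and the estimation errors are small multiples of Mq². -/
theorem norm_deriv_le (S : CubicStep G Q M q x s u H)
    (hG : ∀ x, HasFDerivAt G (Q x) x) (hQ : ∀ x x', ‖Q x - Q x'‖ ≤ c * ‖x - x'‖) (hc : 0 ≤ c)
    (hM : 12 * c ≤ M) (hq : 0 ≤ q) (hs : ‖s‖ ≤ q / 2) : ‖G (x + s)‖ ≤ M * q ^ 2 := by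
  have hM0 : 0 ≤ M := by linarith
  refine ContinuousLinearMap.opNorm_le_bound _ (by positivity) fun v => ?_
  have h1 := norm_remainder_le hc hG hQ x (x + s)
  rw [add_sub_cancel_left] at h1
  have h2 := ContinuousLinearMap.le_of_opNorm_le (G (x + s) - G x - Q x s) h1 v
  rw [sub_apply, sub_apply, Real.norm_eq_abs] at h2
  have h3 := S.grad_err v
  have h4 := S.hess_err s v
  have h5 : inner ℝ u v + inner ℝ (H s) v + M / 2 * ‖s‖ * inner ℝ s v = 0 := by
    have := congrArg (fun w : E => (inner ℝ w v : ℝ)) (cubicModel_stationary S.symm S.min)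
    simpa only [inner_add_left, real_inner_smul_left, inner_zero_left] using this
  have h6 : |M / 2 * ‖s‖ * inner ℝ s v| ≤ M / 2 * ‖s‖ * (‖s‖ * ‖v‖) := by
    rw [abs_mul, abs_of_nonneg (by positivity)]
    gcongr
    exact abs_real_inner_le_norm _ _
  have h7 : |G (x + s) v| ≤ c * ‖s‖ ^ 2 * ‖v‖ + M * q ^ 2 / 192 * ‖v‖
      + M * q / 48 * ‖s‖ * ‖v‖ + M / 2 * ‖s‖ * (‖s‖ * ‖v‖) := by
    rw [abs_le] at *
    constructor <;> linarith
  rw [Real.norm_eq_abs]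
  refine h7.trans ?_
  set r := ‖s‖
  have hr : 0 ≤ r := norm_nonneg _
  have hr2 : r ^ 2 ≤ q ^ 2 / 4 := by
    have : r ^ 2 ≤ (q / 2) ^ 2 := by gcongr
    linarith
  have key : c * r ^ 2 + M * q ^ 2 / 192 + M * q / 48 * r + M / 2 * r ^ 2 ≤ M * q ^ 2 := by
    have e1 : 12 * c * r ^ 2 ≤ M * r ^ 2 := by gcongr
    have e2 := mul_le_mul_of_nonneg_left hr2 hM0
    have e3 : M * q * r ≤ M * q * (q / 2) := by gcongr
    have e4 : 0 ≤ M * q ^ 2 := by positivity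
    linarith
  have := mul_le_mul_of_nonneg_right key (norm_nonneg v)
  linarith

/-- The model's second-order condition bounds H below by −(M/2)‖s‖; passing to Q(x + s) costs c‖s‖
and the Hessian error. -/
theorem hess_ge (S : CubicStep G Q M q x s u H)
    (hQ : ∀ x x', ‖Q x - Q x'‖ ≤ c * ‖x - x'‖) (hc : 0 ≤ c)
    (hM : 12 * c ≤ M) (hq : 0 ≤ q) (hs : ‖s‖ ≤ q / 2) (v : E) :
    -(M * q * ‖v‖ ^ 2) ≤ Q (x + s) v v := by
  have hM0 : 0 ≤ M := by linarith
  have h1 := hQ (x + s) x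
  rw [add_sub_cancel_left] at h1
  have h2 := ContinuousLinearMap.le_of_opNorm_le _
    (ContinuousLinearMap.le_of_opNorm_le (Q (x + s) - Q x) h1 v) v
  rw [sub_apply, sub_apply, Real.norm_eq_abs] at h2
  have h3 := (abs_le.1 h2).1
  have h4 := (abs_le.1 (S.hess_err v v)).2
  have h5 := cubicModel_hess_nonneg S.symm S.min v
  rw [real_inner_comm] at h5
  set r := ‖s‖
  have key : c * r + M * q / 48 + M / 2 * r ≤ M * q := by
    have e1 : 12 * c * r ≤ M * r := by gcongr
    have e2 := mul_le_mul_of_nonneg_left hs hM0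
    have e4 : 0 ≤ M * q := by positivity
    linarith
  have := mul_le_mul_of_nonneg_right key (sq_nonneg ‖v‖)
  linarith

end CubicStep

/-- Termination of a method which decreases a function, bounded below, by at least
`M / 24 * ‖s t‖ ^ 3` whenever the step `s t` is longer than `q / 2`. -/
theorem exists_last_of_descent {x s : ℕ → E} {M q Δ : ℝ} {N T : ℕ} (hM : 0 < M) (hq : 0 < q)
    (hstep : ∀ t < N, q / 2 ≤ ‖s t‖ → Φ (x (t + 1)) ≤ Φ (x t) - M / 24 * ‖s t‖ ^ 3)
    (hΔ : 0 < Δ) (hlow : ∀ y, Φ (x 0) - 2 * Δ ≤ Φ y)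
    (hgo : ∀ t, t + 1 < N → q / 2 < ‖s t‖) (hend : N = T ∨ ∃ t, N = t + 1 ∧ ‖s t‖ ≤ q / 2)
    (hT : 400 * Δ ≤ M * q ^ 3 * T) :
    (∃ t, N = t + 1 ∧ ‖s t‖ ≤ q / 2) ∧ ∀ t, t + 1 < N → M * ‖s t‖ ^ 3 ≤ 48 * Δ := by
  -- Every long step gains at least (M/24)(q/2)³ = Mq³/192.
  have hdec : ∀ t ≤ N, (∀ i < t, q / 2 < ‖s i‖) →
      Φ (x t) ≤ Φ (x 0) - t * (M * q ^ 3 / 192) := by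
    intro t
    induction t with
    | zero => intro _ _; simp
    | succ t ih =>
      intro ht hi
      have h1 := ih (by omega) fun i hit => hi i (by omega)
      have h2 := hi t (by omega)
      have h3 := hstep t (by omega) h2.le
      have h4 : M / 24 * (q / 2) ^ 3 ≤ M / 24 * ‖s t‖ ^ 3 := by gcongr
      push_cast
      linarith
  constructor
  · rcases hend with h | h
    · subst h
      have hN : N ≠ 0 := by
        rintro rfl
        norm_num at hT
        linarith
      obtain ⟨t, rfl⟩ := Nat.exists_eq_succ_of_ne_zero hN
      refine ⟨t, rfl, ?_⟩
      -- If the last step were long too, the total decrease would be at least 400Δ/192 > 2Δ.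
      by_contra! hc
      have h1 := hdec (t + 1) le_rfl fun i hi => by
        rcases Nat.lt_succ_iff_lt_or_eq.1 hi with h | rfl
        · exact hgo i (by omega)
        · exact hc
      have h2 := hlow (x (t + 1))
      linarith
    · exact h
  -- A single decrease (M/24)‖s‖³ cannot exceed 2Δ, hence 48Δ.
  · intro t ht
    have h1 := hdec t (by omega) fun i hi => hgo i (by omega)
    have h2 := hstep t (by omega) (hgo t ht).le
    have h3 := hlow (x (t + 1))
    have : 0 ≤ (t : ℝ) * (M * q ^ 3 / 192) := by positivity
    linarith

end CubicStep

end FSBA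
end

noncomputable section
set_option linter.unusedSectionVars false
set_option maxSynthPendingDepth 3
namespace FSBA

/-! ### Warm starts and the accuracy of the inner iterates. -/

theorem innerSteps_spec {E : Type*} [NormedAddCommGroup E] (κ κ₂ acc R : ℝ) (s : ℕ → E) :
    2 * Real.sqrt κ₂ * Real.log (Real.sqrt (κ₂ + 1) / acc * R) ≤ innerSteps κ κ₂ acc R s 0 ∧
      ∀ t, 2 * Real.sqrt κ₂ * Real.log (Real.sqrt (κ₂ + 1) / acc * (acc + 4 * κ * ‖s t‖))
        ≤ innerSteps κ κ₂ acc R s (t + 1) :=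
  ⟨Nat.le_ceil _, fun _ => Nat.le_ceil _⟩

theorem sensitivity_le_hessSens {μ ℓ ρ lam : ℝ} (hμ : 0 < μ) (hℓ : 0 ≤ ℓ) (hρ : 0 ≤ ρ)
    (hlam : 0 < lam) :
    (1 + lam) * ρ * (1 + ((1 + lam) * ℓ / (lam * μ / 2)) ^ 2) + lam * (ρ * (1 + (ℓ / μ) ^ 2))
      ≤ 2 * hessSens μ ℓ ρ lam := by
  -- The sensitivity constant is a perfect square in q = 2(1 + λ)ℓ/(λμ), which dominates both 1 + q²
  -- and 1 + (ℓ/μ)².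
  have e : hessSens μ ℓ ρ lam
      = (1 + lam) * ρ * (1 + (1 + lam) * ℓ / (lam * μ / 2)) ^ 2 := by
    rw [hessSens]
    field_simp
    ring
  have hq : ℓ / μ ≤ (1 + lam) * ℓ / (lam * μ / 2) := by
    rw [div_le_div_iff₀ hμ (by positivity)]
    have : 0 ≤ ℓ * μ := by positivity
    have : 0 ≤ lam * (ℓ * μ) := by positivity
    nlinarith
  have h0 : 0 ≤ ℓ / μ := by positivity
  rw [e]
  generalize (1 + lam) * ℓ / (lam * μ / 2) = q at *
  have h1 : (ℓ / μ) ^ 2 ≤ q ^ 2 := by gcongr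
  have h2 : lam * (ρ * (1 + (ℓ / μ) ^ 2)) ≤ (1 + lam) * ρ * (1 + q ^ 2) := by
    rw [← mul_assoc]
    gcongr
    linarith
  have h3 : 0 ≤ (1 + lam) * ρ * q := mul_nonneg (by positivity) (h0.trans hq)
  linarith

section Inner

variable {E F : Type*} [NormedAddCommGroup E] [InnerProductSpace ℝ E] [CompleteSpace E]
  [NormedAddCommGroup F] [InnerProductSpace ℝ F] [CompleteSpace F] [Nontrivial F]
  [FiniteDimensional ℝ F] {f g : E → F → ℝ} {μ C ℓ ρ ν lam : ℝ}

namespace Assumptions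

theorem rho_nonneg (A : Assumptions f g μ C ℓ ρ ν) : 0 ≤ ρ :=
  nonneg_of_lipschitz_bound A.g_regular.hess_lip

theorem kappa_eq : kappa μ C ℓ ρ ν = ellBar C ℓ ρ ν / μ := rfl

theorem one_le_kappa (A : Assumptions f g μ C ℓ ρ ν) : 1 ≤ kappa μ C ℓ ρ ν := by
  rw [kappa_eq, one_le_div A.mu_pos]
  exact A.mu_le.trans (le_ellBar C ℓ ρ ν).2.1

theorem ell_le (A : Assumptions f g μ C ℓ ρ ν) : ℓ ≤ μ * kappa μ C ℓ ρ ν := by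
  have := A.mu_pos
  rw [kappa_eq, mul_div_cancel₀ _ this.ne']
  exact (le_ellBar C ℓ ρ ν).2.1

theorem norm_agd_lower_sub_le (A : Assumptions f g μ C ℓ ρ ν) {x : E} {z₀ : F} {K : ℕ}
    {acc D : ℝ} (hacc : 0 < acc) (hD : ‖z₀ - minY g x‖ ≤ D)
    (hK : 2 * Real.sqrt (3 * kappa μ C ℓ ρ ν) *
      Real.log (Real.sqrt (3 * kappa μ C ℓ ρ ν + 1) / acc * D) ≤ K) :
    ‖agd (g x) z₀ K (1 / ℓ) (momentum (kappa μ C ℓ ρ ν)) - minY g x‖ ≤ acc :=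
  A.g_regular.norm_agd_sub_le (c := 0) (fun _ => (sub_zero _).symm) (fun _ => rfl) A.one_le_kappa
    (by linarith [A.one_le_kappa]) (A.mu_pos.trans_le A.mu_le) A.ell_le hacc hD hK

/-- The choice 3κ is justified by (1 + λ)ℓ ≤ (λμ/2)·3κ, from ℓ ≤ μκ and λ ≥ 2. -/
theorem norm_agd_lagrangian_sub_le (A : Assumptions f g μ C ℓ ρ ν) (hlam : 2 * ℓ / μ ≤ lam)
    {x : E} {z₀ : F} {K : ℕ} {acc D : ℝ} (hacc : 0 < acc)
    (hD : ‖z₀ - minY (pen f g lam) x‖ ≤ D)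
    (hK : 2 * Real.sqrt (3 * kappa μ C ℓ ρ ν) *
      Real.log (Real.sqrt (3 * kappa μ C ℓ ρ ν + 1) / acc * D) ≤ K) :
    ‖agd (lagrangian f g lam x) z₀ K (1 / ((1 + lam) * ℓ)) (momentum (3 * kappa μ C ℓ ρ ν))
      - minY (pen f g lam) x‖ ≤ acc := by
  have h2 := A.two_le_lam hlam
  have hℓ := A.mu_pos.trans_le A.mu_le
  refine (A.pen_regular hlam).norm_agd_sub_le (lagrangian_eq x)
    (gradient_lagrangian (A.pen_regular hlam).smooth x) (by linarith [A.one_le_kappa]) le_rfl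
    (by positivity) ?_ hacc hD hK
  have h3 : lam * ℓ ≤ lam * (μ * kappa μ C ℓ ρ ν) :=
    mul_le_mul_of_nonneg_left A.ell_le (by linarith)
  nlinarith [A.ell_le]

variable {x₀ : E} {T : ℕ} {ε M acc R : ℝ} {K₁ K₂ : ℕ → ℕ}

/-- Warm start: the previous iterate is within `acc` of the old minimizer, and the minimizers of g
and of the Lagrangian move by at most κ‖s‖ and 3κ‖s‖. Both distances are covered by `acc` + 4κ‖s‖,
the quantity in the step count. -/
theorem run_errors (A : Assumptions f g μ C ℓ ρ ν) (hlam : 2 * ℓ / μ ≤ lam) (hacc : 0 < acc)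
    (hR : ‖minY g x₀‖ ≤ R) (hR' : ‖minY (pen f g lam) x₀‖ ≤ R)
    (r : Run f g lam x₀ T ℓ ((1 + lam) * ℓ) (kappa μ C ℓ ρ ν) (3 * kappa μ C ℓ ρ ν) ε M K₁ K₂)
    (h₁ : ∀ t < r.N, K₁ t = innerSteps (kappa μ C ℓ ρ ν) (3 * kappa μ C ℓ ρ ν) acc R r.s t)
    (h₂ : ∀ t < r.N, K₂ t = innerSteps (kappa μ C ℓ ρ ν) (3 * kappa μ C ℓ ρ ν) acc R r.s t)
    (t : ℕ) (ht : t < r.N) :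
    ‖r.w (t + 1) - minY g (r.x t)‖ ≤ acc ∧
      ‖r.y (t + 1) - minY (pen f g lam) (r.x t)‖ ≤ acc := by
  have hspec := innerSteps_spec (kappa μ C ℓ ρ ν) (3 * kappa μ C ℓ ρ ν) acc R r.s
  have hH := A.reg hlam
  have hκ := A.one_le_kappa
  induction t with
  | zero =>
    rw [r.w_step 0 ht, r.y_step 0 ht, r.w_zero, r.y_zero, r.x_zero, h₁ 0 ht, h₂ 0 ht]
    exact ⟨A.norm_agd_lower_sub_le hacc (by rwa [zero_sub, norm_neg]) hspec.1,
      A.norm_agd_lagrangian_sub_le hlam hacc (by rwa [zero_sub, norm_neg]) hspec.1⟩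
  | succ t ih =>
    obtain ⟨e1, e2⟩ := ih (by omega)
    have hx : ‖r.x t - r.x (t + 1)‖ = ‖r.s t‖ := by
      rw [r.x_step t (by omega), sub_add_cancel_left, norm_neg]
    have d1 := hH.g_reg.minY_lip (r.x t) (r.x (t + 1))
    have d2 := hH.h_reg.minY_lip (r.x t) (r.x (t + 1))
    rw [hx] at d1 d2
    have d3 := mul_le_mul_of_nonneg_right hH.ratio_le (norm_nonneg (r.s t))
    rw [← kappa_eq] at d1 d3
    have hs : 0 ≤ kappa μ C ℓ ρ ν * ‖r.s t‖ := by positivity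
    rw [r.w_step _ ht, r.y_step _ ht, h₁ _ ht, h₂ _ ht]
    refine ⟨A.norm_agd_lower_sub_le hacc ?_ (hspec.2 t),
      A.norm_agd_lagrangian_sub_le hlam hacc ?_ (hspec.2 t)⟩
    · refine (norm_sub_le_norm_sub_add_norm_sub _ (minY g (r.x t)) _).trans ?_
      linarith
    · refine (norm_sub_le_norm_sub_add_norm_sub _ (minY (pen f g lam) (r.x t)) _).trans ?_
      linarith

theorem cubicStep (A : Assumptions f g μ C ℓ ρ ν) (hlam : 2 * ℓ / μ ≤ lam) {q : ℝ} {x s : E}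
    {y w : F} (hw : ‖w - minY g x‖ ≤ acc) (hy : ‖y - minY (pen f g lam) x‖ ≤ acc)
    (hg : 4 * lam * ellBar C ℓ ρ ν * acc ≤ M * q ^ 2 / 192)
    (hh : 2 * hessSens μ ℓ ρ lam * acc ≤ M * q / 48)
    (hs : ∀ s', cubicModel (gradEst f g lam x y w) (hessEst f g lam x y w) M s
      ≤ cubicModel (gradEst f g lam x y w) (hessEst f g lam x y w) M s') :
    CubicStep (proxyD f g lam) (proxyH f g lam) M q x s (gradEst f g lam x y w)
      (hessEst f g lam x y w) := by
  have h2 := A.two_le_lam hlam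
  have hl : 0 < lam := by linarith
  have hμ := A.mu_pos
  have hℓ := hμ.trans_le A.mu_le
  have hρ := A.rho_nonneg
  have hacc : 0 ≤ acc := (norm_nonneg _).trans hw
  refine ⟨hessEst_symm A.g_regular (A.pen_regular hlam) A.f_smooth' x y w, hs, fun v => ?_,
    fun u v => ?_⟩
  · refine (abs_gradEst_sub_le A.g_regular (A.pen_regular hlam) A.f_smooth' hl.le x v y w).trans ?_
    gcongr
    calc (1 + lam) * ℓ * ‖y - minY (pen f g lam) x‖ + lam * (ℓ * ‖w - minY g x‖)
        ≤ (1 + lam) * ℓ * acc + lam * (ℓ * acc) := by gcongr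
      _ = (1 + 2 * lam) * (ℓ * acc) := by ring
      _ ≤ 4 * lam * (ℓ * acc) := by gcongr; linarith
      _ ≤ 4 * lam * (ellBar C ℓ ρ ν * acc) := by
        gcongr
        exact (le_ellBar C ℓ ρ ν).2.1
      _ ≤ _ := by linarith
  · refine (abs_hessEst_sub_le (A.reg hlam) A.g_regular (A.pen_regular hlam) x u v y w).trans ?_
    gcongr
    have h3 := mul_le_mul_of_nonneg_right (sensitivity_le_hessSens hμ hℓ.le hρ hl) hacc
    refine le_trans ?_ (h3.trans hh)
    calc (1 + lam) * ρ * ‖y - minY (pen f g lam) x‖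
            * (1 + ((1 + lam) * ℓ / (lam * μ / 2)) ^ 2)
          + lam * (ρ * ‖w - minY g x‖ * (1 + (ℓ / μ) ^ 2))
        ≤ (1 + lam) * ρ * acc * (1 + ((1 + lam) * ℓ / (lam * μ / 2)) ^ 2)
          + lam * (ρ * acc * (1 + (ℓ / μ) ^ 2)) := by gcongr
      _ = _ := by ring

end Assumptions

end Inner

/-! ### Stationarity of the output. -/

section Outer

variable {E F : Type*} [NormedAddCommGroup E] [InnerProductSpace ℝ E] [CompleteSpace E]
  [NormedAddCommGroup F] [InnerProductSpace ℝ F] [CompleteSpace F]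
  [FiniteDimensional ℝ F] {f g : E → F → ℝ} {μ Λ lam : ℝ}

namespace Reg

/-- The factor 2 combines the gap of φ with the approximation error of the proxy, which is also at
most Δ; only its lower bound loses, because Φ ≤ φ. -/
theorem proxy_gap (H : Reg f g μ Λ lam) (hb : BddBelow (Set.range (hyperObj f g))) {x₀ : E}
    (hΔ : Λ * (Λ / μ / lam) ≤ gap f g x₀) (y : E) :
    proxy f g lam x₀ - 2 * gap f g x₀ ≤ proxy f g lam y := by
  have h1 := H.proxy_le_hyperObj x₀
  have h2 := H.hyperObj_le_proxy y
  have h3 := ciInf_le hb y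
  rw [gap] at *
  linarith

/-- Approximate second-order stationarity carries over from the proxy to the hyper-objective. -/
theorem isSOSP (H : Reg f g μ Λ lam) {x : E} {ε τ : ℝ} (h1 : ‖proxyD f g lam x‖ ≤ ε)
    (h2 : ∀ v, -(τ * ‖v‖ ^ 2) ≤ proxyH f g lam x v v)
    (hb1 : Λ * (Λ / μ) ^ 3 / lam ≤ ε) (hb2 : Λ * (Λ / μ) ^ 5 / lam ≤ τ) :
    IsSOSP (hyperObj f g) (5 * ε) (49 * τ) x := by
  refine ⟨H.contDiff_hyperObj.contDiffAt, ?_, fun m hm => ?_⟩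
  · rw [gradient, (H.hasFDerivAt_hyperObj x).fderiv, LinearIsometryEquiv.norm_map]
    have h3 := H.norm_hyperD_sub_proxyD_le x
    have h4 := norm_sub_norm_le (hyperD f g x) (proxyD f g lam x)
    have h5 : 4 * Λ * (Λ / μ) ^ 3 / lam = 4 * (Λ * (Λ / μ) ^ 3 / lam) := by ring
    linarith
  -- On an eigenvector the quadratic form is m‖v‖²; the losses τ from the proxy and 48τ from the
  -- approximation add to 49τ.
  · obtain ⟨v, hv⟩ := hm.exists_hasEigenvector
    have h3 := H.abs_hess_hyperObj_sub_le x v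
    have h4 : fderiv ℝ (gradient (hyperObj f g)) x v = m • v := hv.apply_eq_smul
    rw [h4, real_inner_smul_left, real_inner_self_eq_norm_sq] at h3
    have h5 := (abs_le.1 h3).2
    have h6 := h2 v
    have h7 : 0 < ‖v‖ ^ 2 := by
      have := norm_pos_iff.2 hv.2
      positivity
    have h8 : 48 * Λ * (Λ / μ) ^ 5 / lam = 48 * (Λ * (Λ / μ) ^ 5 / lam) := by ring
    rw [h8] at h5
    have h9 := mul_le_mul_of_nonneg_right hb2 h7.le
    refine le_of_mul_le_mul_right ?_ h7
    linarith

end Reg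

variable [Nontrivial F] {C ℓ ρ ν : ℝ} {x₀ : E} {T : ℕ} {ε M acc R : ℝ} {K₁ K₂ : ℕ → ℕ}

/-- The output of a run is second-order stationary, and all steps but the last are bounded. -/
theorem Assumptions.run_output (A : Assumptions f g μ C ℓ ρ ν) (hlam : 2 * ℓ / μ ≤ lam)
    (hacc : 0 < acc) (hR : ‖minY g x₀‖ ≤ R) (hR' : ‖minY (pen f g lam) x₀‖ ≤ R)
    (hε : 0 < ε) (hM : 0 < M) (hΔ : 0 < gap f g x₀)
    (hM' : 10000 * (ellBar C ℓ ρ ν * kappa μ C ℓ ρ ν ^ 5) ≤ M)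
    (hb0 : ellBar C ℓ ρ ν * kappa μ C ℓ ρ ν / lam ≤ gap f g x₀)
    (hb1 : ellBar C ℓ ρ ν * kappa μ C ℓ ρ ν ^ 3 / lam ≤ ε)
    (hb2 : ellBar C ℓ ρ ν * kappa μ C ℓ ρ ν ^ 5 / lam ≤ Real.sqrt (M * ε))
    (hg : 4 * lam * ellBar C ℓ ρ ν * acc ≤ ε / 192)
    (hh : 2 * hessSens μ ℓ ρ lam * acc ≤ Real.sqrt (M * ε) / 48)
    (hT : 400 * (gap f g x₀ * Real.sqrt M * ε ^ (-(3 / 2) : ℝ)) ≤ T)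
    (r : Run f g lam x₀ T ℓ ((1 + lam) * ℓ) (kappa μ C ℓ ρ ν) (3 * kappa μ C ℓ ρ ν) ε M K₁ K₂)
    (h₁ : ∀ t < r.N, K₁ t = innerSteps (kappa μ C ℓ ρ ν) (3 * kappa μ C ℓ ρ ν) acc R r.s t)
    (h₂ : ∀ t < r.N, K₂ t = innerSteps (kappa μ C ℓ ρ ν) (3 * kappa μ C ℓ ρ ν) acc R r.s t) :
    IsSOSP (hyperObj f g) (5 * ε) (49 * Real.sqrt (M * ε)) r.output ∧
      ∀ t, t + 1 < r.N → M * ‖r.s t‖ ^ 3 ≤ 48 * gap f g x₀ := by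
  have H := A.reg hlam
  have hκ := H.one_le_kappa
  have hΛ := H.Λ_pos
  -- For q = √(ε/M), Mq² = ε and Mq = √(Mε), so the tolerances become ε/192 and √(Mε)/48. Moreover
  -- Mq³ is the inverse of √M ε^(−3/2), which links T to the descent bound.
  have hq0 : 0 < Real.sqrt (ε / M) := Real.sqrt_pos.2 (by positivity)
  have hq2 : M * Real.sqrt (ε / M) ^ 2 = ε := by
    rw [Real.sq_sqrt (by positivity)]
    field_simp
  have hq1 : M * Real.sqrt (ε / M) = Real.sqrt (M * ε) := by
    have : M * ε = M ^ 2 * (ε / M) := by field_simp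
    rw [this, Real.sqrt_mul (sq_nonneg M), Real.sqrt_sq hM.le]
  have hq3 : M * Real.sqrt (ε / M) ^ 3 * (Real.sqrt M * ε ^ (-(3 / 2) : ℝ)) = 1 := by
    have e1 : ε ^ (-(3 / 2) : ℝ) = (ε * Real.sqrt ε)⁻¹ := by
      rw [Real.rpow_neg hε.le, show (3 / 2 : ℝ) = 1 + 1 / 2 by norm_num, Real.rpow_add hε,
        Real.rpow_one, ← Real.sqrt_eq_rpow]
    have e2 : Real.sqrt ε = Real.sqrt M * Real.sqrt (ε / M) := by
      rw [← Real.sqrt_mul hM.le, mul_div_cancel₀ _ hM.ne']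
    have h3 := Real.sqrt_pos.2 hM
    rw [e1, e2]
    generalize Real.sqrt (ε / M) = q at *
    field_simp
    linarith
  set q := Real.sqrt (ε / M) with hq
  clear_value q
  have hlip := H.proxyH_lip
  have hc0 : 0 ≤ 352 * ellBar C ℓ ρ ν * (ellBar C ℓ ρ ν / μ) ^ 5 := by
    have := A.mu_pos
    positivity
  -- 12 · 352 = 4224 is below the factor 10000 required of M.
  have hcM : 12 * (352 * ellBar C ℓ ρ ν * (ellBar C ℓ ρ ν / μ) ^ 5) ≤ M := by
    rw [kappa_eq] at hM'
    linarith
  have herr := A.run_errors hlam hacc hR hR' r h₁ h₂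
  have hstep : ∀ t < r.N, CubicStep (proxyD f g lam) (proxyH f g lam) M q (r.x t) (r.s t)
      (gradEst f g lam (r.x t) (r.y (t + 1)) (r.w (t + 1)))
      (hessEst f g lam (r.x t) (r.y (t + 1)) (r.w (t + 1))) := fun t ht =>
    A.cubicStep hlam (herr t ht).1 (herr t ht).2 (by rwa [hq2]) (by rwa [hq1]) (r.s_min t ht)
  obtain ⟨⟨t, htN, hts⟩, hbd⟩ := exists_last_of_descent (Φ := proxy f g lam) (x := r.x) (s := r.s)
    (T := T) hM hq0
    (fun t ht hs => by
      rw [r.x_step t ht]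
      exact (hstep t ht).descent H.hasFDerivAt_proxy H.hasFDerivAt_proxyD hlip hc0 hcM hq0.le hs)
    hΔ (fun y => by
      rw [r.x_zero]
      refine H.proxy_gap A.phi_bdd ?_ y
      rwa [← mul_div_assoc])
    (fun t ht => by have := r.no_break t ht; rw [hq]; linarith)
    (r.ends.imp id fun ⟨t, h1, h2⟩ => ⟨t, h1, by rw [hq]; linarith⟩) (by
      have h1 := mul_le_mul_of_nonneg_left hT (show 0 ≤ M * q ^ 3 by positivity)
      have h2 : M * q ^ 3 * (400 * (gap f g x₀ * Real.sqrt M * ε ^ (-(3 / 2) : ℝ)))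
          = 400 * gap f g x₀ * (M * q ^ 3 * (Real.sqrt M * ε ^ (-(3 / 2) : ℝ))) := by ring
      rwa [h2, hq3, mul_one] at h1)
  refine ⟨?_, hbd⟩
  have hx : r.output = r.x t + r.s t := by rw [Run.output, htN, r.x_step t (by omega)]
  have S := hstep t (by omega)
  rw [hx]
  refine H.isSOSP ?_ (fun v => ?_) hb1 hb2
  · have := S.norm_deriv_le H.hasFDerivAt_proxyD hlip hc0 hcM hq0.le hts
    rwa [hq2] at this
  · have := S.hess_ge hlip hc0 hcM hq0.le hts v
    rwa [hq1] at this

end Outer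

end FSBA
end

noncomputable section
set_option linter.unusedSectionVars false
namespace FSBA

/-! ### Logarithmic bounds on the inner iteration counts. -/

theorem IsSOSP.mono {E : Type*} [NormedAddCommGroup E] [InnerProductSpace ℝ E] [CompleteSpace E]
    {φ : E → ℝ} {ε ε' τ τ' : ℝ} {x : E} (h : IsSOSP φ ε τ x) (hε : ε ≤ ε') (hτ : τ ≤ τ') :
    IsSOSP φ ε' τ' x :=
  ⟨h.1, h.2.1.trans hε, fun m hm => (neg_le_neg hτ).trans (h.2.2 m hm)⟩

theorem natCeil_le_add_one {x y : ℝ} (hxy : x ≤ y) (hy : 0 ≤ y) : (⌈x⌉₊ : ℝ) ≤ y + 1 :=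
  (Nat.cast_le.2 (Nat.ceil_mono hxy)).trans (Nat.ceil_lt_add_one hy).le

/-- The constant B is absorbed into a multiple of log P, which is at least log 2. -/
theorem log_le_mul_log {z B P : ℝ} {n : ℕ} (hz : 0 ≤ z) (hB : 1 ≤ B) (hP : 2 ≤ P)
    (h : z ≤ B * P ^ n) : Real.log z ≤ (Real.log B / Real.log 2 + n) * Real.log P := by
  have hlogB := Real.log_nonneg hB
  have hlog2 : 0 < Real.log 2 := Real.log_pos (by norm_num)
  have hlogP : Real.log 2 ≤ Real.log P := Real.log_le_log (by norm_num) hP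
  have hBP : Real.log (B * P ^ n) = Real.log B + n * Real.log P := by
    rw [Real.log_mul (by positivity) (by positivity), Real.log_pow]
  have h1 : Real.log B ≤ Real.log B / Real.log 2 * Real.log P := by
    rw [div_mul_eq_mul_div, le_div_iff₀ hlog2]
    gcongr
  have h2 : Real.log z ≤ Real.log (B * P ^ n) := by
    -- For z = 0 the convention log 0 = 0 still leaves a true bound, the right side being
    -- nonnegative.
    rcases hz.eq_or_lt with rfl | hz
    · rw [Real.log_zero, hBP]
      have : 0 ≤ Real.log P := hlog2.le.trans hlogP
      positivity
    · exact Real.log_le_log hz h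
  rw [hBP] at h2
  linarith

/-- `P` dominates the problem parameters, and `M` the smoothness constant. -/
structure Dominates (P κ Λ ε Δ R M : ℝ) : Prop where
  two_le : 2 ≤ P
  one_le_kappa : 1 ≤ κ
  kappa_le : κ ≤ P
  Λ_pos : 0 < Λ
  Λ_le : Λ ≤ P
  eps_pos : 0 < ε
  eps_inv_le : 1 / ε ≤ P
  gap_pos : 0 < Δ
  gap_le : Δ ≤ P
  gap_inv_le : 1 / Δ ≤ P
  R_nonneg : 0 ≤ R
  R_le : R ≤ P
  Λ_le_M : Λ ≤ M

namespace Dominates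

variable {P κ Λ ε Δ R M : ℝ}

theorem of_sum (hκ : 1 ≤ κ) (hΛ : 0 < Λ) (hε : 0 < ε) (hΔ : 0 < Δ) (hR : 0 ≤ R) (hM : Λ ≤ M) :
    Dominates (2 + κ + Λ + 1 / ε + Δ + 1 / Δ + R) κ Λ ε Δ R M := by
  have h1 : 0 < 1 / ε := by positivity
  have h2 : 0 < 1 / Δ := by positivity
  constructor <;> first | assumption | linarith

theorem sqrt_Λ_le (D : Dominates P κ Λ ε Δ R M) : Real.sqrt Λ ≤ P := by
  have := D.two_le
  rw [Real.sqrt_le_left (by linarith)]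
  nlinarith [D.Λ_le]

theorem Λ_div_sqrt_le (D : Dominates P κ Λ ε Δ R M) :
    Λ / Real.sqrt (M * ε) ≤ Real.sqrt Λ * P := by
  have h2 := D.two_le
  have hε := D.eps_pos
  have hΛ := D.Λ_pos
  have h1 : Real.sqrt (1 / ε) ≤ P := by
    rw [Real.sqrt_le_left (by linarith)]
    nlinarith [D.eps_inv_le]
  have h3 : Λ / Real.sqrt (Λ * ε) = Real.sqrt Λ * Real.sqrt (1 / ε) := by
    rw [Real.sqrt_mul hΛ.le, Real.sqrt_div zero_le_one, Real.sqrt_one]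
    nth_rw 1 [← Real.mul_self_sqrt hΛ.le]
    have := Real.sqrt_pos.2 hΛ
    have := Real.sqrt_pos.2 hε
    field_simp
  calc Λ / Real.sqrt (M * ε) ≤ Λ / Real.sqrt (Λ * ε) := by
        gcongr
        exact D.Λ_le_M
    _ ≤ _ := by rw [h3]; gcongr

theorem penalty_le (D : Dominates P κ Λ ε Δ R M) : penalty Λ κ Δ ε M ≤ P ^ 7 := by
  have h2 := D.two_le
  have h1 : 1 ≤ P := by linarith
  have hκ : 0 ≤ κ := by linarith [D.one_le_kappa]
  have hΛ := D.Λ_pos.le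
  have hε := D.eps_pos
  have hΔ := D.gap_pos
  refine max_le ?_ (max_le ?_ ?_)
  · calc Λ * κ ^ 2 / Δ = Λ * κ ^ 2 * (1 / Δ) := by ring
      _ ≤ P * P ^ 2 * P := by
        gcongr
        exacts [D.Λ_le, D.kappa_le, D.gap_inv_le]
      _ = P ^ 4 := by ring
      _ ≤ P ^ 7 := pow_le_pow_right₀ h1 (by norm_num)
  · calc Λ * κ ^ 3 / ε = Λ * κ ^ 3 * (1 / ε) := by ring
      _ ≤ P * P ^ 3 * P := by
        gcongr
        exacts [D.Λ_le, D.kappa_le, D.eps_inv_le]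
      _ = P ^ 5 := by ring
      _ ≤ P ^ 7 := pow_le_pow_right₀ h1 (by norm_num)
  · calc Λ * κ ^ 5 / Real.sqrt (M * ε) = Λ / Real.sqrt (M * ε) * κ ^ 5 := by ring
      _ ≤ P * P * P ^ 5 := by
        gcongr
        · exact D.Λ_div_sqrt_le.trans (by gcongr; exact D.sqrt_Λ_le)
        · exact D.kappa_le
      _ = P ^ 7 := by ring

theorem penalty_pos (D : Dominates P κ Λ ε Δ R M) : 0 < penalty Λ κ Δ ε M := by
  refine lt_max_of_lt_left ?_
  have := D.Λ_pos
  have := D.gap_pos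
  have := D.one_le_kappa
  positivity

/-- The factor √Λ is kept apart on purpose: P does not control 1/Λ, so ‖s_t‖ alone cannot be bounded
by a power of P, but √Λ‖s_t‖ can. -/
theorem acc_inv_le (D : Dominates P κ Λ ε Δ R M) {a lam C₂ : ℝ} (ha : 0 < a) (hlam : 0 < lam)
    (hC₂ : 0 < C₂) (hC : C₂ ≤ a * (lam * Λ * κ ^ 2)) :
    1 / innerAcc Λ lam ε M C₂ ≤ Real.sqrt Λ * (lam * (768 + 96 * a) * P ^ 3) := by
  have h2 := D.two_le
  have h1 : 1 ≤ P := by linarith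
  have hκ : 0 ≤ κ := by linarith [D.one_le_kappa]
  have hΛ := D.Λ_pos
  have hε := D.eps_pos
  have hM : 0 < M := hΛ.trans_le D.Λ_le_M
  have hS := Real.sqrt_pos.2 hΛ
  have hq : 0 < Real.sqrt (M * ε) := Real.sqrt_pos.2 (by positivity)
  have hB : 0 < Real.sqrt Λ * (lam * (768 + 96 * a) * P ^ 3) := by positivity
  rw [one_div_le (by unfold innerAcc; positivity) hB]
  refine le_min ?_ ?_
  · rw [one_div_le hB (by positivity)]
    calc 1 / (1 / 192 * ε / (4 * lam * Λ)) = 768 * lam * Λ * (1 / ε) := by field_simp; norm_num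
      _ ≤ 768 * lam * Λ * P := by gcongr; exact D.eps_inv_le
      _ = Real.sqrt Λ * (lam * (768 * (Real.sqrt Λ * P))) := by
        nth_rw 1 [← Real.mul_self_sqrt hΛ.le]
        ring
      _ ≤ Real.sqrt Λ * (lam * ((768 + 96 * a) * P ^ 3)) := by
        gcongr
        · linarith
        · calc Real.sqrt Λ * P ≤ P * P := by gcongr; exact D.sqrt_Λ_le
            _ = P ^ 2 := by ring
            _ ≤ P ^ 3 := pow_le_pow_right₀ h1 (by norm_num)
      _ = _ := by ring
  · rw [one_div_le hB (by positivity)]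
    calc 1 / (1 / 48 * Real.sqrt (M * ε) / (2 * C₂)) = 96 * C₂ / Real.sqrt (M * ε) := by
          field_simp; norm_num
      _ ≤ 96 * (a * (lam * Λ * κ ^ 2)) / Real.sqrt (M * ε) := by gcongr
      _ = 96 * a * lam * (Λ / Real.sqrt (M * ε)) * κ ^ 2 := by ring
      _ ≤ 96 * a * lam * (Real.sqrt Λ * P) * P ^ 2 := by
        gcongr
        exacts [D.Λ_div_sqrt_le, D.kappa_le]
      _ = Real.sqrt Λ * (lam * (96 * a) * P ^ 3) := by ring
      _ ≤ _ := by gcongr; linarith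

/-- After cubing, Λ^(3/2) r³ = √Λ · Λr³ ≤ P · 48P, which is below (7P)³. -/
theorem sqrt_Λ_mul_le (D : Dominates P κ Λ ε Δ R M) {r : ℝ} (hr : 0 ≤ r)
    (h : M * r ^ 3 ≤ 48 * Δ) : Real.sqrt Λ * r ≤ 7 * P := by
  have h2 := D.two_le
  refine le_of_pow_le_pow_left₀ (n := 3) (by norm_num) (by linarith) ?_
  calc (Real.sqrt Λ * r) ^ 3 = Real.sqrt Λ * ((Real.sqrt Λ * Real.sqrt Λ) * r ^ 3) := by ring
    _ = Real.sqrt Λ * (Λ * r ^ 3) := by rw [Real.mul_self_sqrt D.Λ_pos.le]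
    _ ≤ P * (48 * P) := by
      refine mul_le_mul D.sqrt_Λ_le ?_ (mul_nonneg D.Λ_pos.le (by positivity)) (by linarith)
      calc Λ * r ^ 3 ≤ M * r ^ 3 := by gcongr; exact D.Λ_le_M
        _ ≤ 48 * Δ := h
        _ ≤ 48 * P := by gcongr; exact D.gap_le
    _ ≤ (7 * P) ^ 3 := by nlinarith [sq_nonneg P]

theorem sqrt_three_le (D : Dominates P κ Λ ε Δ R M) : Real.sqrt (3 * κ + 1) ≤ 2 * P := by
  have h2 := D.two_le
  rw [Real.sqrt_le_left (by linarith)]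
  nlinarith [D.kappa_le]

/-- The exponent in the logarithmic factor of the number of inner iterations. -/
def logConst (a : ℝ) : ℝ := Real.log (58 * (768 + 96 * a)) / Real.log 2 + (14 : ℕ)

theorem logConst_nonneg {a : ℝ} (ha : 0 < a) : 0 ≤ logConst a := by
  have : 0 ≤ Real.log (58 * (768 + 96 * a)) := Real.log_nonneg (by linarith)
  have : 0 < Real.log 2 := Real.log_pos (by norm_num)
  unfold logConst
  positivity

theorem innerSteps_le (D : Dominates P κ Λ ε Δ R M) {a C₂ : ℝ} (ha : 0 < a)
    (hC₂ : 0 < C₂) (hC : C₂ ≤ a * (penalty Λ κ Δ ε M * Λ * κ ^ 2))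
    {E : Type*} [NormedAddCommGroup E] {s : ℕ → E} {t : ℕ}
    (hs : ∀ i, i + 1 = t → M * ‖s i‖ ^ 3 ≤ 48 * Δ) :
    (innerSteps κ (3 * κ) (innerAcc Λ (penalty Λ κ Δ ε M) ε M C₂) R s t : ℝ)
      ≤ 2 * Real.sqrt (3 * κ) * (logConst a * Real.log P) + 1 := by
  have h2 := D.two_le
  have h1 : 1 ≤ P := by linarith
  have hκ1 := D.one_le_kappa
  have hκ : 0 ≤ κ := by linarith
  have hΛ := D.Λ_pos
  have hε := D.eps_pos
  have hM : 0 < M := hΛ.trans_le D.Λ_le_M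
  have hl := D.penalty_pos
  have hl' := D.penalty_le
  have hinv := D.acc_inv_le ha hl hC₂ hC
  have hR := D.R_nonneg
  set lam := penalty Λ κ Δ ε M
  have hacc : 0 < innerAcc Λ lam ε M C₂ := by
    have : 0 < Real.sqrt (M * ε) := Real.sqrt_pos.2 (by positivity)
    unfold innerAcc
    positivity
  set acc := innerAcc Λ lam ε M C₂
  set b := 768 + 96 * a
  have hb : 768 ≤ b := by simp only [b]; linarith
  have hlogP : 0 ≤ Real.log P := Real.log_nonneg h1
  have hinv' : 1 / acc ≤ Real.sqrt Λ * (b * P ^ 10) := hinv.trans <| by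
    calc Real.sqrt Λ * (lam * b * P ^ 3) ≤ Real.sqrt Λ * (P ^ 7 * b * P ^ 3) := by gcongr
      _ = _ := by ring
  have hkey : ∀ z : ℝ, 0 ≤ z → z ≤ 58 * b * P ^ 14 →
      (⌈2 * Real.sqrt (3 * κ) * Real.log z⌉₊ : ℝ)
        ≤ 2 * Real.sqrt (3 * κ) * (logConst a * Real.log P) + 1 := fun z hz hzb => by
    have hc := logConst_nonneg ha
    refine natCeil_le_add_one ?_ (by positivity)
    gcongr
    exact log_le_mul_log hz (by linarith) h2 hzb
  cases t with
  | zero =>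
    refine hkey _ (by positivity) ?_
    calc Real.sqrt (3 * κ + 1) / acc * R = Real.sqrt (3 * κ + 1) * (1 / acc) * R := by ring
      _ ≤ 2 * P * (P * (b * P ^ 10)) * P := by
        gcongr
        · exact D.sqrt_three_le
        · exact hinv'.trans (by gcongr; exact D.sqrt_Λ_le)
        · exact D.R_le
      _ = 2 * b * P ^ 13 := by ring
      _ ≤ 58 * b * P ^ 14 := by
        gcongr
        · norm_num
        · norm_num
  | succ t =>
    refine hkey _ (by positivity) ?_
    -- The separate √Λ in the bound for 1/acc is spent on ‖s_t‖.
    have h3 : 1 / acc * ‖s t‖ ≤ b * P ^ 10 * (7 * P) :=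
      calc 1 / acc * ‖s t‖ ≤ Real.sqrt Λ * (b * P ^ 10) * ‖s t‖ := by gcongr
        _ = b * P ^ 10 * (Real.sqrt Λ * ‖s t‖) := by ring
        _ ≤ _ := by
          exact mul_le_mul_of_nonneg_left (D.sqrt_Λ_mul_le (norm_nonneg _) (hs t rfl))
            (by positivity)
    have h4 : 1 ≤ b * P ^ 12 := by
      have := one_le_pow₀ h1 (n := 12)
      nlinarith
    calc Real.sqrt (3 * κ + 1) / acc * (acc + 4 * κ * ‖s t‖)
        = Real.sqrt (3 * κ + 1) * (1 + 4 * κ * (1 / acc * ‖s t‖)) := by field_simp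
      _ ≤ 2 * P * (b * P ^ 12 + 4 * P * (b * P ^ 10 * (7 * P))) := by
        gcongr
        · exact D.sqrt_three_le
        · exact D.kappa_le
      _ = 58 * b * P ^ 13 := by ring
      _ ≤ 58 * b * P ^ 14 := by
        gcongr
        norm_num

end Dominates

end FSBA
end

noncomputable section
set_option linter.unusedSectionVars false
namespace FSBA

/-! ### Oracle complexity. -/

section Counts

variable {E F : Type*} [NormedAddCommGroup E] [InnerProductSpace ℝ E] [CompleteSpace E]
  [NormedAddCommGroup F] [InnerProductSpace ℝ F] [CompleteSpace F] {f g : E → F → ℝ}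
  {P κ Λ ε Δ R M lam ℓ₁ ℓ₂ κ₁ κ₂ a C₂ : ℝ} {x₀ : E} {T : ℕ} {K₁ K₂ : ℕ → ℕ}

/-- The bound on the number of iterations. -/
theorem Dominates.iterations_le (D : Dominates P κ Λ ε Δ R M) (ha : 0 < a)
    (hM : M ≤ a * (Λ * κ ^ 5)) (hT : (T : ℝ) ≤ a * (Δ * Real.sqrt M * ε ^ (-(3 / 2) : ℝ)))
    (r : Run f g lam x₀ T ℓ₁ ℓ₂ κ₁ κ₂ ε M K₁ K₂) :
    (r.N : ℝ) ≤ a * Real.sqrt a * (Δ * (κ ^ 2 * Real.sqrt κ) * Real.sqrt Λ * ε ^ (-(3 / 2) : ℝ)) := by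
  have hκ : 0 ≤ κ := by linarith [D.one_le_kappa]
  have hΔ := D.gap_pos
  have hε := D.eps_pos
  have h1 : Real.sqrt M ≤ Real.sqrt a * (Real.sqrt Λ * (κ ^ 2 * Real.sqrt κ)) := by
    refine (Real.sqrt_le_sqrt hM).trans (le_of_eq ?_)
    rw [Real.sqrt_mul ha.le, Real.sqrt_mul D.Λ_pos.le, show κ ^ 5 = (κ ^ 2) ^ 2 * κ by ring,
      Real.sqrt_mul (by positivity), Real.sqrt_sq (by positivity)]
  calc (r.N : ℝ) ≤ T := Nat.cast_le.2 r.N_le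
    _ ≤ a * (Δ * Real.sqrt M * ε ^ (-(3 / 2) : ℝ)) := hT
    _ ≤ a * (Δ * (Real.sqrt a * (Real.sqrt Λ * (κ ^ 2 * Real.sqrt κ))) * ε ^ (-(3 / 2) : ℝ)) := by
      gcongr
    _ = _ := by ring

/-- The iteration bound carries κ^(5/2), and each iteration costs a further √κ log P, which makes
κ³. -/
theorem Dominates.firstOrderCalls_le (D : Dominates P κ Λ ε Δ R M) (ha : 0 < a)
    (hM : M ≤ a * (Λ * κ ^ 5)) (hT : (T : ℝ) ≤ a * (Δ * Real.sqrt M * ε ^ (-(3 / 2) : ℝ)))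
    (hC₂ : 0 < C₂) (hC : C₂ ≤ a * (penalty Λ κ Δ ε M * Λ * κ ^ 2))
    (r : Run f g lam x₀ T ℓ₁ ℓ₂ κ₁ κ₂ ε M K₁ K₂)
    (h₁ : ∀ t < r.N, K₁ t
      = innerSteps κ (3 * κ) (innerAcc Λ (penalty Λ κ Δ ε M) ε M C₂) R r.s t)
    (h₂ : ∀ t < r.N, K₂ t
      = innerSteps κ (3 * κ) (innerAcc Λ (penalty Λ κ Δ ε M) ε M C₂) R r.s t)
    (hs : ∀ t, t + 1 < r.N → M * ‖r.s t‖ ^ 3 ≤ 48 * Δ) :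
    (r.firstOrderCalls : ℝ) ≤ a * Real.sqrt a * (12 * Dominates.logConst a + 9)
      * (Δ * κ ^ 3 * Real.sqrt Λ * ε ^ (-(3 / 2) : ℝ)) * Real.log P := by
  have hκ1 := D.one_le_kappa
  have hκ : 0 ≤ κ := by linarith
  have hΔ := D.gap_pos
  have hε := D.eps_pos
  have hb := Dominates.logConst_nonneg ha
  -- 9 · 0.69 > 6, so 9√κ log P absorbs the additive constants 3 and 3·1 of one iteration.
  have hlogP : 0.69 ≤ Real.log P :=
    (by linarith [Real.log_two_gt_d9] : (0.69 : ℝ) ≤ Real.log 2).trans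
      (Real.log_le_log (by norm_num) D.two_le)
  have hlogP0 : 0 ≤ Real.log P := by linarith
  have hsq1 : 1 ≤ Real.sqrt κ := Real.one_le_sqrt.2 hκ1
  have hsq3 : Real.sqrt (3 * κ) ≤ 2 * Real.sqrt κ := by
    rw [Real.sqrt_mul (by norm_num)]
    gcongr
    rw [Real.sqrt_le_left (by norm_num)]
    norm_num
  have hN := D.iterations_le ha hM hT r
  set b := Dominates.logConst a
  have hterm : ∀ t ∈ Finset.range r.N, ((K₁ t + 2 * K₂ t + 3 : ℕ) : ℝ)
      ≤ (12 * b + 9) * (Real.sqrt κ * Real.log P) := fun t ht => by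
    rw [Finset.mem_range] at ht
    have h3 := D.innerSteps_le ha hC₂ hC (s := r.s) (t := t) fun i hi => hs i (hi ▸ ht)
    rw [← h₁ t ht] at h3
    have h4 : K₂ t = K₁ t := (h₂ t ht).trans (h₁ t ht).symm
    have h5 : Real.sqrt (3 * κ) * (b * Real.log P)
        ≤ 2 * Real.sqrt κ * (b * Real.log P) := by gcongr
    have h6 : 0.69 ≤ Real.sqrt κ * Real.log P := by nlinarith
    push_cast
    rw [h4]
    linarith
  calc (r.firstOrderCalls : ℝ)
      = ∑ t ∈ Finset.range r.N, ((K₁ t + 2 * K₂ t + 3 : ℕ) : ℝ) := by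
        rw [Run.firstOrderCalls, Nat.cast_sum]
    _ ≤ r.N * ((12 * b + 9) * (Real.sqrt κ * Real.log P)) := by
      simpa using Finset.sum_le_sum hterm
    _ ≤ a * Real.sqrt a * (Δ * (κ ^ 2 * Real.sqrt κ) * Real.sqrt Λ * ε ^ (-(3 / 2) : ℝ))
        * ((12 * b + 9) * (Real.sqrt κ * Real.log P)) := by gcongr
    _ = a * Real.sqrt a * (12 * b + 9)
        * (Δ * (κ ^ 2 * (Real.sqrt κ * Real.sqrt κ)) * Real.sqrt Λ * ε ^ (-(3 / 2) : ℝ))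
        * Real.log P := by ring
    _ = _ := by rw [Real.mul_self_sqrt hκ]; ring

end Counts

theorem rpow_five_halves {κ : ℝ} (hκ : 0 < κ) : κ ^ (5 / 2 : ℝ) = κ ^ 2 * Real.sqrt κ := by
  rw [show (5 / 2 : ℝ) = (2 : ℕ) + 1 / 2 by norm_num, Real.rpow_add hκ, Real.rpow_natCast,
    Real.sqrt_eq_rpow]

theorem sqrt_mul_le_rpow {M a Λ κ ε : ℝ} (ha : 0 ≤ a) (hΛ : 0 ≤ Λ) (hκ : 0 < κ) (hM0 : 0 ≤ M)
    (hM : M ≤ a * (Λ * κ ^ 5)) :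
    Real.sqrt (M * ε)
      ≤ Real.sqrt a * (κ ^ (5 / 2 : ℝ) * Λ ^ (1 / 2 : ℝ) * ε ^ (1 / 2 : ℝ)) := by
  rw [rpow_five_halves hκ, ← Real.sqrt_eq_rpow, ← Real.sqrt_eq_rpow, Real.sqrt_mul hM0]
  have h1 : Real.sqrt M ≤ Real.sqrt a * (Real.sqrt Λ * (κ ^ 2 * Real.sqrt κ)) := by
    refine (Real.sqrt_le_sqrt hM).trans (le_of_eq ?_)
    rw [Real.sqrt_mul ha, Real.sqrt_mul hΛ, show κ ^ 5 = (κ ^ 2) ^ 2 * κ by ring,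
      Real.sqrt_mul (by positivity), Real.sqrt_sq (by positivity)]
  calc Real.sqrt M * Real.sqrt ε
      ≤ Real.sqrt a * (Real.sqrt Λ * (κ ^ 2 * Real.sqrt κ)) * Real.sqrt ε := by gcongr
    _ = _ := by ring

end FSBA
end

/-! ### Choice of the constants and assembly. -/

theorem theorem3p4 :
    -- absolute constants in `M = Ω(ρ̄)` and in the lower half of `T = Θ(Δ √M ε^(-3/2))`
    ∃ cM cT : ℝ, 0 < cM ∧ 0 < cT ∧
    -- for every bound `a` on the remaining hidden constants of the parameters there is a
    -- constant `A`, depending on `a` only, for which the conclusions hold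
    ∀ a : ℝ, 0 < a → ∃ A : ℝ, 0 < A ∧
    ∀ (dx dy : ℕ), 0 < dy →
    ∀ (f g : EuclideanSpace ℝ (Fin dx) → EuclideanSpace ℝ (Fin dy) → ℝ) (μ C ℓ ρ ν : ℝ),
    FSBA.Assumptions f g μ C ℓ ρ ν →
    ∀ (x₀ : EuclideanSpace ℝ (Fin dx)) (ε M lam C₂ acc R ℓb κ Δ : ℝ) (T : ℕ) (K₁ K₂ : ℕ → ℕ),
    ℓb = FSBA.ellBar C ℓ ρ ν →
    κ = FSBA.kappa μ C ℓ ρ ν →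
    Δ = FSBA.gap f g x₀ →
    0 < ε → 0 < Δ →
    cM * (ℓb * κ ^ 5) ≤ M → M ≤ a * (ℓb * κ ^ 5) →
    lam = FSBA.penalty ℓb κ Δ ε M →
    2 * ℓ / μ ≤ lam →
    0 < C₂ → FSBA.hessSens μ ℓ ρ lam ≤ C₂ → C₂ ≤ a * (lam * ℓb * κ ^ 2) →
    acc = FSBA.innerAcc ℓb lam ε M C₂ →
    R = max ‖FSBA.yStar g x₀‖ ‖FSBA.yStarLam f g lam x₀‖ →
    cT * (Δ * Real.sqrt M * ε ^ (-(3 / 2) : ℝ)) ≤ T →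
    (T : ℝ) ≤ a * (Δ * Real.sqrt M * ε ^ (-(3 / 2) : ℝ)) →
    ∀ r : FSBA.Run f g lam x₀ T ℓ ((1 + lam) * ℓ) κ (3 * κ) ε M K₁ K₂,
    (∀ t < r.N, K₁ t = FSBA.innerSteps κ (3 * κ) acc R r.s t) →
    (∀ t < r.N, K₂ t = FSBA.innerSteps κ (3 * κ) acc R r.s t) →
    FSBA.IsSOSP (FSBA.hyperObj f g) (A * ε)
        (A * (κ ^ (5 / 2 : ℝ) * ℓb ^ (1 / 2 : ℝ) * ε ^ (1 / 2 : ℝ))) r.output ∧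
      (r.firstOrderCalls : ℝ) ≤
        A * (Δ * κ ^ (3 : ℝ) * ℓb ^ (1 / 2 : ℝ) * ε ^ (-(3 / 2) : ℝ))
          * Real.log (2 + κ + ℓb + 1 / ε + Δ + 1 / Δ + R) ∧
      (r.secondOrderCalls : ℝ) ≤
        A * (Δ * κ ^ (5 / 2 : ℝ) * ℓb ^ (1 / 2 : ℝ) * ε ^ (-(3 / 2) : ℝ)) := by
  refine ⟨10000, 400, by norm_num, by norm_num, fun a ha => ?_⟩
  have hb := FSBA.Dominates.logConst_nonneg ha
  set b := FSBA.Dominates.logConst a with hbd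
  have hsa := Real.sqrt_nonneg a
  -- The summands serve the gradient bound, the eigenvalue bound and the first-order count; the last
  -- one also covers the factor 3 of the second-order count.
  refine ⟨5 + 49 * Real.sqrt a + a * Real.sqrt a * (12 * b + 9), by positivity, ?_⟩
  intro dx dy hdy f g μ C ℓ ρ ν A x₀ ε M lam C₂ acc R ℓb κ Δ T K₁ K₂ hℓb hκ hΔ hε hΔ0 hM hM'
    hlam hlam2 hC₂ hC₂l hC₂u hacc hR hT hT' r h₁ h₂
  -- A positive dimension makes the y-space nontrivial, as the derivative bounds need.
  have : Nonempty (Fin dy) := ⟨⟨0, hdy⟩⟩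
  have H := A.reg hlam2
  have hΛ := H.Λ_pos
  have hκ1 := A.one_le_kappa
  rw [← hκ] at hκ1
  rw [← hℓb] at hΛ
  have hκ0 : 0 < κ := by linarith
  have hκ5 : 1 ≤ κ ^ 5 := one_le_pow₀ hκ1
  have hR0 : 0 ≤ R := hR ▸ le_max_of_le_left (norm_nonneg _)
  have hΛM : ℓb ≤ M := by nlinarith
  have hM0 : 0 < M := hΛ.trans_le hΛM
  have hsq : 0 < Real.sqrt (M * ε) := Real.sqrt_pos.2 (by positivity)
  have D := FSBA.Dominates.of_sum hκ1 hΛ hε hΔ0 hR0 hΛM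
  have hl : 0 < lam := hlam ▸ D.penalty_pos
  have l1 : ℓb * κ ^ 2 / Δ ≤ lam := hlam ▸ le_max_left _ _
  have l2 : ℓb * κ ^ 3 / ε ≤ lam := hlam ▸ (le_max_left _ _).trans (le_max_right _ _)
  have l3 : ℓb * κ ^ 5 / Real.sqrt (M * ε) ≤ lam :=
    hlam ▸ (le_max_right _ _).trans (le_max_right _ _)
  have hacc0 : 0 < acc := by
    rw [hacc, FSBA.innerAcc]
    positivity
  have a1 : acc ≤ 1 / 192 * ε / (4 * lam * ℓb) := hacc ▸ min_le_left _ _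
  have a2 : acc ≤ 1 / 48 * Real.sqrt (M * ε) / (2 * C₂) := hacc ▸ min_le_right _ _
  rw [div_le_iff₀ (by positivity), mul_comm lam] at l1 l2 l3
  rw [le_div_iff₀ (by positivity), mul_comm] at a1 a2
  obtain ⟨hout, hsteps⟩ := A.run_output (R := R) hlam2 hacc0 (hR ▸ le_max_left _ _)
    (by rw [hR, FSBA.yStarLam, FSBA.argmin_lagrangian]; exact le_max_right _ _) hε hM0
    (hΔ ▸ hΔ0) (by rwa [← hℓb, ← hκ])
    -- The value error needs only ℓ̄κ/λ ≤ Δ; the κ² in the penalty is more than enough.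
    (by
      rw [← hℓb, ← hκ, ← hΔ, div_le_iff₀ hl]
      refine le_trans ?_ l1
      gcongr
      exact le_self_pow₀ hκ1 (by norm_num))
    (by rwa [← hℓb, ← hκ, div_le_iff₀ hl]) (by rwa [← hℓb, ← hκ, div_le_iff₀ hl])
    (by rw [← hℓb]; linarith)
    (by
      have : 2 * FSBA.hessSens μ ℓ ρ lam * acc ≤ 2 * C₂ * acc := by gcongr
      linarith)
    (by rwa [← hΔ]) (hκ ▸ r) (by subst hκ; exact h₁) (by subst hκ; exact h₂)
  subst hκ
  rw [← hΔ] at hsteps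
  subst hlam hacc
  have hN := D.iterations_le ha hM' hT' r
  have hF := D.firstOrderCalls_le ha hM' hT' hC₂ hC₂u r h₁ h₂ hsteps
  refine ⟨hout.mono ?_ ?_, hF.trans ?_, ?_⟩
  · gcongr
    have : 0 ≤ a * Real.sqrt a * (12 * b + 9) := by positivity
    linarith
  · have h3 := FSBA.sqrt_mul_le_rpow (ε := ε) ha.le hΛ.le hκ0 hM0.le hM'
    refine (mul_le_mul_of_nonneg_left h3 (by norm_num : (0 : ℝ) ≤ 49)).trans ?_
    rw [← mul_assoc]
    gcongr
    have : 0 ≤ a * Real.sqrt a * (12 * b + 9) := by positivity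
    linarith
  · rw [← Real.sqrt_eq_rpow, show (3 : ℝ) = (3 : ℕ) by norm_num, Real.rpow_natCast]
    have := Real.log_nonneg (by linarith [D.two_le] :
      1 ≤ 2 + FSBA.kappa μ C ℓ ρ ν + ℓb + 1 / ε + Δ + 1 / Δ + R)
    gcongr
    linarith
  · rw [FSBA.rpow_five_halves hκ0, ← Real.sqrt_eq_rpow]
    have h3 : (r.secondOrderCalls : ℝ) = 3 * r.N := by
      simp [FSBA.Run.secondOrderCalls, mul_comm]
    rw [h3]
    refine (mul_le_mul_of_nonneg_left hN (by norm_num)).trans ?_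
    rw [← mul_assoc]
    gcongr
    nlinarith [mul_nonneg (mul_nonneg ha.le hsa) hb, mul_nonneg ha.le hsa]
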